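/- Let $G\subset SL(3,\mathbf C)$ be a finite abelian group, and choose coordinates $x,y,z$ of $\mathbf C^3$ in which $G$ is diagonal. Let $M_G\subset\mathbf Z^3$ be the lattice of exponents of $G$-invariant Laurent monomials, $N_G$ its dual lattice, and $\Sigma_G$ the fan in $N_G\otimes\mathbf R$, subdividing the positive octant, of the toric variety $X=G\text{-Hilb}\,\mathbf C^3$. (Two weights $w,w'\in\mathbf R^3_{\ge 0}$ lie in the relative interior of the same cone of $\Sigma_G$ iff, for each character of $G$, the same monomials of $\mathbf C[x,y,z]$ with that character have minimal $w$-weight, respectively minimal $w'$-weight.) Let $\nu_1,\dots,\nu_{r+3}\in N_G$ be the primitive generators of the one-dimensional cones of $\Sigma_G$, and fix an isomorphism $\varphi:N_G\simeq\mathbf Z^3$ with $\varphi(\nu_k)=(1,\bar\nu_k)$, $\bar\nu_k=(\bar\nu_{k,2},\bar\nu_{k,3})\in\mathbf Z^2$, for all $k$. For $a\in\mathbf C^{r+3}$ put $$F(a;U,V,W_1,W_2)=U^2+V^2+\sum_k a_kW_1^{\bar\nu_{k,2}}W_2^{\bar\nu_{k,3}},$$ and let $Y_a$ be the locus in $\mathbf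 C^2\times(\mathbf C^*)^2$ where $F(a;\cdot)=0$ and $d_{U,V,W}F(a;\cdot)\neq0$; this is the whole hypersurface $\{F(a;\cdot)=0\}$ whenever $dF$ vanishes nowhere on it. Let $\mathrm{Res}_{F=0}\big(\tfrac1F\,dU\,dV\,\tfrac{dW_1}{W_1}\tfrac{dW_2}{W_2}\big)$ be the holomorphic 3-form $\omega$ on $Y_a$ with $dF\wedge\omega=dU\wedge dV\wedge\frac{dW_1}{W_1}\wedge\frac{dW_2}{W_2}$, and for $L\in H_3(Y_a,\mathbf Z)$ put $$\Pi_L(a)=\frac1{4\pi^3}\int_L \mathrm{Res}_{F=0}\Big(\frac{1}{F}\,dU\,dV\,\frac{dW_1}{W_1}\frac{dW_2}{W_2}\Big),$$ the integral being taken over any smooth singular cycle that represents $L$. A family of classes $L_a\in H_3(Y_a,\mathbf Z)$, $a\in D$, $D\subset\mathbf C^{r+3}$ open, is called flat if near every point of $D$ it has the form $L_a=(\Phi_a)_*\ell$, where $\ell$ is a fixed class in $H_3(Y_b\cap U,\mathbf Z)$ for some nearby parameter $b$ and some open $U\subset\mathbf C^4$, and $\Phi_a:Y_b\cap U\to Y_a$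 are maps given by a map $(a,p)\mapsto\Phi_a(p)$ that is $C^\infty$ for $a$ in a neighbourhood of the point and $p\in U$, with $\Phi_b$ the inclusion. Then: 1. $\Pi_L(a)$ is well defined: it does not depend on the cycle chosen in the class $L$. 2. For every $a_0\in\mathbf C^{r+3}$ and every $L_0\in H_3(Y_{a_0},\mathbf Z)$ there is a flat family $L_a$ over an open neighbourhood of $a_0$ with $L_{a_0}=L_0$. 3. For every flat family $L=(L_a)_{a\in D}$ over an open set $D\subset\mathbf C^{r+3}$, the period integral $\Pi_L(a)=\Pi_{L_a}(a)$ is a holomorphic function on $D$, and on $D$ $$\Box_l\,\Pi_L(a)=0\quad(l\in\mathcal L),\qquad \mathcal Z_i\,\Pi_L(a)=0\quad(i=1,2,3),$$ where $\mathcal L=\{(l_1,\dots,l_{r+3})\in\mathbf Z^{r+3}\mid\sum_k l_k\nu_k=0\}$, $$\Box_l=\Big(\frac{\partial}{\partial a}\Big)^{l^+}-\Big(\frac{\partial}{\partial a}\Big)^{l^-},\qquad l_k^{\pm}=\tfrac12(|l_k|\pm l_k),$$ and, with $\theta_k=a_k\frac{\partial}{\partial a_k}$, $$\mathcal Z_1=\sum_k\theta_k,\qquad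 \mathcal Z_2=\sum_k\bar\nu_{k,2}\,\theta_k,\qquad \mathcal Z_3=\sum_k\bar\nu_{k,3}\,\theta_k .$$ -/

import Mathlib

open scoped ContDiff MatrixGroups

noncomputable section

namespace LocalMirror

/-! ### Toric data of `G`-Hilb `ℂ³` -/

/-- The entries of the matrix of `g` in the eigenbasis given by `P`: the `i`-th coordinate function
on `ℂ³` is multiplied by `eigenChar P g i`. -/
def eigenChar (P : GL (Fin 3) ℂ) (g : SL(3, ℂ)) (i : Fin 3) : ℂ :=
  ((P : Matrix (Fin 3) (Fin 3) ℂ) * (g : Matrix (Fin 3) (Fin 3) ℂ) *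
    ((P⁻¹ : GL (Fin 3) ℂ) : Matrix (Fin 3) (Fin 3) ℂ)) i i

/-- `M_G`: the exponents of the `G`-invariant Laurent monomials in the eigen-coordinates. -/
def latticeM (G : Subgroup SL(3, ℂ)) (P : GL (Fin 3) ℂ) : Set (Fin 3 → ℤ) :=
  {m | ∀ g ∈ G, ∏ i, eigenChar P g i ^ m i = 1}

/-- `N_G`: the lattice dual to `M_G`, inside `ℝ³`. -/
def latticeN (G : Subgroup SL(3, ℂ)) (P : GL (Fin 3) ℂ) : AddSubgroup (Fin 3 → ℝ) where
  carrier := {v | ∀ m ∈ latticeM G P, ∃ z : ℤ, ∑ i, (m i : ℝ) * v i = z}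
  zero_mem' := fun m _ => ⟨0, by simp⟩
  add_mem' := by
    intro v w hv hw m hm
    obtain ⟨y, hy⟩ := hv m hm
    obtain ⟨z, hz⟩ := hw m hm
    exact ⟨y + z, by simp [mul_add, Finset.sum_add_distrib, hy, hz]⟩
  neg_mem' := by
    intro v hv m hm
    obtain ⟨y, hy⟩ := hv m hm
    exact ⟨-y, by simp [hy]⟩

/-- The monomial `x ^ m` has minimal `w`-weight among all monomials with the same `G`-character. -/
def IsMinimalMonomial (G : Subgroup SL(3, ℂ)) (P : GL (Fin 3) ℂ) (w : Fin 3 → ℝ)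
    (m : Fin 3 → ℕ) : Prop :=
  ∀ m' : Fin 3 → ℕ, (fun i => (m' i : ℤ) - (m i : ℤ)) ∈ latticeM G P →
    ∑ i, w i * m i ≤ ∑ i, w i * m' i

/-- `w` and `w'` lie in the relative interior of the same cone of the fan `Σ_G` of `G`-Hilb `ℂ³`.

The limit of the free `G`-orbit of `(t ^ w₁, t ^ w₂, t ^ w₃)`, as `t → 0`, is the point of
`G`-Hilb `ℂ³` whose ideal is spanned by the monomials that are not `w`-minimal in their character
class and the differences of `w`-minimal monomials with the same character. Two weights are in the
same relatively open cone of the fan exactly if these limit points agree, that is, if the minimal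
monomials are the same. -/
def SameCone (G : Subgroup SL(3, ℂ)) (P : GL (Fin 3) ℂ) (w w' : Fin 3 → ℝ) : Prop :=
  ∀ m : Fin 3 → ℕ, IsMinimalMonomial G P w m ↔ IsMinimalMonomial G P w' m

/-- The primitive generators (in `N_G`) of the one-dimensional cones of the fan `Σ_G`, whose
support is the positive octant. -/
def rayGenerators (G : Subgroup SL(3, ℂ)) (P : GL (Fin 3) ℂ) : Set (latticeN G P) :=
  {v | v ≠ 0 ∧ (∀ i, 0 ≤ (v : Fin 3 → ℝ) i) ∧
    (∀ w : Fin 3 → ℝ, (∀ i, 0 ≤ w i) →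
      (SameCone G P v w ↔ ∃ c : ℝ, 0 < c ∧ w = c • (v : Fin 3 → ℝ))) ∧
    ∀ (u : latticeN G P) (c : ℝ), 0 < c →
      (u : Fin 3 → ℝ) = c • (v : Fin 3 → ℝ) → 1 ≤ c}

/-- The lattice of integral relations among the vectors `ν k`. -/
def relationLattice {N : Type*} [AddCommGroup N] {K : ℕ} (ν : Fin K → N) :
    AddSubgroup (Fin K → ℤ) where
  carrier := {l | ∑ k, l k • ν k = 0}
  zero_mem' := by simp
  add_mem' := by
    intro a b ha hb
    simp only [Set.mem_ofPred_eq] at ha hb ⊢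
    simp [add_smul, Finset.sum_add_distrib, ha, hb]
  neg_mem' := by
    intro a ha
    simp only [Set.mem_ofPred_eq] at ha ⊢
    simp [ha]

/-! ### Third integral homology, by smooth singular cubes -/

section Homology

variable {E : Type*} [NormedAddCommGroup E] [NormedSpace ℝ E]

/-- Extend a map on the unit cube to `ℝⁿ` by clamping the coordinates (only the values on the cube
matter; this makes calculus on the cube available). -/
def cubeExtend {n : ℕ} (f : (Fin n → unitInterval) → E) : (Fin n → ℝ) → E :=
  fun s => f (fun i => Set.projIcc (0 : ℝ) 1 zero_le_one (s i))

/-- A `C^∞` singular `n`-cube `[0,1]ⁿ → S`. -/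
@[ext]
structure SmoothCube (S : Set E) (n : ℕ) where
  toFun : (Fin n → unitInterval) → E
  mem : ∀ t, toFun t ∈ S
  smooth : ContDiffOn ℝ ∞ (cubeExtend toFun) (Set.Icc 0 1)

/-- The face `t_i = ε` of a singular cube. -/
def SmoothCube.face {S : Set E} {n : ℕ} (i : Fin (n + 1)) (ε : unitInterval)
    (σ : SmoothCube S (n + 1)) : SmoothCube S n where
  toFun t := σ.toFun (i.insertNth ε t)
  mem t := σ.mem _
  smooth := by
    have h1 : ContDiff ℝ ∞ (fun s : Fin n → ℝ => (i.insertNth (ε : ℝ) s : Fin (n + 1) → ℝ)) := by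
      rw [contDiff_pi]
      intro j
      refine Fin.succAboveCases i ?_ (fun k => ?_) j
      · simpa using contDiff_const
      · simpa using contDiff_apply ℝ ℝ k
    have h2 : Set.MapsTo (fun s : Fin n → ℝ => (i.insertNth (ε : ℝ) s : Fin (n + 1) → ℝ))
        (Set.Icc 0 1) (Set.Icc 0 1) := by
      intro s hs
      constructor
      · intro j
        refine Fin.succAboveCases i ?_ (fun k => ?_) j
        · simpa using ε.2.1
        · simpa using hs.1 k
      · intro j
        refine Fin.succAboveCases i ?_ (fun k => ?_) j
        · simpa using ε.2.2
        · simpa using hs.2 k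
    refine (σ.smooth.comp h1.contDiffOn h2).congr ?_
    intro s _
    simp only [cubeExtend, Function.comp]
    congr 1
    ext j
    refine Fin.succAboveCases i ?_ (fun k => ?_) j
    · simp
    · simp

/-- A cube is degenerate if it does not depend on one of its coordinates. -/
def SmoothCube.IsDegenerate {S : Set E} {n : ℕ} (σ : SmoothCube S n) : Prop :=
  ∃ i : Fin n, ∀ (t : Fin n → unitInterval) (x : unitInterval),
    σ.toFun (Function.update t i x) = σ.toFun t

/-- Integral smooth cubical chains. -/
abbrev Chain (S : Set E) (n : ℕ) : Type _ := SmoothCube S n →₀ ℤ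

/-- The boundary `∂σ = ∑ i, (-1)^i (σ|_{t_i = 1} - σ|_{t_i = 0})`, with `i` counted from `0`. -/
def boundary (S : Set E) (n : ℕ) : Chain S (n + 1) →ₗ[ℤ] Chain S n :=
  Finsupp.linearCombination ℤ (fun σ : SmoothCube S (n + 1) =>
    ∑ i : Fin (n + 1), (-1 : ℤ) ^ (i : ℕ) •
      (Finsupp.single (σ.face i 1) (1 : ℤ) - Finsupp.single (σ.face i 0) (1 : ℤ)))

/-- The subgroup spanned by the degenerate cubes. -/
def degenerateChains (S : Set E) (n : ℕ) : Submodule ℤ (Chain S n) :=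
  Submodule.span ℤ {c | ∃ σ : SmoothCube S n, σ.IsDegenerate ∧ c = Finsupp.single σ 1}

/-- Three-dimensional cycles (modulo degenerate chains). -/
def cycles3 (S : Set E) : Submodule ℤ (Chain S 3) :=
  (degenerateChains S 2).comap (boundary S 2)

/-- Three-dimensional boundaries, together with the degenerate chains. -/
def boundaries3 (S : Set E) : Submodule ℤ (Chain S 3) :=
  LinearMap.range (boundary S 3) ⊔ degenerateChains S 3

/-- `H₃(S, ℤ)` as normalized smooth singular cubical homology. For a submanifold `S` this is the
usual third singular homology group. -/
abbrev H3 (S : Set E) : Type _ :=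
  cycles3 S ⧸ (boundaries3 S).submoduleOf (cycles3 S)

/-- The homology class of a cycle. -/
def H3.mk {S : Set E} (c : cycles3 S) : H3 S :=
  Submodule.Quotient.mk c

variable {E' : Type*} [NormedAddCommGroup E'] [NormedSpace ℝ E']

/-- Composition of a singular cube with a smooth map. -/
def SmoothCube.map {S : Set E} {T : Set E'} (φ : E → E') (hφ : ContDiffOn ℝ ∞ φ S)
    (hST : Set.MapsTo φ S T) {n : ℕ} (σ : SmoothCube S n) : SmoothCube T n where
  toFun t := φ (σ.toFun t)
  mem t := hST (σ.mem t)
  smooth := hφ.comp σ.smooth (fun _ _ => σ.mem _)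

/-- Push-forward of chains. -/
def Chain.map {S : Set E} {T : Set E'} (φ : E → E') (hφ : ContDiffOn ℝ ∞ φ S)
    (hST : Set.MapsTo φ S T) (n : ℕ) : Chain S n →ₗ[ℤ] Chain T n :=
  Finsupp.lmapDomain ℤ ℤ (SmoothCube.map φ hφ hST)

theorem boundary_map {S : Set E} {T : Set E'} (φ : E → E') (hφ : ContDiffOn ℝ ∞ φ S)
    (hST : Set.MapsTo φ S T) (n : ℕ) (c : Chain S (n + 1)) :
    boundary T n (Chain.map φ hφ hST (n + 1) c) = Chain.map φ hφ hST n (boundary S n c) := by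
  have h : (boundary T n).comp (Chain.map φ hφ hST (n + 1)) =
      (Chain.map φ hφ hST n).comp (boundary S n) := by
    refine Finsupp.lhom_ext' fun σ => LinearMap.ext_ring ?_
    simp only [boundary, Chain.map, LinearMap.comp_apply, Finsupp.lsingle_apply,
      Finsupp.lmapDomain_apply, Finsupp.mapDomain_single, Finsupp.linearCombination_single,
      one_smul]
    rw [← Finsupp.lmapDomain_apply ℤ ℤ, map_sum]
    refine Finset.sum_congr rfl fun i _ => ?_
    rw [map_smul, map_sub]
    simp only [Finsupp.lmapDomain_apply, Finsupp.mapDomain_single]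
    rfl
  exact LinearMap.congr_fun h c

theorem degenerate_map {S : Set E} {T : Set E'} (φ : E → E') (hφ : ContDiffOn ℝ ∞ φ S)
    (hST : Set.MapsTo φ S T) (n : ℕ) (c : Chain S n) (hc : c ∈ degenerateChains S n) :
    Chain.map φ hφ hST n c ∈ degenerateChains T n := by
  have h : degenerateChains S n ≤ (degenerateChains T n).comap (Chain.map φ hφ hST n) := by
    refine Submodule.span_le.2 ?_
    rintro _ ⟨σ, ⟨i, hi⟩, rfl⟩
    refine Submodule.subset_span ⟨σ.map φ hφ hST, ⟨i, fun t x => ?_⟩, ?_⟩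
    · simp [SmoothCube.map, hi t x]
    · simp [Chain.map, Finsupp.mapDomain_single]
  exact h hc

/-- The map `φ_* : H₃(S, ℤ) → H₃(T, ℤ)` induced by a smooth map `φ : S → T`. -/
def H3.map {S : Set E} {T : Set E'} (φ : E → E') (hφ : ContDiffOn ℝ ∞ φ S)
    (hST : Set.MapsTo φ S T) : H3 S →ₗ[ℤ] H3 T :=
  Submodule.mapQ _ _
    ((Chain.map φ hφ hST 3).restrict (p := cycles3 S) (q := cycles3 T) (fun c hc => by
      have h := degenerate_map φ hφ hST 2 _ hc
      rw [← boundary_map] at h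
      exact h))
    (by
      intro c hc
      have hc' : (c : Chain S 3) ∈ boundaries3 S := hc
      obtain ⟨_, ⟨d, rfl⟩, y, hy, hxy⟩ := Submodule.mem_sup.1 hc'
      change Chain.map φ hφ hST 3 (c : Chain S 3) ∈ boundaries3 T
      rw [← hxy, map_add, ← boundary_map]
      exact Submodule.add_mem_sup ⟨_, rfl⟩ (degenerate_map φ hφ hST 3 y hy))

end Homology

/-! ### The mirror hypersurface and the residue form -/

/-- `F(a; U, V, W₁, W₂) = U² + V² + ∑ k, a_k W₁ ^ (e k 0) W₂ ^ (e k 1)`, where the coordinates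
`U, V, W₁, W₂` of `p` are `p 0, p 1, p 2, p 3`. -/
def mirrorF {K : ℕ} (e : Fin K → Fin 2 → ℤ) (a : Fin K → ℂ) (p : Fin 4 → ℂ) : ℂ :=
  p 0 ^ 2 + p 1 ^ 2 + ∑ k, a k * (p 2 ^ e k 0 * p 3 ^ e k 1)

/-- The hypersurface `Y = {F = 0}` in `ℂ² × (ℂ^*)²`. -/
def mirrorY {K : ℕ} (e : Fin K → Fin 2 → ℤ) (a : Fin K → ℂ) : Set (Fin 4 → ℂ) :=
  {p | p 2 ≠ 0 ∧ p 3 ≠ 0 ∧ mirrorF e a p = 0}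

/-- The smooth locus `{p ∈ Y | dF(p) ≠ 0}`, on which the residue form lives. It is all of `Y` when
`Y` is nonsingular. -/
def mirrorYreg {K : ℕ} (e : Fin K → Fin 2 → ℤ) (a : Fin K → ℂ) : Set (Fin 4 → ℂ) :=
  {p | p ∈ mirrorY e a ∧ fderiv ℂ (mirrorF e a) p ≠ 0}

/-- The form `dU ∧ dV ∧ dW₁/W₁ ∧ dW₂/W₂`. -/
def ambientForm (p : Fin 4 → ℂ) (v : Fin 4 → Fin 4 → ℂ) : ℂ :=
  (Matrix.of v).det / (p 2 * p 3)

/-- A tangent vector `ξ` with `dF(ξ) = 1`: the conjugate gradient divided by its square norm. -/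
def normalVector {K : ℕ} (e : Fin K → Fin 2 → ℤ) (a : Fin K → ℂ) (p : Fin 4 → ℂ) : Fin 4 → ℂ :=
  fun i => (starRingEnd ℂ) (fderiv ℂ (mirrorF e a) p (Pi.single i 1)) /
    ∑ j, fderiv ℂ (mirrorF e a) p (Pi.single j 1) *
      (starRingEnd ℂ) (fderiv ℂ (mirrorF e a) p (Pi.single j 1))

/-- The residue `Res_{F=0} (F⁻¹ dU dV dW₁/W₁ dW₂/W₂)`, i.e. the holomorphic three-form `ω` on the
smooth part of `Y` with `dF ∧ ω = dU ∧ dV ∧ dW₁/W₁ ∧ dW₂/W₂`. On vectors tangent to `Y` it is the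
contraction of the right-hand side with any vector `ξ` such that `dF(ξ) = 1`; see
`ambientForm_eq_residueForm` for the independence of `ξ`. -/
def residueForm {K : ℕ} (e : Fin K → Fin 2 → ℤ) (a : Fin K → ℂ) (p : Fin 4 → ℂ)
    (v : Fin 3 → Fin 4 → ℂ) : ℂ :=
  ambientForm p (Fin.cons (normalVector e a p) v)

theorem fderiv_normalVector {K : ℕ} (e : Fin K → Fin 2 → ℤ) (a : Fin K → ℂ) (p : Fin 4 → ℂ)
    (hp : fderiv ℂ (mirrorF e a) p ≠ 0) :
    fderiv ℂ (mirrorF e a) p (normalVector e a p) = 1 := by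
  set D := fderiv ℂ (mirrorF e a) p with hD
  have hexp : ∀ x : Fin 4 → ℂ, D x = ∑ i, x i * D (Pi.single i 1) := by
    intro x
    conv_lhs => rw [pi_eq_sum_univ' x]
    simp [map_sum]
  have hne : ∑ j, D (Pi.single j 1) * (starRingEnd ℂ) (D (Pi.single j 1)) ≠ 0 := by
    intro h0
    apply hp
    have h1 : ∑ j, ‖D (Pi.single j 1)‖ ^ 2 = (0 : ℝ) := by
      have : ((∑ j, ‖D (Pi.single j 1)‖ ^ 2 : ℝ) : ℂ) = 0 := by
        rw [← h0]
        push_cast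
        exact Finset.sum_congr rfl fun j _ => (Complex.mul_conj' _).symm
      exact_mod_cast this
    have h2 := (Finset.sum_eq_zero_iff_of_nonneg (fun j _ => by positivity)).1 h1
    refine ContinuousLinearMap.ext fun x => ?_
    rw [hexp x]
    simp only [zero_apply]
    refine Finset.sum_eq_zero fun j hj => ?_
    have := h2 j hj
    simp only [ne_eq, OfNat.ofNat_ne_zero, not_false_eq_true, pow_eq_zero_iff, norm_eq_zero] at this
    simp [this]
  rw [hexp]
  simp only [normalVector, ← hD]
  simp only [div_mul_eq_mul_div, ← Finset.sum_div]
  rw [div_eq_one_iff_eq hne]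
  exact Finset.sum_congr rfl fun j _ => mul_comm _ _

/-- The defining property `dF ∧ Res = dU ∧ dV ∧ dW₁/W₁ ∧ dW₂/W₂`, evaluated on `(ξ, v₁, v₂, v₃)`
with `v₁, v₂, v₃` tangent to the level set of `F`. -/
theorem ambientForm_eq_residueForm {K : ℕ} (e : Fin K → Fin 2 → ℤ) (a : Fin K → ℂ)
    (p : Fin 4 → ℂ) (hp : fderiv ℂ (mirrorF e a) p ≠ 0) (ξ : Fin 4 → ℂ)
    (v : Fin 3 → Fin 4 → ℂ) (hv : ∀ i, fderiv ℂ (mirrorF e a) p (v i) = 0) :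
    ambientForm p (Fin.cons ξ v) =
      fderiv ℂ (mirrorF e a) p ξ * residueForm e a p v := by
  have hN := fderiv_normalVector e a p hp
  set D := fderiv ℂ (mirrorF e a) p with hD
  set n := normalVector e a p with hn
  have hexp : ∀ x : Fin 4 → ℂ, D x = ∑ i, x i * D (Pi.single i 1) := by
    intro x
    conv_lhs => rw [pi_eq_sum_univ' x]
    simp [map_sum]
  have hdet : (Matrix.of (Fin.cons (ξ - D ξ • n) v : Fin 4 → Fin 4 → ℂ)).det = 0 := by
    apply Matrix.exists_mulVec_eq_zero_iff.1
    refine ⟨fun i => D (Pi.single i 1), ?_, ?_⟩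
    · intro h0
      apply hp
      refine ContinuousLinearMap.ext fun x => ?_
      rw [hexp x]
      simp only [zero_apply]
      exact Finset.sum_eq_zero fun j _ => by rw [show D (Pi.single j 1) = 0 from congrFun h0 j]; simp
    · ext i
      simp only [Matrix.mulVec, dotProduct, Matrix.of_apply, Pi.zero_apply, ← hexp]
      refine Fin.cases ?_ (fun j => ?_) i
      · simp [hN]
      · simpa using hv j
  have key : ∀ x : Fin 4 → ℂ, (Matrix.of (Fin.cons x v : Fin 4 → Fin 4 → ℂ)).det =
      ((Matrix.detRowAlternating (R := ℂ) (n := Fin 4)).toMultilinearMap.toLinearMap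
        (Fin.cons n v) 0) x := by
    intro x
    simp only [MultilinearMap.toLinearMap_apply, Fin.update_cons_zero]
    rfl
  rw [key, map_sub, map_smul, ← key, ← key, smul_eq_mul, sub_eq_zero] at hdet
  simp only [residueForm, ambientForm, ← hn, hdet, mul_div_assoc]

/-! ### Period integrals -/

/-- The integral of the residue form over a smooth singular 3-cube in `Y`. -/
def cubeIntegral {K : ℕ} (e : Fin K → Fin 2 → ℤ) (a : Fin K → ℂ)
    (σ : SmoothCube (mirrorYreg e a) 3) : ℂ :=
  ∫ t in Set.Icc (0 : Fin 3 → ℝ) 1,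
    residueForm e a (cubeExtend σ.toFun t)
      (fun i => fderivWithin ℝ (cubeExtend σ.toFun) (Set.Icc 0 1) t (Pi.single i 1))

/-- `(4 π³)⁻¹ ∫_c Res_{F=0} (F⁻¹ dU dV dW₁/W₁ dW₂/W₂)` for a smooth singular chain `c`. -/
def chainPeriod {K : ℕ} (e : Fin K → Fin 2 → ℤ) (a : Fin K → ℂ)
    (c : Chain (mirrorYreg e a) 3) : ℂ :=
  1 / (4 * (Real.pi : ℂ) ^ 3) * c.sum fun σ n => (n : ℂ) * cubeIntegral e a σ

/-- The period of a class `L ∈ H₃(Y, ℤ)`: the integral over a cycle that represents `L`. (That the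
choice of the cycle is immaterial is part of the theorem.) -/
def period {K : ℕ} (e : Fin K → Fin 2 → ℤ) (a : Fin K → ℂ) (L : H3 (mirrorYreg e a)) : ℂ :=
  chainPeriod e a ((Submodule.mkQ_surjective _ L).choose : cycles3 (mirrorYreg e a))

/-- A family of classes `L a ∈ H₃(Y_a, ℤ)`, `a ∈ D`, is flat (locally constant for the Gauss-Manin
connection): near every point of `D` it is `L a = (Φ_a)_* ℓ` for a fixed class `ℓ` on an open part
of one fibre `Y_b` and maps `Φ_a` of it into `Y_a` that depend smoothly on `a`, with `Φ_b` the
inclusion. -/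
def IsFlat {K : ℕ} (e : Fin K → Fin 2 → ℤ) (D : Set (Fin K → ℂ))
    (L : ∀ a, H3 (mirrorYreg e a)) : Prop :=
  ∀ a₀ ∈ D, ∃ N : Set (Fin K → ℂ), IsOpen N ∧ a₀ ∈ N ∧ N ⊆ D ∧ ∃ b ∈ N,
    ∃ U : Set (Fin 4 → ℂ), IsOpen U ∧ ∃ Φ : (Fin K → ℂ) → (Fin 4 → ℂ) → (Fin 4 → ℂ),
      ContDiffOn ℝ ∞ (Function.uncurry Φ) (N ×ˢ U) ∧
      (∀ p ∈ mirrorYreg e b ∩ U, Φ b p = p) ∧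
      ∃ ℓ : H3 (mirrorYreg e b ∩ U), ∀ a ∈ N,
        ∃ (hΦ : ContDiffOn ℝ ∞ (Φ a) (mirrorYreg e b ∩ U))
          (hmaps : Set.MapsTo (Φ a) (mirrorYreg e b ∩ U) (mirrorYreg e a)),
          L a = H3.map (Φ a) hΦ hmaps ℓ

/-! ### The differential operators -/

/-- `∂/∂a_k`. -/
def partialDeriv {K : ℕ} (k : Fin K) (f : (Fin K → ℂ) → ℂ) : (Fin K → ℂ) → ℂ :=
  fun a => fderiv ℂ f a (Pi.single k 1)

/-- `(∂/∂a)^n = (∂/∂a_1)^{n_1} ⋯ (∂/∂a_K)^{n_K}`. -/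
def multiDeriv {K : ℕ} (n : Fin K → ℕ) (f : (Fin K → ℂ) → ℂ) : (Fin K → ℂ) → ℂ :=
  (List.finRange K).foldr (fun k g => (partialDeriv k)^[n k] g) f

/-- `□_l = (∂/∂a)^{l⁺} - (∂/∂a)^{l⁻}`, with `l⁺ = max l 0` and `l⁻ = max (-l) 0`. -/
def boxOp {K : ℕ} (l : Fin K → ℤ) (f : (Fin K → ℂ) → ℂ) : (Fin K → ℂ) → ℂ :=
  fun a => multiDeriv (fun k => (l k).toNat) f a - multiDeriv (fun k => (-l k).toNat) f a

/-- `θ_k = a_k ∂/∂a_k`. -/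
def thetaOp {K : ℕ} (k : Fin K) (f : (Fin K → ℂ) → ℂ) : (Fin K → ℂ) → ℂ :=
  fun a => a k * partialDeriv k f a

/-- `∑ k, c_k θ_k`. -/
def scalingOp {K : ℕ} (c : Fin K → ℤ) (f : (Fin K → ℂ) → ℂ) : (Fin K → ℂ) → ℂ :=
  fun a => ∑ k, (c k : ℂ) * thetaOp k f a

end LocalMirror

end

/-! Notation: $W^m=W_1^{m_0}W_2^{m_1}$, and $\Omega=dU\,dV\,\frac{dW_1}{W_1}\frac{dW_2}{W_2}$.

The level $z$ of $F$ is added as a parameter. A flat family of cycles in $\{F(a;\cdot)=0\}$ is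
extended to cycles $c_{a,z}$ in the level sets $\{F(a;\cdot)=z\}$, and the moments
$R_m(a,z)=\int_{c_{a,z}}W^m\,\mathrm{Res}$ are studied. Derivatives in $z$ then take the place of
poles of higher order, so no tube around the hypersurface is needed.

The field $\xi=U\partial_U$ satisfies $d(\iota_\xi W^m\Omega)=W^m\Omega$. Put
$N_m(a,z)=\int_{c_{a,z}}\iota_\xi W^m\Omega$. By Stokes' theorem on the tube swept by the cycles,
the derivative of $N_m$ in a direction is the integral of $W^m\Omega$ contracted with the velocity.
Since $\Omega=dF\wedge\mathrm{Res}$ and the velocity is known modulo tangent vectors from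
differentiating $F(a;\Psi_{a,z}(p))=z$, this gives $$\partial_zN_m=R_m,\qquad
\partial_{a_k}N_m=-R_{m+e_k}.$$ The maps involved are only real smooth, but these formulas are
complex linear in the direction. Hence all $G_{m,j}=\partial_z^jN_m$ are holomorphic, and
$\partial_{a_k}G_{m,j}=-G_{m+e_k,j+1}$. The period is $\frac1{4\pi^3}G_{0,1}$ at $z=0$.

Box operators: $(\partial/\partial a)^n$ turns $G_{0,1}$ into $(-1)^{|n|}G_{\sum n_ke_k,\,1+|n|}$,
which depends on $n$ only through $\sum n_k$ and $\sum n_ke_k$. These agree for $l^+$ and $l^-$.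

Euler operators: for a diagonal linear field $\xi$ the integral of $\iota_\xi\Omega$ has two
descriptions. It equals $\int dF(\xi)\,\mathrm{Res}$, a combination of moments, and its
$z$-derivative is the divergence weight of $\xi$ times $R_0$. Comparing $z$-derivatives at $z=0$
gives $\mathcal Z_1$ from $-\frac12(U\partial_U+V\partial_V)$, and $\mathcal Z_2,\mathcal Z_3$ from
$W_i\partial_{W_i}$.

Independence of the cycle uses the same mechanism: for a boundary moved to all nearby levels, $N_0$
vanishes identically, because $\Omega$ restricts to zero on a level set, so its $z$-derivative $R_0$
vanishes.

The main ingredients are `stokes_cube`, `chainIntegral_homotopy`, `fderiv_familyIntegral`,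
`IsLevelFamily.fderiv_eulerIntegral`, `isMomentSystem_iterate`, and `exists_levelProjection`. The
last one supplies the extension to nearby levels and also the existence of flat families. -/

namespace LocalMirror

open Set Filter Topology MeasureTheory

/-! ### Parametric integrals, Fubini on cubes, and implicit functions along compact sets. -/

section ParametricIntegral

variable {P T F : Type} [NormedAddCommGroup P] [NormedSpace ℝ P] [ProperSpace P]
  [NormedAddCommGroup T] [NormedSpace ℝ T] [MeasurableSpace T] [BorelSpace T]
  [SecondCountableTopology T]

/-- Differentiation under the integral sign over a compact set. -/
theorem hasFDerivAt_setIntegral_of_compact [NormedAddCommGroup F] [NormedSpace ℝ F]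
    [CompleteSpace F]
    {μ : Measure T} [IsFiniteMeasureOnCompacts μ] {Q : Set T} (hQ : IsCompact Q)
    (hQd : UniqueDiffOn ℝ Q) {O : Set P} (hO : IsOpen O) {f : P × T → F}
    (hf : ContDiffOn ℝ 1 f (O ×ˢ Q)) {A : P} (hA : A ∈ O) :
    HasFDerivAt (fun A => ∫ t in Q, f (A, t) ∂μ)
      (∫ t in Q, (fderivWithin ℝ f (O ×ˢ Q) (A, t)).comp (ContinuousLinearMap.inl ℝ P T) ∂μ) A := by
  obtain ⟨ε, hε, hball⟩ := Metric.isOpen_iff.1 hO A hA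
  have hsub : Metric.closedBall A (ε / 2) ⊆ O :=
    (Metric.closedBall_subset_ball (by linarith)).trans hball
  have hud : UniqueDiffOn ℝ (O ×ˢ Q) := hO.uniqueDiffOn.prod hQd
  have hcD : ContinuousOn (fun q => (fderivWithin ℝ f (O ×ˢ Q) q).comp
      (ContinuousLinearMap.inl ℝ P T)) (O ×ˢ Q) :=
    (hf.continuousOn_fderivWithin hud le_rfl).clm_comp continuousOn_const
  have hslice : ∀ B ∈ O, ContinuousOn (fun t : T => ((B, t) : P × T)) Q ∧
      MapsTo (fun t : T => ((B, t) : P × T)) Q (O ×ˢ Q) := fun B hB =>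
    ⟨by fun_prop, fun t ht => ⟨hB, ht⟩⟩
  -- The dominating function is a constant: a bound for the partial derivative on the product of a
  -- closed ball with `Q`, which is compact because `P` is proper.
  obtain ⟨M, hM⟩ := (((isCompact_closedBall A (ε / 2)).prod hQ).image_of_continuousOn
    (hcD.mono (prod_mono hsub le_rfl)).norm).bddAbove
  have hint : ∀ B ∈ O, ContinuousOn (fun t => f (B, t)) Q := fun B hB =>
    hf.continuousOn.comp (hslice B hB).1 (hslice B hB).2
  refine hasFDerivAt_integral_of_dominated_of_fderiv_le (𝕜 := ℝ)
    (F' := fun B t => (fderivWithin ℝ f (O ×ˢ Q) (B, t)).comp (ContinuousLinearMap.inl ℝ P T))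
    (bound := fun _ => M) (Metric.closedBall_mem_nhds A (half_pos hε)) ?_ ?_ ?_ ?_ ?_ ?_
  · filter_upwards [hO.mem_nhds hA] with B hB
    exact (hint B hB).aestronglyMeasurable hQ.measurableSet
  · exact (hint A hA).integrableOn_compact hQ
  · exact (hcD.comp (hslice A hA).1 (hslice A hA).2).aestronglyMeasurable_of_isCompact hQ
      hQ.measurableSet
  · refine (ae_restrict_iff' hQ.measurableSet).2 (Eventually.of_forall fun t ht B hB => ?_)
    exact mem_upperBounds.1 hM _ (mem_image_of_mem _ (mk_mem_prod hB ht))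
  · exact integrableOn_const hQ.measure_lt_top.ne
  · refine (ae_restrict_iff' hQ.measurableSet).2 (Eventually.of_forall fun t ht B hB => ?_)
    have h1 := ((hf.differentiableOn one_ne_zero) (B, t) ⟨hsub hB, ht⟩).hasFDerivWithinAt
    have h2 : HasFDerivWithinAt (fun B : P => (B, t)) (ContinuousLinearMap.inl ℝ P T) O B :=
      (hasFDerivAt_prodMk_left B t).hasFDerivWithinAt
    exact (h1.comp B h2 (fun B' hB' => mk_mem_prod hB' ht)).hasFDerivAt (hO.mem_nhds (hsub hB))

/-- Bootstrap: the derivative is an integral of the same kind, with values in `P →L[ℝ] F`. The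
induction on the order therefore has to let the target space vary. -/
theorem contDiffOn_setIntegral_of_compact [NormedAddCommGroup F] [NormedSpace ℝ F]
    [CompleteSpace F]
    {μ : Measure T} [IsFiniteMeasureOnCompacts μ] {Q : Set T} (hQ : IsCompact Q)
    (hQd : UniqueDiffOn ℝ Q) {O : Set P} (hO : IsOpen O) {f : P × T → F}
    (hf : ContDiffOn ℝ ∞ f (O ×ˢ Q)) :
    ContDiffOn ℝ ∞ (fun A => ∫ t in Q, f (A, t) ∂μ) O := by
  rw [contDiffOn_infty]
  intro n
  have hud : UniqueDiffOn ℝ (O ×ˢ Q) := hO.uniqueDiffOn.prod hQd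
  induction n generalizing F with
  | zero =>
    refine contDiffOn_zero.2 fun A hA => ?_
    exact (hasFDerivAt_setIntegral_of_compact hQ hQd hO (hf.of_le (by norm_cast))
      hA).continuousAt.continuousWithinAt
  | succ n ih =>
    have hd := fun A (hA : A ∈ O) => hasFDerivAt_setIntegral_of_compact (μ := μ) hQ hQd hO
      (hf.of_le (by norm_cast)) hA
    rw [show ((n + 1 : ℕ) : WithTop ℕ∞) = (n : WithTop ℕ∞) + 1 by norm_cast,
      contDiffOn_succ_iff_fderiv_of_isOpen hO]
    refine ⟨fun A hA => (hd A hA).differentiableAt.differentiableWithinAt,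
      fun h => absurd h (by simp), ?_⟩
    have hg : ContDiffOn ℝ ∞ (fun q => (fderivWithin ℝ f (O ×ˢ Q) q).comp
        (ContinuousLinearMap.inl ℝ P T)) (O ×ˢ Q) :=
      (hf.fderivWithin hud (by norm_cast)).clm_comp contDiffOn_const
    exact (ih hg).congr fun A hA => (hd A hA).fderiv

end ParametricIntegral

theorem setIntegral_Icc_fin_succ {F : Type*} [NormedAddCommGroup F] [NormedSpace ℝ F] {n : ℕ}
    {f : (Fin (n + 1) → ℝ) → F} (hf : ContinuousOn f (Icc 0 1)) :
    ∫ t in Icc (0 : Fin (n + 1) → ℝ) 1, f t =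
      ∫ s in Icc (0 : ℝ) 1, ∫ t in Icc (0 : Fin n → ℝ) 1, f (Fin.cons s t) := by
  have hmp := (volume_preserving_piFinSuccAbove (fun _ : Fin (n + 1) => ℝ) 0).symm
  have hset : (MeasurableEquiv.piFinSuccAbove (fun _ : Fin (n + 1) => ℝ) 0).symm ⁻¹'
      (Icc (0 : Fin (n + 1) → ℝ) 1) = Icc (0 : ℝ) 1 ×ˢ Icc (0 : Fin n → ℝ) 1 := by
    ext ⟨s, t⟩
    simp [MeasurableEquiv.piFinSuccAbove, Pi.le_def, Fin.forall_fin_succ]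
  rw [← hmp.setIntegral_preimage_emb (MeasurableEquiv.measurableEmbedding _), hset,
    Measure.volume_eq_prod, setIntegral_prod]
  · simp [MeasurableEquiv.piFinSuccAbove, Fin.insertNthEquiv]
  · have h := (hmp.integrableOn_comp_preimage (MeasurableEquiv.measurableEmbedding _)
      (f := f) (s := Icc 0 1)).2 (hf.integrableOn_compact isCompact_Icc)
    rwa [hset] at h

/-- The implicit function theorem along a compact set. -/
theorem exists_implicit_function_of_compact {B : Type} [NormedAddCommGroup B] [NormedSpace ℝ B]
    [CompleteSpace B]
    {O : Set (B × ℂ)} (hO : IsOpen O) {f : B × ℂ → ℂ} (hf : ContDiffOn ℝ ∞ f O)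
    (hder : ∀ q ∈ O, ∃ c : ℂ, c ≠ 0 ∧ ∀ δ, fderiv ℝ f q (0, δ) = c * δ)
    {C : Set B} (hC : IsCompact C) (hCO : ∀ x ∈ C, (x, (0 : ℂ)) ∈ O)
    (hC0 : ∀ x ∈ C, f (x, 0) = 0) :
    ∃ W : Set B, IsOpen W ∧ C ⊆ W ∧ ∃ ε > 0, ∃ s : B × ℂ → ℂ,
      ContDiffOn ℝ ∞ s (W ×ˢ Metric.ball 0 ε) ∧
      (∀ x ∈ W, ∀ z ∈ Metric.ball (0 : ℂ) ε, (x, s (x, z)) ∈ O ∧ f (x, s (x, z)) = z) ∧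
      ∀ x ∈ W, f (x, 0) = 0 → s (x, 0) = 0 := by
  -- Adjoining the base point makes `H` a local diffeomorphism at points of `O`, because the
  -- derivative of `f` in the last variable is multiplication by a nonzero number. The solution `s`
  -- is the second component of an inverse of `H`.
  set H : B × ℂ → B × ℂ := fun q => (q.1, f q) with hH
  have hHc : ∀ q ∈ O, ContDiffAt ℝ ∞ H q := fun q hq =>
    contDiffAt_fst.prodMk (hf.contDiffAt (hO.mem_nhds hq))
  have hHd : ∀ q ∈ O, ∃ L : (B × ℂ) ≃L[ℝ] (B × ℂ), HasFDerivAt H (L : (B × ℂ) →L[ℝ] (B × ℂ)) q := by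
    intro q hq
    obtain ⟨c, hc, hcδ⟩ := hder q hq
    set D := fderiv ℝ f q with hD
    have hfq : HasFDerivAt f D q :=
      ((hf.contDiffAt (hO.mem_nhds hq)).differentiableAt (by simp)).hasFDerivAt
    have hsplit : ∀ u : B × ℂ, D u = D (u.1, 0) + c * u.2 := by
      intro u
      rw [← hcδ, ← map_add]
      simp
    refine ⟨ContinuousLinearEquiv.equivOfInverse
      ((ContinuousLinearMap.fst ℝ B ℂ).prod D)
      ((ContinuousLinearMap.fst ℝ B ℂ).prod (c⁻¹ •
        (ContinuousLinearMap.snd ℝ B ℂ - D.comp ((ContinuousLinearMap.inl ℝ B ℂ).comp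
          (ContinuousLinearMap.fst ℝ B ℂ))))) ?_ ?_, ?_⟩
    · intro u
      refine Prod.ext rfl ?_
      simp [hsplit u, hc]
    · intro u
      refine Prod.ext rfl ?_
      have h := hsplit (u.1, c⁻¹ * (u.2 - D (u.1, 0)))
      rw [mul_inv_cancel_left₀ hc] at h
      simpa using h
    · exact hasFDerivAt_fst.prodMk hfq
  -- a neighbourhood of the compact set on which `H` is injective
  have hinj : InjOn H (C ×ˢ {(0 : ℂ)}) := by
    rintro ⟨x, s⟩ ⟨-, hs⟩ ⟨y, t⟩ ⟨-, ht⟩ h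
    simp only [mem_singleton_iff] at hs ht
    exact Prod.ext (congrArg Prod.fst h :) (hs.trans ht.symm)
  have hKO : C ×ˢ {(0 : ℂ)} ⊆ O := by
    rintro ⟨x, s⟩ ⟨hx, hs⟩
    simp only [mem_singleton_iff] at hs
    subst hs
    exact hCO x hx
  obtain ⟨W₁, hW₁o, hKW₁, hW₁inj⟩ := hinj.exists_isOpen_superset (hC.prod isCompact_singleton)
    (fun q hq => (hHc q (hKO hq)).continuousAt) (fun q hq => by
      obtain ⟨L, hL⟩ := hHd q (hKO hq)
      refine ⟨_, (((hHc q (hKO hq)).toOpenPartialHomeomorph H hL (by simp)).open_source.mem_nhds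
        (ContDiffAt.mem_toOpenPartialHomeomorph_source _ hL _)), ?_⟩
      exact ((hHc q (hKO hq)).toOpenPartialHomeomorph H hL (by simp)).injOn)
  set W₀ := W₁ ∩ O with hW₀
  have hW₀o : IsOpen W₀ := hW₁o.inter hO
  have hW₀inj : InjOn H W₀ := hW₁inj.mono inter_subset_left
  have hKW₀ : C ×ˢ {(0 : ℂ)} ⊆ W₀ := subset_inter hKW₁ hKO
  set G := Function.invFunOn H W₀ with hG
  have hGH : ∀ q ∈ W₀, G (H q) = q := fun q hq => hW₀inj.leftInvOn_invFunOn hq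
  have hloc : ∀ q ∈ W₀, H '' W₀ ∈ 𝓝 (H q) ∧ ContDiffAt ℝ ∞ G (H q) := by
    intro q hq
    obtain ⟨L, hL⟩ := hHd q hq.2
    have hc := hHc q hq.2
    have hn : (∞ : WithTop ℕ∞) ≠ 0 := by simp
    have hinv := hc.to_localInverse hL hn
    have hq' := hc.localInverse_apply_image hL hn
    have hright : ∀ᶠ y in 𝓝 (H q), H (hc.localInverse hL hn y) = y :=
      (hc.hasStrictFDerivAt' hL hn).eventually_right_inverse
    have hmem : ∀ᶠ y in 𝓝 (H q), hc.localInverse hL hn y ∈ W₀ :=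
      hinv.continuousAt.preimage_mem_nhds (by rw [hq']; exact hW₀o.mem_nhds hq)
    refine ⟨?_, hinv.congr_of_eventuallyEq ?_⟩
    · filter_upwards [hright, hmem] with y h1 h2
      exact ⟨_, h2, h1⟩
    · filter_upwards [hright, hmem] with y h1 h2
      rw [← hGH _ h2, h1]
  have hopen : IsOpen (H '' W₀) := isOpen_iff_mem_nhds.2 (by
    rintro _ ⟨q, hq, rfl⟩
    exact (hloc q hq).1)
  have hKH : C ×ˢ {(0 : ℂ)} ⊆ H '' W₀ := by
    rintro ⟨x, s⟩ hxs
    refine ⟨(x, s), hKW₀ hxs, ?_⟩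
    obtain ⟨hx, hs⟩ := hxs
    simp only [mem_singleton_iff] at hs
    subst hs
    simp [hH, hC0 x hx]
  -- The tube is taken inside `W₀` as well as inside the image. Then `(x, 0)` lies in the set on
  -- which `H` is injective, and `f (x, 0) = 0` forces the inverse to return `(x, 0)` itself.
  obtain ⟨W, V, hWo, hVo, hCW, h0V, hWV⟩ := generalized_tube_lemma hC isCompact_singleton
    (hopen.inter hW₀o) (subset_inter hKH hKW₀)
  obtain ⟨ε, hε, hball⟩ := Metric.isOpen_iff.1 hVo 0 (h0V rfl)
  have hWVb : W ×ˢ Metric.ball (0 : ℂ) ε ⊆ W ×ˢ V := prod_mono le_rfl hball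
  refine ⟨W, hWo, hCW, ε, hε, fun q => (G q).2, ?_, ?_, ?_⟩
  · intro q hq
    obtain ⟨q', hq', rfl⟩ := (hWV (hWVb hq)).1
    exact (contDiffAt_snd.comp _ (hloc q' hq').2).contDiffWithinAt
  · intro x hx z hz
    obtain ⟨q', hq', h⟩ := (hWV (hWVb ⟨hx, hz⟩ : (x, z) ∈ W ×ˢ V)).1
    have h1 : q'.1 = x := congrArg Prod.fst h
    have h2 : f q' = z := congrArg Prod.snd h
    have h3 : (x, (G (x, z)).2) = q' := by
      rw [← h, hGH q' hq', ← h1]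
    rw [h3]
    exact ⟨hq'.2, h2⟩
  · intro x hx hx0
    have h1 : (x, (0 : ℂ)) ∈ W₀ := (hWV (hWVb ⟨hx, Metric.mem_ball_self hε⟩)).2
    have h2 : H (x, 0) = (x, 0) := by simp [hH, hx0]
    have h3 := hGH _ h1
    rw [h2] at h3
    simp [h3]

/-! ### Calculus on the closed unit cube: faces and degenerate cubes. -/

section Cube

variable {n : ℕ}

theorem uniqueDiffOn_cube : UniqueDiffOn ℝ (Icc (0 : Fin n → ℝ) 1) := by
  rw [← Set.pi_univ_Icc]
  exact UniqueDiffOn.univ_pi fun i => uniqueDiffOn_Icc zero_lt_one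

theorem interior_cube : interior (Icc (0 : Fin n → ℝ) 1) = Set.pi univ fun _ => Ioo (0 : ℝ) 1 := by
  rw [← Set.pi_univ_Icc, interior_pi_set finite_univ]
  simp

theorem mem_closure_interior_cube {t : Fin n → ℝ} (ht : t ∈ Icc (0 : Fin n → ℝ) 1) :
    t ∈ closure (interior (Icc (0 : Fin n → ℝ) 1)) := by
  rw [interior_cube, closure_pi_set]
  rw [← Set.pi_univ_Icc] at ht
  simpa using ht

variable {E : Type} [NormedAddCommGroup E] [NormedSpace ℝ E]

theorem SmoothCube.cubeExtend_mem {S : Set E} (σ : SmoothCube S n) (t : Fin n → ℝ) :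
    cubeExtend σ.toFun t ∈ S := σ.mem _

theorem insertNth_mem_cube (i : Fin (n + 1)) {ε : ℝ} (hε : ε ∈ Icc (0 : ℝ) 1) {t : Fin n → ℝ}
    (ht : t ∈ Icc (0 : Fin n → ℝ) 1) :
    (i.insertNth ε t : Fin (n + 1) → ℝ) ∈ Icc (0 : Fin (n + 1) → ℝ) 1 := by
  constructor
  · intro j
    refine Fin.succAboveCases i ?_ (fun k => ?_) j
    · simpa using hε.1
    · simpa using ht.1 k
  · intro j
    refine Fin.succAboveCases i ?_ (fun k => ?_) j
    · simpa using hε.2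
    · simpa using ht.2 k

theorem SmoothCube.cubeExtend_face {S : Set E} (σ : SmoothCube S (n + 1)) (i : Fin (n + 1))
    (ε : unitInterval) (t : Fin n → ℝ) :
    cubeExtend (σ.face i ε).toFun t = cubeExtend σ.toFun (i.insertNth (ε : ℝ) t) := by
  simp only [cubeExtend, SmoothCube.face]
  congr 1
  ext j
  refine Fin.succAboveCases i ?_ (fun k => ?_) j
  · simp
  · simp

/-- Insertion of a zero coordinate. -/
noncomputable def insertZero (i : Fin (n + 1)) : (Fin n → ℝ) →L[ℝ] (Fin (n + 1) → ℝ) :=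
  LinearMap.toContinuousLinearMap
    { toFun := fun t => i.insertNth (0 : ℝ) t
      map_add' := fun s t => by
        ext j
        refine Fin.succAboveCases i ?_ (fun k => ?_) j <;> simp
      map_smul' := fun c t => by
        ext j
        refine Fin.succAboveCases i ?_ (fun k => ?_) j <;> simp }

theorem insertZero_single (i : Fin (n + 1)) (j : Fin n) :
    insertZero i (Pi.single j 1) = Pi.single (i.succAbove j) 1 := by
  ext k
  refine Fin.succAboveCases i ?_ (fun k => ?_) k
  · simp [insertZero, (Fin.succAbove_ne i j).symm]
  · simp [insertZero, Pi.single_apply]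

theorem hasFDerivAt_insertNth (i : Fin (n + 1)) (ε : ℝ) (t : Fin n → ℝ) :
    HasFDerivAt (fun s : Fin n → ℝ => (i.insertNth ε s : Fin (n + 1) → ℝ)) (insertZero i) t := by
  have h : (fun s : Fin n → ℝ => (i.insertNth ε s : Fin (n + 1) → ℝ)) =
      fun s => i.insertNth ε (0 : Fin n → ℝ) + insertZero i s := by
    ext s j
    refine Fin.succAboveCases i ?_ (fun k => ?_) j <;> simp [insertZero]
  rw [h]
  exact (insertZero i).hasFDerivAt.const_add _

theorem SmoothCube.fderivWithin_face {S : Set E} (σ : SmoothCube S (n + 1)) (i : Fin (n + 1))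
    (ε : unitInterval) {t : Fin n → ℝ} (ht : t ∈ Icc (0 : Fin n → ℝ) 1) (j : Fin n) :
    fderivWithin ℝ (cubeExtend (σ.face i ε).toFun) (Icc 0 1) t (Pi.single j 1) =
      fderivWithin ℝ (cubeExtend σ.toFun) (Icc 0 1) (i.insertNth (ε : ℝ) t)
        (Pi.single (i.succAbove j) 1) := by
  have hmaps : MapsTo (fun s : Fin n → ℝ => (i.insertNth (ε : ℝ) s : Fin (n + 1) → ℝ))
      (Icc 0 1) (Icc 0 1) := fun s hs => insertNth_mem_cube i ε.2 hs
  have h1 := (σ.smooth.differentiableOn (by simp) _ (hmaps ht)).hasFDerivWithinAt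
  have h2 := h1.comp t (hasFDerivAt_insertNth i (ε : ℝ) t).hasFDerivWithinAt hmaps
  have h3 : cubeExtend (σ.face i ε).toFun =
      cubeExtend σ.toFun ∘ fun s : Fin n → ℝ => (i.insertNth (ε : ℝ) s : Fin (n + 1) → ℝ) :=
    funext fun s => σ.cubeExtend_face i ε s
  rw [h3, h2.fderivWithin (uniqueDiffOn_cube t ht)]
  simp [insertZero_single]

theorem SmoothCube.IsDegenerate.exists_fderivWithin_eq_zero {S : Set E} {σ : SmoothCube S n}
    (hσ : σ.IsDegenerate) : ∃ i, ∀ t ∈ Icc (0 : Fin n → ℝ) 1,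
      fderivWithin ℝ (cubeExtend σ.toFun) (Icc 0 1) t (Pi.single i 1) = 0 := by
  obtain ⟨i, hi⟩ := hσ
  refine ⟨i, fun t ht => ?_⟩
  -- `π` sets the `i`-th coordinate to zero. A cube independent of that coordinate factors through
  -- `π`, so its derivative kills the `i`-th basis vector.
  set π : (Fin n → ℝ) →L[ℝ] (Fin n → ℝ) := ContinuousLinearMap.pi fun j =>
    if j = i then 0 else ContinuousLinearMap.proj j with hπ
  have hπv : ∀ s j, π s j = if j = i then 0 else s j := by
    intro s j
    by_cases h : j = i <;> simp [hπ, h]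
  have hmaps : MapsTo π (Icc 0 1) (Icc 0 1) := by
    intro s hs
    refine ⟨fun j => ?_, fun j => ?_⟩
    · rw [hπv]
      split_ifs
      · exact le_rfl
      · exact hs.1 j
    · rw [hπv]
      split_ifs
      · exact zero_le_one
      · exact hs.2 j
  have heq : cubeExtend σ.toFun = cubeExtend σ.toFun ∘ π := by
    ext1 s
    simp only [cubeExtend, Function.comp]
    rw [← hi (fun j => projIcc 0 1 zero_le_one (s j)) (projIcc 0 1 zero_le_one 0)]
    congr 1
    ext j
    by_cases h : j = i
    · subst h
      simp [hπv]
    · simp [hπv, h]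
  have h1 := (σ.smooth.differentiableOn (by simp) _ (hmaps ht)).hasFDerivWithinAt
  have h2 := h1.comp t π.hasFDerivAt.hasFDerivWithinAt hmaps
  rw [← heq] at h2
  rw [h2.fderivWithin (uniqueDiffOn_cube t ht)]
  have h3 : π (Pi.single i 1) = 0 := by
    ext j
    rw [hπv]
    split_ifs with h
    · rfl
    · simp [h]
  simp [h3]

end Cube

/-! ### Smoothness of evaluating alternating forms on vector fields. -/

section Apply

variable {E F : Type} [NormedAddCommGroup E] [NormedSpace ℝ E]
  [NormedAddCommGroup F] [NormedSpace ℝ F]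

/-- Currying off the first argument reduces joint smoothness of evaluation to the bilinear case of
applying a continuous linear map. -/
theorem contDiff_continuousMultilinearMap_apply (k : ℕ) :
    ContDiff ℝ ∞ (fun q : (ContinuousMultilinearMap ℝ (fun _ : Fin k => E) F) × (Fin k → E) =>
      q.1 q.2) := by
  induction k with
  | zero =>
    have h : (fun q : (ContinuousMultilinearMap ℝ (fun _ : Fin 0 => E) F) × (Fin 0 → E) =>
        q.1 q.2) = fun q => (ContinuousMultilinearMap.apply ℝ (fun _ : Fin 0 => E) F 0) q.1 := by
      ext q
      simp [Subsingleton.elim q.2 0]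
    rw [h]
    exact (ContinuousLinearMap.contDiff _).comp contDiff_fst
  | succ k ih =>
    have h : (fun q : (ContinuousMultilinearMap ℝ (fun _ : Fin (k + 1) => E) F) ×
        (Fin (k + 1) → E) => q.1 q.2) =
        fun q => ((continuousMultilinearCurryLeftEquiv ℝ (fun _ : Fin (k + 1) => E) F) q.1)
          (q.2 0) (Fin.tail q.2) := by
      ext q
      simp
    rw [h]
    have h1 : ContDiff ℝ ∞ (fun q : (ContinuousMultilinearMap ℝ (fun _ : Fin (k + 1) => E) F) ×
        (Fin (k + 1) → E) =>
        ((continuousMultilinearCurryLeftEquiv ℝ (fun _ : Fin (k + 1) => E) F) q.1) (q.2 0)) := by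
      refine ContDiff.clm_apply ?_ ?_
      · exact (LinearIsometryEquiv.contDiff _).comp contDiff_fst
      · exact (contDiff_apply ℝ E 0).comp contDiff_snd
    refine ih.comp (h1.prodMk (contDiff_pi.2 fun j => ?_))
    exact (contDiff_apply ℝ E j.succ).comp contDiff_snd

theorem ContDiffOn.continuousAlternatingMap_apply {G : Type} [NormedAddCommGroup G]
    [NormedSpace ℝ G] {k : ℕ} {s : Set G} {η : G → E [⋀^Fin k]→L[ℝ] F} {v : G → Fin k → E}
    (hη : ContDiffOn ℝ ∞ η s) (hv : ContDiffOn ℝ ∞ v s) :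
    ContDiffOn ℝ ∞ (fun x => η x (v x)) s := by
  have h1 : ContDiffOn ℝ ∞ (fun x => (η x).toContinuousMultilinearMap) s :=
    (ContinuousAlternatingMap.toContinuousMultilinearMapCLM (𝕜 := ℝ) (E := E) (F := F)
      (ι := Fin k) ℝ).contDiff.comp_contDiffOn hη
  exact (contDiff_continuousMultilinearMap_apply (E := E) (F := F) k).comp_contDiffOn (h1.prodMk hv)

theorem ContDiffOn.extDeriv {k : ℕ} {X : Set E} (hX : IsOpen X) {η : E → E [⋀^Fin k]→L[ℝ] F}
    (hη : ContDiffOn ℝ ∞ η X) : ContDiffOn ℝ ∞ (extDeriv η) X :=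
  (ContinuousAlternatingMap.alternatizeUncurryFinCLM ℝ E F).contDiff.comp_contDiffOn
    (hη.fderiv_of_isOpen hX (by norm_cast))

end Apply

/-! ### Integration over chains and Stokes' theorem. -/

section Stokes

variable {E : Type} [NormedAddCommGroup E] [NormedSpace ℝ E] {n : ℕ}

/-- The integral over the unit cube of the pull-back of `w` under `f`. -/
noncomputable def pullbackIntegral (w : E → (Fin n → E) → ℂ) (f : (Fin n → ℝ) → E) : ℂ :=
  ∫ t in Icc (0 : Fin n → ℝ) 1, w (f t) fun i => fderivWithin ℝ f (Icc 0 1) t (Pi.single i 1)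

/-- The integral of `w` over a smooth cubical chain. -/
noncomputable def chainIntegral {S : Set E} (w : E → (Fin n → E) → ℂ) : Chain S n →ₗ[ℤ] ℂ :=
  Finsupp.linearCombination ℤ fun σ : SmoothCube S n => pullbackIntegral w (cubeExtend σ.toFun)

/-- Only vanishing on a zero argument is required of `w`, so that the lemma covers alternating forms
as well as `residueForm`, which is a bare function. -/
theorem chainIntegral_eq_zero_of_mem_degenerateChains {S : Set E} {w : E → (Fin n → E) → ℂ}
    (hw : ∀ p v i, v i = 0 → w p v = 0) {c : Chain S n} (hc : c ∈ degenerateChains S n) :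
    chainIntegral w c = 0 := by
  have h : degenerateChains S n ≤ LinearMap.ker (chainIntegral (S := S) w) := by
    refine Submodule.span_le.2 ?_
    rintro _ ⟨σ, hσ, rfl⟩
    obtain ⟨i, hi⟩ := hσ.exists_fderivWithin_eq_zero
    simp only [SetLike.mem_coe, LinearMap.mem_ker, chainIntegral,
      Finsupp.linearCombination_single, one_smul, pullbackIntegral]
    refine setIntegral_eq_zero_of_forall_eq_zero fun t ht => hw _ _ i (hi t ht)
  exact h hc

theorem chainIntegral_map {E' : Type} [NormedAddCommGroup E'] [NormedSpace ℝ E'] {S : Set E}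
    {T : Set E'} (φ : E → E') (hφ : ContDiffOn ℝ ∞ φ S) (hST : MapsTo φ S T)
    (w : E' → (Fin n → E') → ℂ) (c : Chain S n) :
    chainIntegral w (Chain.map φ hφ hST n c) =
      c.sum fun σ m => m • pullbackIntegral w fun t => φ (cubeExtend σ.toFun t) := by
  rw [chainIntegral, Chain.map, Finsupp.lmapDomain_apply, Finsupp.linearCombination_mapDomain,
    Finsupp.linearCombination_apply]
  rfl

/-- **Stokes' theorem** for a smooth singular cube. -/
theorem stokes_cube {S X : Set E} (hX : IsOpen X) (hSX : S ⊆ X) {η : E → E [⋀^Fin n]→L[ℝ] ℂ}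
    (hη : ContDiffOn ℝ ∞ η X) (σ : SmoothCube S (n + 1)) :
    pullbackIntegral (fun p v => extDeriv η p v) (cubeExtend σ.toFun) =
      ∑ i : Fin (n + 1), (-1 : ℤ) ^ (i : ℕ) •
        (pullbackIntegral (fun p v => η p v) (cubeExtend (σ.face i 1).toFun) -
          pullbackIntegral (fun p v => η p v) (cubeExtend (σ.face i 0).toFun)) := by
  set f := cubeExtend σ.toFun with hf
  set Q := Icc (0 : Fin (n + 1) → ℝ) 1 with hQ
  have hfX : MapsTo f Q X := fun t _ => hSX (σ.cubeExtend_mem t)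
  have hud : UniqueDiffOn ℝ Q := uniqueDiffOn_cube
  have hfs : ContDiffOn ℝ ∞ f Q := σ.smooth
  have hDf : ContDiffOn ℝ ∞ (fderivWithin ℝ f Q) Q := hfs.fderivWithin hud (by norm_cast)
  have hηf : ContDiffOn ℝ ∞ (fun t => η (f t)) Q := hη.comp hfs hfX
  have hsign : ∀ (k : ℕ) (z : ℂ), (-1 : ℤ) ^ k • z = (-1 : ℝ) ^ k • z := by
    intro k z
    rcases Nat.even_or_odd k with h | h <;> simp [h.neg_one_pow]
  set e : Fin (n + 1) → Fin (n + 1) → ℝ := fun j => Pi.single j 1 with he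
  -- The pulled back `n`-form read as a vector field: component `i` is the signed coefficient of the
  -- term omitting $dt_i$. Its divergence is the coefficient of the exterior derivative, so Stokes'
  -- theorem becomes the divergence theorem on a box.
  set g : Fin (n + 1) → (Fin (n + 1) → ℝ) → ℂ := fun i t =>
    (-1 : ℝ) ^ (i : ℕ) • η (f t) (fun j => fderivWithin ℝ f Q t (e (i.succAbove j))) with hg
  have hgs : ∀ i, ContDiffOn ℝ ∞ (g i) Q := by
    intro i
    refine ContDiffOn.const_smul _ (ContDiffOn.continuousAlternatingMap_apply hηf ?_)
    exact contDiffOn_pi.2 fun j => hDf.clm_apply contDiffOn_const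
  have hdiv : ∀ t ∈ Q, ∑ i, fderivWithin ℝ (g i) Q t (e i) =
      extDeriv η (f t) (fun i => fderivWithin ℝ f Q t (e i)) := by
    intro t ht
    have hηd : DifferentiableWithinAt ℝ η X (f t) :=
      hη.differentiableOn (by simp) _ (hfX ht)
    -- Exterior derivative and pull-back commute also at boundary points of the cube, since every
    -- point of the cube is a limit of interior points.
    have hpull := extDerivWithin_pullback (r := ∞) hηd (hfs t ht) (by
      simp only [minSmoothness_of_isRCLikeNormedField]; exact WithTop.coe_le_coe.2 le_top)
      hud (mem_closure_interior_cube ht) ht hfX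
    have hd : DifferentiableWithinAt ℝ
        (fun x => (η (f x)).compContinuousLinearMap (fderivWithin ℝ f Q x)) Q t :=
      (hηf.differentiableOn (by simp) t ht).continuousAlternatingMapCompContinuousLinearMap
        (hDf.differentiableOn (by simp) t ht)
    have h1 := extDerivWithin_apply hd (hud t ht) e
    rw [hpull] at h1
    have h2 : extDerivWithin η X (f t) = extDeriv η (f t) := by
      simp only [extDerivWithin, extDeriv, fderivWithin_of_isOpen hX (hfX ht)]
    rw [h2] at h1
    refine Eq.trans (Finset.sum_congr rfl fun i _ => ?_) h1.symm
    have h3 : DifferentiableWithinAt ℝ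
        (fun x => η (f x) fun j => fderivWithin ℝ f Q x (e (i.succAbove j))) Q t := by
      refine (ContDiffOn.continuousAlternatingMap_apply hηf ?_).differentiableOn (by simp) t ht
      exact contDiffOn_pi.2 fun j => hDf.clm_apply contDiffOn_const
    simp only [hg]
    rw [fderivWithin_fun_const_smul (hud t ht) h3, smul_apply, ← hsign]
    rfl
  have hgc : ∀ i, ContinuousOn (g i) Q := fun i => (hgs i).continuousOn
  have hkey := integral_divergence_of_hasFDerivAt_off_countable' (0 : Fin (n + 1) → ℝ) 1
    (fun _ => zero_le_one) g (fun i t => fderivWithin ℝ (g i) Q t) ∅ countable_empty hgc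
    (fun x hx i => by
      have hx' : x ∈ interior Q := by
        rw [hQ, interior_cube]
        exact hx.1
      have h := ((hgs i).differentiableOn (by simp) x (interior_subset hx')).hasFDerivWithinAt
      exact h.hasFDerivAt (mem_interior_iff_mem_nhds.1 hx'))
    (ContinuousOn.integrableOn_compact (isCompact_Icc)
      (continuousOn_finsetSum _ fun i _ =>
        ((hgs i).continuousOn_fderivWithin hud (by simp)).clm_apply continuousOn_const))
  have hL : pullbackIntegral (fun p v => extDeriv η p v) f =
      ∫ t in Q, ∑ i, fderivWithin ℝ (g i) Q t (e i) :=
    setIntegral_congr_fun measurableSet_Icc fun t ht => (hdiv t ht).symm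
  rw [hL, hkey]
  refine Finset.sum_congr rfl fun i _ => ?_
  have hface : ∀ ε : unitInterval, ∫ x in Icc ((0 : Fin (n + 1) → ℝ) ∘ i.succAbove)
      ((1 : Fin (n + 1) → ℝ) ∘ i.succAbove), g i (i.insertNth (ε : ℝ) x) =
      (-1 : ℤ) ^ (i : ℕ) • pullbackIntegral (fun p v => η p v) (cubeExtend (σ.face i ε).toFun) := by
    intro ε
    rw [hsign, pullbackIntegral, ← integral_smul]
    refine setIntegral_congr_fun measurableSet_Icc fun x hx => ?_
    have hx' : x ∈ Icc (0 : Fin n → ℝ) 1 := hx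
    simp only [hg]
    rw [σ.cubeExtend_face]
    congr 2
    ext1 j
    exact (σ.fderivWithin_face i ε hx' j).symm
  rw [smul_sub, ← hface 1, ← hface 0]
  rfl

/-- **Stokes' theorem** for smooth cubical chains. -/
theorem chainIntegral_boundary {S X : Set E} (hX : IsOpen X) (hSX : S ⊆ X)
    {η : E → E [⋀^Fin n]→L[ℝ] ℂ} (hη : ContDiffOn ℝ ∞ η X) (d : Chain S (n + 1)) :
    chainIntegral (fun p v => η p v) (boundary S n d) =
      chainIntegral (fun p v => extDeriv η p v) d := by
  have h : (chainIntegral (fun p v => η p v)).comp (boundary S n) =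
      chainIntegral (fun p v => extDeriv η p v) := by
    refine Finsupp.lhom_ext' fun σ => LinearMap.ext_ring ?_
    simp only [boundary, LinearMap.comp_apply, Finsupp.lsingle_apply, chainIntegral,
      Finsupp.linearCombination_single, one_smul]
    rw [stokes_cube hX hSX hη σ, map_sum]
    refine Finset.sum_congr rfl fun i _ => ?_
    rw [map_smul, map_sub, Finsupp.linearCombination_single, Finsupp.linearCombination_single,
      one_smul, one_smul]
  exact LinearMap.congr_fun h d

end Stokes

/-! ### Prisms over chains and the homotopy formula. -/

section Prism

variable {E E' : Type} [NormedAddCommGroup E] [NormedSpace ℝ E]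
  [NormedAddCommGroup E'] [NormedSpace ℝ E'] {n : ℕ}

/-- The trace of a singular cube under a homotopy. -/
def SmoothCube.prism {S : Set E} {T : Set E'} (h : ℝ → E → E')
    (hh : ContDiffOn ℝ ∞ (Function.uncurry h) (Icc 0 1 ×ˢ S))
    (hST : ∀ s ∈ Icc (0 : ℝ) 1, MapsTo (h s) S T) (σ : SmoothCube S n) :
    SmoothCube T (n + 1) where
  toFun t := h (t 0) (σ.toFun (Fin.tail t))
  mem t := hST _ (t 0).2 (σ.mem _)
  smooth := by
    have h1 : ContDiffOn ℝ ∞ (fun t : Fin (n + 1) → ℝ => cubeExtend σ.toFun (Fin.tail t))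
        (Icc 0 1) := by
      refine σ.smooth.comp (contDiffOn_pi.2 fun j => (contDiff_apply ℝ ℝ j.succ).contDiffOn) ?_
      exact fun t ht => ⟨fun j => ht.1 j.succ, fun j => ht.2 j.succ⟩
    refine (hh.comp ((contDiff_apply ℝ ℝ (0 : Fin (n + 1))).contDiffOn.prodMk h1) ?_).congr ?_
    · exact fun t ht => ⟨⟨ht.1 0, ht.2 0⟩, σ.mem _⟩
    · intro t ht
      simp only [cubeExtend, Function.comp, Function.uncurry]
      rw [projIcc_of_mem zero_le_one (⟨ht.1 0, ht.2 0⟩ : t 0 ∈ Icc (0 : ℝ) 1)]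
      rfl

/-- The trace of a chain under a homotopy. -/
noncomputable def Chain.prism {S : Set E} {T : Set E'} (h : ℝ → E → E')
    (hh : ContDiffOn ℝ ∞ (Function.uncurry h) (Icc 0 1 ×ˢ S))
    (hST : ∀ s ∈ Icc (0 : ℝ) 1, MapsTo (h s) S T) (n : ℕ) : Chain S n →ₗ[ℤ] Chain T (n + 1) :=
  Finsupp.lmapDomain ℤ ℤ (SmoothCube.prism h hh hST)

theorem contDiffOn_slice {S : Set E} {I : Set ℝ} {h : ℝ → E → E'}
    (hh : ContDiffOn ℝ ∞ (Function.uncurry h) (I ×ˢ S)) {s : ℝ} (hs : s ∈ I) :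
    ContDiffOn ℝ ∞ (h s) S :=
  hh.comp (contDiff_prodMk_right s).contDiffOn fun _ hp => mk_mem_prod hs hp

variable {S : Set E} {T : Set E'} (h : ℝ → E → E')
  (hh : ContDiffOn ℝ ∞ (Function.uncurry h) (Icc 0 1 ×ˢ S))
  (hST : ∀ s ∈ Icc (0 : ℝ) 1, MapsTo (h s) S T)

theorem SmoothCube.face_zero_prism (σ : SmoothCube S n) (ε : unitInterval) :
    (σ.prism h hh hST).face 0 ε = σ.map (h ε) (contDiffOn_slice hh ε.2) (hST _ ε.2) := by
  ext t
  simp [SmoothCube.prism, SmoothCube.face, SmoothCube.map]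

theorem SmoothCube.face_succ_prism (σ : SmoothCube S (n + 1)) (i : Fin (n + 1))
    (ε : unitInterval) :
    (σ.prism h hh hST).face i.succ ε = (σ.face i ε).prism h hh hST := by
  ext t
  have h1 : (i.succ.insertNth ε t : Fin (n + 2) → unitInterval) 0 = t 0 := by
    have := Fin.insertNth_apply_succAbove (α := fun _ => unitInterval) i.succ ε t 0
    simpa using this
  have h2 : Fin.tail (i.succ.insertNth ε t : Fin (n + 2) → unitInterval) =
      i.insertNth ε (Fin.tail t) := by
    ext1 j
    refine Fin.succAboveCases i ?_ (fun k => ?_) j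
    · simp [Fin.tail]
    · have := Fin.insertNth_apply_succAbove (α := fun _ => unitInterval) i.succ ε t k.succ
      rw [Fin.succ_succAbove_succ] at this
      simp [Fin.tail, this]
  simp only [SmoothCube.prism, SmoothCube.face, h1, h2]

/-- The homotopy time is the coordinate of index 0. Its two faces are the ends of the homotopy,
while the face of index `i + 1` is the prism over the face of index `i`. This shift of index
produces the minus sign in front of the last term. -/
theorem Chain.boundary_prism (c : Chain S (n + 1)) :
    boundary T (n + 1) (Chain.prism h hh hST (n + 1) c) =
      Chain.map (h 1) (contDiffOn_slice hh (by simp)) (hST _ (by simp)) (n + 1) c -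
        Chain.map (h 0) (contDiffOn_slice hh (by simp)) (hST _ (by simp)) (n + 1) c -
        Chain.prism h hh hST n (boundary S n c) := by
  have H : (boundary T (n + 1)).comp (Chain.prism h hh hST (n + 1)) =
      Chain.map (h 1) (contDiffOn_slice hh (by simp)) (hST _ (by simp)) (n + 1) -
        Chain.map (h 0) (contDiffOn_slice hh (by simp)) (hST _ (by simp)) (n + 1) -
        (Chain.prism h hh hST n).comp (boundary S n) := by
    refine Finsupp.lhom_ext' fun σ => LinearMap.ext_ring ?_
    simp only [boundary, Chain.prism, Chain.map, LinearMap.comp_apply, LinearMap.sub_apply,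
      Finsupp.lsingle_apply, Finsupp.lmapDomain_apply, Finsupp.mapDomain_single,
      Finsupp.linearCombination_single, one_smul]
    rw [Fin.sum_univ_succ, sub_eq_add_neg (_ - _)]
    congr 1
    · simp only [SmoothCube.face_zero_prism, Fin.val_zero, pow_zero, one_smul]
      rfl
    · rw [← Finsupp.lmapDomain_apply ℤ ℤ, map_sum, ← Finset.sum_neg_distrib]
      refine Finset.sum_congr rfl fun i _ => ?_
      rw [map_smul, map_sub]
      simp only [Finsupp.lmapDomain_apply, Finsupp.mapDomain_single, SmoothCube.face_succ_prism,
        Fin.val_succ, pow_succ, mul_neg, mul_one, neg_smul]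
  exact LinearMap.congr_fun H c

theorem Chain.prism_mem_degenerateChains {c : Chain S n} (hc : c ∈ degenerateChains S n) :
    Chain.prism h hh hST n c ∈ degenerateChains T (n + 1) := by
  have H : degenerateChains S n ≤
      (degenerateChains T (n + 1)).comap (Chain.prism h hh hST n) := by
    refine Submodule.span_le.2 ?_
    rintro _ ⟨σ, ⟨i, hi⟩, rfl⟩
    refine Submodule.subset_span ⟨σ.prism h hh hST, ⟨i.succ, fun t x => ?_⟩, ?_⟩
    · have h2 : Fin.tail (Function.update t i.succ x) = Function.update (Fin.tail t) i x := by
        simp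
      simp [SmoothCube.prism, h2, hi, Function.update_of_ne (Fin.succ_ne_zero i).symm]
    · simp [Chain.prism, Finsupp.mapDomain_single]
  exact H hc

/-- A chain over which the integrals of closed forms are invariant under homotopy. -/
def Chain.IsClosed (c : Chain S (n + 1)) : Prop :=
  boundary S n c ∈ degenerateChains S n ∨ ∃ d, c = boundary S (n + 1) d

/-- The homotopy formula for integrals over cycles. -/
theorem chainIntegral_homotopy {X : Set E'} (hX : IsOpen X) (hTX : T ⊆ X)
    {η : E' → E' [⋀^Fin (n + 1)]→L[ℝ] ℂ} (hη : ContDiffOn ℝ ∞ η X) {c : Chain S (n + 1)}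
    (hc : c.IsClosed) :
    chainIntegral (fun p v => η p v)
        (Chain.map (h 1) (contDiffOn_slice hh (by simp)) (hST _ (by simp)) (n + 1) c) -
      chainIntegral (fun p v => η p v)
        (Chain.map (h 0) (contDiffOn_slice hh (by simp)) (hST _ (by simp)) (n + 1) c) =
      chainIntegral (fun p v => extDeriv η p v) (Chain.prism h hh hST (n + 1) c) := by
  have hzero : chainIntegral (fun p v => η p v)
      (Chain.prism h hh hST n (boundary S n c)) = 0 := by
    rcases hc with hc | ⟨d, rfl⟩
    · exact chainIntegral_eq_zero_of_mem_degenerateChains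
        (fun p v i hi => (η p).map_coord_zero i hi) (Chain.prism_mem_degenerateChains h hh hST hc)
    -- Two applications of the prism formula show that prisms commute with the double boundary.
    -- Stokes' theorem used twice then turns the integral into one of $d\,d\eta=0$.
    · have h1 : Chain.prism h hh hST n (boundary S n (boundary S (n + 1) d)) =
          boundary T (n + 1) (boundary T (n + 1 + 1) (Chain.prism h hh hST (n + 1 + 1) d)) := by
        rw [Chain.boundary_prism, map_sub, map_sub, boundary_map, boundary_map,
          Chain.boundary_prism]
        abel
      rw [h1, chainIntegral_boundary hX hTX hη,
        chainIntegral_boundary hX hTX (ContDiffOn.extDeriv hX hη), chainIntegral,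
        Finsupp.linearCombination_apply]
      refine Finset.sum_eq_zero fun σ _ => ?_
      simp only [pullbackIntegral]
      rw [setIntegral_eq_zero_of_forall_eq_zero, smul_zero]
      intro t _
      rw [extDeriv_extDeriv_apply (r := ∞) (hη.contDiffAt (hX.mem_nhds (hTX (σ.cubeExtend_mem t))))
        (by simp only [minSmoothness_of_isRCLikeNormedField]; exact WithTop.coe_le_coe.2 le_top)]
      rfl
  rw [← chainIntegral_boundary hX hTX hη, Chain.boundary_prism, map_sub, map_sub, hzero, sub_zero]

end Prism

/-! ### Derivatives of integrals over smooth families of chains. -/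

section Family

variable {P E E' : Type} [NormedAddCommGroup P] [NormedSpace ℝ P]
  [NormedAddCommGroup E] [NormedSpace ℝ E]
  [NormedAddCommGroup E'] [NormedSpace ℝ E'] {n : ℕ} {O : Set P} {U S : Set E}
  {g : P → E → E'}

theorem fderivWithin_family (hO : IsOpen O) (hU : IsOpen U) (hSU : S ⊆ U)
    (hg : ContDiffOn ℝ ∞ (Function.uncurry g) (O ×ˢ U)) (σ : SmoothCube S n) {A : P} (hA : A ∈ O)
    {t : Fin n → ℝ} (ht : t ∈ Icc (0 : Fin n → ℝ) 1) (v : Fin n → ℝ) :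
    fderivWithin ℝ (fun s => g A (cubeExtend σ.toFun s)) (Icc 0 1) t v =
      fderiv ℝ (Function.uncurry g) (A, cubeExtend σ.toFun t)
        (0, fderivWithin ℝ (cubeExtend σ.toFun) (Icc 0 1) t v) := by
  have hmem : (A, cubeExtend σ.toFun t) ∈ O ×ˢ U := ⟨hA, hSU (σ.cubeExtend_mem t)⟩
  have h1 : HasFDerivAt (Function.uncurry g) _ (A, cubeExtend σ.toFun t) :=
    ((hg.contDiffAt ((hO.prod hU).mem_nhds hmem)).differentiableAt (by simp)).hasFDerivAt
  have h2 := (σ.smooth.differentiableOn (by simp) t ht).hasFDerivWithinAt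
  have h3 := (h1.comp _ (hasFDerivAt_prodMk_right A (cubeExtend σ.toFun t))).comp_hasFDerivWithinAt
    t h2
  have h4 : (fun s => g A (cubeExtend σ.toFun s)) =
      (Function.uncurry g ∘ fun p => (A, p)) ∘ cubeExtend σ.toFun := rfl
  rw [h4, h3.fderivWithin (uniqueDiffOn_cube t ht)]
  simp

theorem contDiffOn_family (hSU : S ⊆ U)
    (hg : ContDiffOn ℝ ∞ (Function.uncurry g) (O ×ˢ U)) (σ : SmoothCube S n) :
    ContDiffOn ℝ ∞ (fun q : P × (Fin n → ℝ) => g q.1 (cubeExtend σ.toFun q.2))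
      (O ×ˢ Icc 0 1) :=
  hg.comp (contDiffOn_fst.prodMk (σ.smooth.comp contDiffOn_snd fun _ hq => hq.2))
    fun _ hq => mk_mem_prod hq.1 (hSU (σ.cubeExtend_mem _))

theorem contDiffOn_fderivWithin_family (hO : IsOpen O) (hU : IsOpen U) (hSU : S ⊆ U)
    (hg : ContDiffOn ℝ ∞ (Function.uncurry g) (O ×ˢ U)) (σ : SmoothCube S n) (v : Fin n → ℝ) :
    ContDiffOn ℝ ∞ (fun q : P × (Fin n → ℝ) =>
      fderivWithin ℝ (fun s => g q.1 (cubeExtend σ.toFun s)) (Icc 0 1) q.2 v) (O ×ˢ Icc 0 1) := by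
  have h1 : ContDiffOn ℝ ∞ (fun q : P × (Fin n → ℝ) =>
      fderiv ℝ (Function.uncurry g) (q.1, cubeExtend σ.toFun q.2)) (O ×ˢ Icc 0 1) :=
    (hg.fderiv_of_isOpen (hO.prod hU) (by norm_cast)).comp
      (contDiffOn_fst.prodMk (σ.smooth.comp contDiffOn_snd fun _ hq => hq.2))
      fun _ hq => mk_mem_prod hq.1 (hSU (σ.cubeExtend_mem _))
  have h2 : ContDiffOn ℝ ∞ (fun q : P × (Fin n → ℝ) =>
      fderivWithin ℝ (cubeExtend σ.toFun) (Icc 0 1) q.2 v) (O ×ˢ Icc 0 1) :=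
    ((σ.smooth.fderivWithin uniqueDiffOn_cube (by norm_cast)).comp contDiffOn_snd
      fun _ hq => hq.2).clm_apply contDiffOn_const
  exact (h1.clm_apply (contDiffOn_const.prodMk h2)).congr fun q hq =>
    fderivWithin_family hO hU hSU hg σ hq.1 hq.2 v

theorem contDiffOn_fderiv_family (hO : IsOpen O) (hU : IsOpen U) (hSU : S ⊆ U)
    (hg : ContDiffOn ℝ ∞ (Function.uncurry g) (O ×ˢ U)) (σ : SmoothCube S n) (u : P) :
    ContDiffOn ℝ ∞ (fun q : P × (Fin n → ℝ) =>
      fderiv ℝ (Function.uncurry g) (q.1, cubeExtend σ.toFun q.2) (u, 0)) (O ×ˢ Icc 0 1) :=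
  ((hg.fderiv_of_isOpen (hO.prod hU) (by norm_cast)).comp
      (contDiffOn_fst.prodMk (σ.smooth.comp contDiffOn_snd fun _ hq => hq.2))
      fun _ hq => mk_mem_prod hq.1 (hSU (σ.cubeExtend_mem _))).clm_apply contDiffOn_const

/-- The integral of `w` over the translates of a chain in a family of maps. -/
noncomputable def familyIntegral (w : E' → (Fin n → E') → ℂ) (g : P → E → E') (c : Chain S n)
    (A : P) : ℂ :=
  c.sum fun σ m => m • pullbackIntegral w fun t => g A (cubeExtend σ.toFun t)

theorem contDiffOn_familyIntegral [ProperSpace P] (hO : IsOpen O) (hU : IsOpen U) (hSU : S ⊆ U)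
    (hg : ContDiffOn ℝ ∞ (Function.uncurry g) (O ×ˢ U)) {X : Set E'}
    (hgX : ∀ A ∈ O, MapsTo (g A) S X)
    {η : E' → E' [⋀^Fin n]→L[ℝ] ℂ} (hη : ContDiffOn ℝ ∞ η X) (c : Chain S n) :
    ContDiffOn ℝ ∞ (familyIntegral (fun p v => η p v) g c) O := by
  refine ContDiffOn.sum fun σ _ => ContDiffOn.const_smul _ ?_
  refine contDiffOn_setIntegral_of_compact (f := fun q : P × (Fin n → ℝ) =>
    η (g q.1 (cubeExtend σ.toFun q.2)) fun i =>
      fderivWithin ℝ (fun s => g q.1 (cubeExtend σ.toFun s)) (Icc 0 1) q.2 (Pi.single i 1))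
    isCompact_Icc uniqueDiffOn_cube hO ?_
  refine ContDiffOn.continuousAlternatingMap_apply
    (hη.comp (contDiffOn_family hSU hg σ) fun q hq => hgX _ hq.1 (σ.cubeExtend_mem _)) ?_
  exact contDiffOn_pi.2 fun i => contDiffOn_fderivWithin_family hO hU hSU hg σ _

/-- The contribution of one cube to the derivative of the integrals of `η` over a family of
cycles. -/
noncomputable def variationIntegral (ζ : E' → (Fin (n + 1) → E') → ℂ) (g : P → E → E')
    (σ : SmoothCube S n) (u : P) (A : P) : ℂ :=
  ∫ t in Icc (0 : Fin n → ℝ) 1, ζ (g A (cubeExtend σ.toFun t))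
    (Fin.cons (fderiv ℝ (Function.uncurry g) (A, cubeExtend σ.toFun t) (u, 0)) fun i =>
      fderivWithin ℝ (fun s => g A (cubeExtend σ.toFun s)) (Icc 0 1) t (Pi.single i 1))

theorem contDiffOn_variation (hO : IsOpen O) (hU : IsOpen U) (hSU : S ⊆ U)
    (hg : ContDiffOn ℝ ∞ (Function.uncurry g) (O ×ˢ U)) {X : Set E'}
    (hgX : ∀ A ∈ O, MapsTo (g A) S X)
    {ζ : E' → E' [⋀^Fin (n + 1)]→L[ℝ] ℂ} (hζ : ContDiffOn ℝ ∞ ζ X) (σ : SmoothCube S n) (u : P) :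
    ContDiffOn ℝ ∞ (fun q : P × (Fin n → ℝ) => ζ (g q.1 (cubeExtend σ.toFun q.2))
      (Fin.cons (fderiv ℝ (Function.uncurry g) (q.1, cubeExtend σ.toFun q.2) (u, 0)) fun i =>
        fderivWithin ℝ (fun s => g q.1 (cubeExtend σ.toFun s)) (Icc 0 1) q.2 (Pi.single i 1)))
      (O ×ˢ Icc 0 1) := by
  refine ContDiffOn.continuousAlternatingMap_apply
    (hζ.comp (contDiffOn_family hSU hg σ) fun q hq => hgX _ hq.1 (σ.cubeExtend_mem _)) ?_
  refine contDiffOn_pi.2 fun i => ?_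
  refine Fin.cases ?_ (fun j => ?_) i
  · simpa using contDiffOn_fderiv_family hO hU hSU hg σ u
  · simpa using contDiffOn_fderivWithin_family hO hU hSU hg σ (Pi.single j 1)

theorem contDiffOn_variationIntegral [ProperSpace P] (hO : IsOpen O) (hU : IsOpen U) (hSU : S ⊆ U)
    (hg : ContDiffOn ℝ ∞ (Function.uncurry g) (O ×ˢ U)) {X : Set E'}
    (hgX : ∀ A ∈ O, MapsTo (g A) S X)
    {ζ : E' → E' [⋀^Fin (n + 1)]→L[ℝ] ℂ} (hζ : ContDiffOn ℝ ∞ ζ X) (σ : SmoothCube S n) (u : P) :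
    ContDiffOn ℝ ∞ (variationIntegral (fun p v => ζ p v) g σ u) O :=
  contDiffOn_setIntegral_of_compact isCompact_Icc uniqueDiffOn_cube hO
    (contDiffOn_variation hO hU hSU hg hgX hζ σ u)

/-- The prism over a straight segment of parameters has velocity `τ • u` in its first coordinate.
Multilinearity takes out the factor `τ`, and Fubini separates the time from the cube. The explicit
factor is what makes division by `τ` possible in the derivative. -/
theorem pullbackIntegral_prism_line (hO : IsOpen O) (hU : IsOpen U) (hSU : S ⊆ U)
    (hg : ContDiffOn ℝ ∞ (Function.uncurry g) (O ×ˢ U)) {X : Set E'}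
    (hgX : ∀ A ∈ O, MapsTo (g A) S X)
    {ζ : E' → E' [⋀^Fin (n + 1)]→L[ℝ] ℂ} (hζ : ContDiffOn ℝ ∞ ζ X) (σ : SmoothCube S n)
    {A u : P} {τ : ℝ} (hline : ∀ s ∈ Icc (0 : ℝ) 1, A + (s * τ) • u ∈ O)
    (hh : ContDiffOn ℝ ∞ (Function.uncurry fun s : ℝ => g (A + (s * τ) • u)) (Icc 0 1 ×ˢ S))
    (hST : ∀ s ∈ Icc (0 : ℝ) 1, MapsTo (g (A + (s * τ) • u)) S X) :
    pullbackIntegral (fun p v => ζ p v)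
        (cubeExtend (σ.prism (fun s : ℝ => g (A + (s * τ) • u)) hh hST).toFun) =
      τ • ∫ s in Icc (0 : ℝ) 1, variationIntegral (fun p v => ζ p v) g σ u (A + (s * τ) • u) := by
  set f : (Fin (n + 1) → ℝ) → E' := fun x =>
    g (A + (x 0 * τ) • u) (cubeExtend σ.toFun (Fin.tail x)) with hf
  have htail : ∀ x ∈ Icc (0 : Fin (n + 1) → ℝ) 1, Fin.tail x ∈ Icc (0 : Fin n → ℝ) 1 :=
    fun x hx => ⟨fun j => hx.1 j.succ, fun j => hx.2 j.succ⟩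
  have heq : EqOn (cubeExtend (σ.prism (fun s : ℝ => g (A + (s * τ) • u)) hh hST).toFun) f
      (Icc 0 1) := by
    intro x hx
    simp only [cubeExtend, SmoothCube.prism, hf]
    rw [projIcc_of_mem zero_le_one (⟨hx.1 0, hx.2 0⟩ : x 0 ∈ Icc (0 : ℝ) 1)]
    rfl
  set T : (Fin (n + 1) → ℝ) →L[ℝ] (Fin n → ℝ) :=
    ContinuousLinearMap.pi fun j => ContinuousLinearMap.proj j.succ with hT
  have hTx : ∀ x, T x = Fin.tail x := fun x => rfl
  have hder : ∀ x ∈ Icc (0 : Fin (n + 1) → ℝ) 1, ∀ v,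
      fderivWithin ℝ f (Icc 0 1) x v =
        fderiv ℝ (Function.uncurry g) (A + (x 0 * τ) • u, cubeExtend σ.toFun (Fin.tail x))
          ((v 0 * τ) • u, fderivWithin ℝ (cubeExtend σ.toFun) (Icc 0 1) (Fin.tail x) (T v)) := by
    intro x hx v
    have hmem : (A + (x 0 * τ) • u, cubeExtend σ.toFun (Fin.tail x)) ∈ O ×ˢ U :=
      ⟨hline _ ⟨hx.1 0, hx.2 0⟩, hSU (σ.cubeExtend_mem _)⟩
    have h1 : HasFDerivAt (Function.uncurry g) _ _ :=
      ((hg.contDiffAt ((hO.prod hU).mem_nhds hmem)).differentiableAt (by simp)).hasFDerivAt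
    have h2 : HasFDerivWithinAt (cubeExtend σ.toFun) _ (Icc 0 1) (T x) :=
      (σ.smooth.differentiableOn (by simp) _ (htail x hx)).hasFDerivWithinAt
    have h3 := h2.comp x T.hasFDerivAt.hasFDerivWithinAt htail
    have h4 : HasFDerivAt (fun x : Fin (n + 1) → ℝ => A + (x 0 * τ) • u)
        ((τ • ContinuousLinearMap.proj (R := ℝ) (φ := fun _ : Fin (n + 1) => ℝ) 0).smulRight u)
        x := by
      have h5 : (fun x : Fin (n + 1) → ℝ => A + (x 0 * τ) • u) = fun x => A +
          ((τ • ContinuousLinearMap.proj (R := ℝ) (φ := fun _ : Fin (n + 1) => ℝ) 0).smulRight u)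
            x := by
        ext x
        simp [mul_comm]
      rw [h5]
      exact (ContinuousLinearMap.hasFDerivAt _).const_add _
    have h6 := h1.comp_hasFDerivWithinAt x (h4.hasFDerivWithinAt.prodMk h3)
    have h7 : f = Function.uncurry g ∘ fun x : Fin (n + 1) → ℝ =>
      (A + (x 0 * τ) • u, (cubeExtend σ.toFun ∘ T) x) := rfl
    rw [h7, h6.fderivWithin (uniqueDiffOn_cube x hx)]
    simp [mul_comm, hTx]
  have hcons : ∀ x ∈ Icc (0 : Fin (n + 1) → ℝ) 1,
      ζ (f x) (fun i => fderivWithin ℝ f (Icc 0 1) x (Pi.single i 1)) =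
      τ • ζ (g (A + (x 0 * τ) • u) (cubeExtend σ.toFun (Fin.tail x)))
        (Fin.cons (fderiv ℝ (Function.uncurry g)
          (A + (x 0 * τ) • u, cubeExtend σ.toFun (Fin.tail x)) (u, 0)) fun i =>
          fderivWithin ℝ (fun s => g (A + (x 0 * τ) • u) (cubeExtend σ.toFun s)) (Icc 0 1)
            (Fin.tail x) (Pi.single i 1)) := by
    intro x hx
    have hv : (fun i => fderivWithin ℝ f (Icc 0 1) x (Pi.single i 1)) =
        Function.update (Fin.cons (fderiv ℝ (Function.uncurry g)
          (A + (x 0 * τ) • u, cubeExtend σ.toFun (Fin.tail x)) (u, 0)) fun i =>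
          fderivWithin ℝ (fun s => g (A + (x 0 * τ) • u) (cubeExtend σ.toFun s)) (Icc 0 1)
            (Fin.tail x) (Pi.single i 1) : Fin (n + 1) → E') 0
          (τ • fderiv ℝ (Function.uncurry g)
            (A + (x 0 * τ) • u, cubeExtend σ.toFun (Fin.tail x)) (u, 0)) := by
      rw [Fin.update_cons_zero]
      ext1 i
      rw [hder x hx]
      refine Fin.cases ?_ (fun j => ?_) i
      · have h1 : T (Pi.single 0 1) = 0 := by
          ext j
          simp [hT]
        rw [h1, Fin.cons_zero, ← map_smul]
        simp
      · have h1 : T (Pi.single j.succ 1) = Pi.single j 1 := by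
          ext k
          simp [hT, Pi.single_apply]
        rw [h1, Fin.cons_succ, fderivWithin_family hO hU hSU hg σ (hline _ ⟨hx.1 0, hx.2 0⟩)
          (htail x hx)]
        simp
    rw [hv, (ζ _).map_update_smul, Fin.update_cons_zero]
  have hcont : ContinuousOn (fun x : Fin (n + 1) → ℝ =>
      ζ (g (A + (x 0 * τ) • u) (cubeExtend σ.toFun (Fin.tail x)))
        (Fin.cons (fderiv ℝ (Function.uncurry g)
          (A + (x 0 * τ) • u, cubeExtend σ.toFun (Fin.tail x)) (u, 0)) fun i =>
          fderivWithin ℝ (fun s => g (A + (x 0 * τ) • u) (cubeExtend σ.toFun s)) (Icc 0 1)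
            (Fin.tail x) (Pi.single i 1))) (Icc 0 1) := by
    refine (contDiffOn_variation hO hU hSU hg hgX hζ σ u).continuousOn.comp
      (f := fun x : Fin (n + 1) → ℝ => (A + (x 0 * τ) • u, T x)) (by fun_prop) ?_
    exact fun x hx => mk_mem_prod (hline _ ⟨hx.1 0, hx.2 0⟩) (htail x hx)
  have hL : pullbackIntegral (fun p v => ζ p v)
      (cubeExtend (σ.prism (fun s : ℝ => g (A + (s * τ) • u)) hh hST).toFun) =
      ∫ x in Icc (0 : Fin (n + 1) → ℝ) 1, τ •
        ζ (g (A + (x 0 * τ) • u) (cubeExtend σ.toFun (Fin.tail x)))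
        (Fin.cons (fderiv ℝ (Function.uncurry g)
          (A + (x 0 * τ) • u, cubeExtend σ.toFun (Fin.tail x)) (u, 0)) fun i =>
          fderivWithin ℝ (fun s => g (A + (x 0 * τ) • u) (cubeExtend σ.toFun s)) (Icc 0 1)
            (Fin.tail x) (Pi.single i 1)) := by
    refine setIntegral_congr_fun measurableSet_Icc fun x hx => ?_
    simp only
    rw [← hcons x hx, heq hx, fderivWithin_congr heq (heq hx)]
  rw [hL, integral_smul, setIntegral_Icc_fin_succ hcont]
  rfl

/-- The derivative of the integrals of a form over a family of cycles. -/
theorem fderiv_familyIntegral [ProperSpace P] (hO : IsOpen O) (hU : IsOpen U) (hSU : S ⊆ U)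
    (hg : ContDiffOn ℝ ∞ (Function.uncurry g) (O ×ˢ U)) {X : Set E'} (hX : IsOpen X)
    (hgX : ∀ A ∈ O, MapsTo (g A) S X)
    {η : E' → E' [⋀^Fin (n + 1)]→L[ℝ] ℂ} (hη : ContDiffOn ℝ ∞ η X) {c : Chain S (n + 1)}
    (hc : c.IsClosed) {A : P} (hA : A ∈ O) (u : P) :
    fderiv ℝ (familyIntegral (fun p v => η p v) g c) A u =
      c.sum fun σ m => m • variationIntegral (fun p v => extDeriv η p v) g σ u A := by
  set N := familyIntegral (fun p v => η p v) g c with hN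
  have hζ : ContDiffOn ℝ ∞ (extDeriv η) X := ContDiffOn.extDeriv hX hη
  set κ : P → ℂ := fun B =>
    c.sum fun σ m => m • variationIntegral (fun p v => extDeriv η p v) g σ u B with hκ
  have hκs : ContDiffOn ℝ ∞ κ O := ContDiffOn.sum fun σ _ =>
    ContDiffOn.const_smul _ (contDiffOn_variationIntegral hO hU hSU hg hgX hζ σ u)
  -- a neighbourhood of `0` that the line through `A` maps into `O`
  have hlc : ContinuousAt (fun τ : ℝ => A + τ • u) 0 := by fun_prop
  have hev : ∀ᶠ τ : ℝ in 𝓝 0, A + τ • u ∈ O := hlc (by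
    simpa using hO.mem_nhds hA)
  obtain ⟨δ, hδ, hball⟩ := Metric.eventually_nhds_iff_ball.1 hev
  have hline : ∀ τ ∈ Metric.ball (0 : ℝ) δ, ∀ s ∈ Icc (0 : ℝ) 1, A + (s * τ) • u ∈ O := by
    intro τ hτ s hs
    refine hball _ ?_
    rw [mem_ball_zero_iff] at hτ ⊢
    rw [norm_mul, Real.norm_of_nonneg hs.1]
    exact (mul_le_of_le_one_left (norm_nonneg _) hs.2).trans_lt hτ
  have hJs : ContDiffOn ℝ ∞ (fun τ : ℝ => ∫ s in Icc (0 : ℝ) 1, κ (A + (s * τ) • u))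
      (Metric.ball 0 δ) := by
    refine contDiffOn_setIntegral_of_compact (f := fun q : ℝ × ℝ => κ (A + (q.2 * q.1) • u))
      isCompact_Icc (uniqueDiffOn_Icc zero_lt_one) Metric.isOpen_ball ?_
    refine hκs.comp ?_ fun q hq => hline _ hq.1 _ hq.2
    exact (contDiff_const.add ((contDiff_snd.mul contDiff_fst).smul contDiff_const)).contDiffOn
  -- The homotopy formula along the segment from `A` to `A + τ • u` expresses the increment exactly,
  -- as `τ` times the average of `κ` over the segment.
  have hNτ : ∀ τ ∈ Metric.ball (0 : ℝ) δ,
      N (A + τ • u) - N A = τ • ∫ s in Icc (0 : ℝ) 1, κ (A + (s * τ) • u) := by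
    intro τ hτ
    have hh : ContDiffOn ℝ ∞ (Function.uncurry fun s : ℝ => g (A + (s * τ) • u))
        (Icc 0 1 ×ˢ S) := by
      refine hg.comp (f := fun q : ℝ × E => (A + (q.1 * τ) • u, q.2)) ?_
        fun q hq => mk_mem_prod (hline τ hτ _ hq.1) (hSU hq.2)
      exact ((contDiff_const.add ((contDiff_fst.mul contDiff_const).smul contDiff_const)).prodMk
        contDiff_snd).contDiffOn
    have hST : ∀ s ∈ Icc (0 : ℝ) 1, MapsTo (g (A + (s * τ) • u)) S X :=
      fun s hs => hgX _ (hline τ hτ s hs)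
    have h1 := chainIntegral_homotopy _ hh hST hX le_rfl hη hc
    rw [chainIntegral_map, chainIntegral_map, Chain.prism, Finsupp.lmapDomain_apply, chainIntegral,
      Finsupp.linearCombination_mapDomain, Finsupp.linearCombination_apply] at h1
    simp only [one_mul, zero_mul, zero_smul, add_zero, Function.comp_def] at h1
    rw [hN]
    refine h1.trans ?_
    rw [Finsupp.sum, hκ]
    simp only [Finsupp.sum]
    rw [integral_finsetSum, Finset.smul_sum]
    · refine Finset.sum_congr rfl fun σ _ => ?_
      rw [pullbackIntegral_prism_line hO hU hSU hg hgX hζ σ (hline τ hτ) hh hST]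
      simp only [zsmul_eq_mul]
      rw [integral_const_mul, mul_smul_comm]
    · intro σ _
      refine ContinuousOn.integrableOn_compact isCompact_Icc (ContinuousOn.const_smul ?_ _)
      refine (contDiffOn_variationIntegral hO hU hSU hg hgX hζ σ u).continuousOn.comp
        (f := fun s : ℝ => A + (s * τ) • u) (by fun_prop) fun s hs => hline τ hτ s hs
  have hNd : HasFDerivAt N (fderiv ℝ N A) A :=
    (((contDiffOn_familyIntegral hO hU hSU hg hgX hη c).contDiffAt
      (hO.mem_nhds hA)).differentiableAt (by simp)).hasFDerivAt
  have hd1 : HasDerivAt (fun τ : ℝ => N (A + τ • u)) (fderiv ℝ N A u) 0 := by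
    have h1 : HasDerivAt (fun τ : ℝ => A + τ • u) u 0 := by
      simpa using ((hasDerivAt_id (0 : ℝ)).smul_const u).const_add A
    exact hNd.comp_hasDerivAt_of_eq (0 : ℝ) h1 (by simp)
  -- The product rule for `τ` times the average leaves the average at `τ = 0`, which is `κ A`.
  have hd2 : HasDerivAt (fun τ : ℝ => N (A + τ • u)) (κ A) 0 := by
    have h0 : (0 : ℝ) ∈ Metric.ball (0 : ℝ) δ := Metric.mem_ball_self hδ
    have hJd := ((hJs.contDiffAt (Metric.isOpen_ball.mem_nhds h0)).differentiableAt
      (by simp)).hasDerivAt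
    have h1 := ((hasDerivAt_id (0 : ℝ)).smul hJd).const_add (N A)
    have h2 : HasDerivAt (fun τ : ℝ => N A + τ • ∫ s in Icc (0 : ℝ) 1, κ (A + (s * τ) • u))
        (κ A) 0 := h1.congr_deriv (by simp)
    refine h2.congr_of_eventuallyEq ?_
    filter_upwards [Metric.isOpen_ball.mem_nhds h0] with τ hτ
    rw [← hNτ τ hτ]
    ring
  exact hd1.unique hd2

end Family

/-! ### Laurent monomials and the derivatives of `F`. -/

section Monomials

/-- The domain `ℂ² × (ℂ^*)²`. -/
def torusDomain : Set (Fin 4 → ℂ) := {p | p 2 ≠ 0 ∧ p 3 ≠ 0}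

theorem isOpen_torusDomain : IsOpen torusDomain :=
  (isOpen_ne.preimage (continuous_apply 2)).inter (isOpen_ne.preimage (continuous_apply 3))

/-- The monomial `W₁ ^ m₀ W₂ ^ m₁`. -/
noncomputable def torusMonomial (m : Fin 2 → ℤ) (p : Fin 4 → ℂ) : ℂ := p 2 ^ m 0 * p 3 ^ m 1

theorem torusMonomial_zero (p : Fin 4 → ℂ) : torusMonomial 0 p = 1 := by simp [torusMonomial]

theorem torusMonomial_add (m m' : Fin 2 → ℤ) {p : Fin 4 → ℂ} (hp : p ∈ torusDomain) :
    torusMonomial (m + m') p = torusMonomial m p * torusMonomial m' p := by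
  simp only [torusMonomial, Pi.add_apply, zpow_add₀ hp.1, zpow_add₀ hp.2]
  ring

theorem contDiffOn_torusMonomial (m : Fin 2 → ℤ) :
    ContDiffOn ℝ ∞ (torusMonomial m) torusDomain := by
  have h : ∀ (i : Fin 4) (k : ℤ), ContDiffOn ℝ ∞ (fun p : Fin 4 → ℂ => p i ^ k)
      {p | p i ≠ 0} := by
    intro i k
    have hi : ContDiffOn ℝ ∞ (fun p : Fin 4 → ℂ => p i) {p | p i ≠ 0} :=
      (contDiff_apply ℝ ℂ i).contDiffOn
    rcases k with k | k
    · simpa using hi.pow k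
    · simp only [zpow_negSucc]
      exact (hi.pow (k + 1)).inv fun p hp => pow_ne_zero _ hp
  exact ((h 2 (m 0)).mono fun p hp => hp.1).mul ((h 3 (m 1)).mono fun p hp => hp.2)

/-- The differential of a monomial. -/
noncomputable def torusMonomialDeriv (m : Fin 2 → ℤ) (p : Fin 4 → ℂ) : (Fin 4 → ℂ) →L[ℂ] ℂ :=
  ((m 0 : ℂ) * torusMonomial (m - ![1, 0]) p) • ContinuousLinearMap.proj 2 +
    ((m 1 : ℂ) * torusMonomial (m - ![0, 1]) p) • ContinuousLinearMap.proj 3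

theorem hasFDerivAt_torusMonomial (m : Fin 2 → ℤ) {p : Fin 4 → ℂ} (hp : p ∈ torusDomain) :
    HasFDerivAt (torusMonomial m) (torusMonomialDeriv m p) p := by
  have h2 := (hasDerivAt_zpow (m 0) (p 2) (Or.inl hp.1)).comp_hasFDerivAt p
    (hasFDerivAt_apply (𝕜 := ℂ) (F' := fun _ : Fin 4 => ℂ) 2 p)
  have h3 := (hasDerivAt_zpow (m 1) (p 3) (Or.inl hp.2)).comp_hasFDerivAt p
    (hasFDerivAt_apply (𝕜 := ℂ) (F' := fun _ : Fin 4 => ℂ) 3 p)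
  refine (h2.mul h3).congr_fderiv ?_
  ext v
  simp [torusMonomialDeriv, torusMonomial]
  ring

/-- Euler's relation: a monomial is an eigenfunction of every field that scales the coordinates
separately. -/
theorem torusMonomialDeriv_mul (m : Fin 2 → ℤ) {p : Fin 4 → ℂ} (hp : p ∈ torusDomain)
    (c : Fin 4 → ℂ) : torusMonomialDeriv m p (c * p) =
      (m 0 * c 2 + m 1 * c 3) * torusMonomial m p := by
  simp [torusMonomialDeriv, torusMonomial, zpow_sub_one₀ hp.1, zpow_sub_one₀ hp.2]
  field_simp [hp.1, hp.2]

variable {K : ℕ} (e : Fin K → Fin 2 → ℤ)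

theorem mirrorF_eq (a : Fin K → ℂ) (p : Fin 4 → ℂ) :
    mirrorF e a p = p 0 ^ 2 + p 1 ^ 2 + ∑ k, a k * torusMonomial (e k) p := rfl

/-- The differential of `F(a; ·)`. -/
noncomputable def mirrorDeriv (a : Fin K → ℂ) (p : Fin 4 → ℂ) : (Fin 4 → ℂ) →L[ℂ] ℂ :=
  (2 * p 0) • ContinuousLinearMap.proj 0 + (2 * p 1) • ContinuousLinearMap.proj 1 +
    ∑ k, a k • torusMonomialDeriv (e k) p

theorem hasFDerivAt_mirrorF (a : Fin K → ℂ) {p : Fin 4 → ℂ} (hp : p ∈ torusDomain) :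
    HasFDerivAt (mirrorF e a) (mirrorDeriv e a p) p := by
  have h0 := (hasFDerivAt_apply (𝕜 := ℂ) (F' := fun _ : Fin 4 => ℂ) 0 p).pow 2
  have h1 := (hasFDerivAt_apply (𝕜 := ℂ) (F' := fun _ : Fin 4 => ℂ) 1 p).pow 2
  refine ((h0.add h1).add (HasFDerivAt.fun_sum (u := Finset.univ) fun k _ =>
    (hasFDerivAt_torusMonomial (e k) hp).const_mul (a k))).congr_fderiv ?_
  simp [mirrorDeriv]

theorem fderiv_mirrorF (a : Fin K → ℂ) {p : Fin 4 → ℂ} (hp : p ∈ torusDomain) :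
    fderiv ℂ (mirrorF e a) p = mirrorDeriv e a p := (hasFDerivAt_mirrorF e a hp).fderiv

theorem contDiffOn_mirrorF :
    ContDiffOn ℝ ∞ (fun q : (Fin K → ℂ) × (Fin 4 → ℂ) => mirrorF e q.1 q.2)
      (univ ×ˢ torusDomain) := by
  have hp : ∀ i, ContDiff ℝ ∞ fun q : (Fin K → ℂ) × (Fin 4 → ℂ) => q.2 i := fun i =>
    (contDiff_apply ℝ ℂ i).comp contDiff_snd
  have ha : ∀ k, ContDiff ℝ ∞ fun q : (Fin K → ℂ) × (Fin 4 → ℂ) => q.1 k := fun k =>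
    (contDiff_apply ℝ ℂ k).comp contDiff_fst
  refine (((hp 0).pow 2).add ((hp 1).pow 2)).contDiffOn.add (ContDiffOn.sum fun k _ => ?_)
  exact (ha k).contDiffOn.mul ((contDiffOn_torusMonomial (e k)).comp contDiffOn_snd
    fun q hq => hq.2)

theorem contDiffOn_mirrorDeriv_apply (v : Fin 4 → ℂ) :
    ContDiffOn ℝ ∞ (fun q : (Fin K → ℂ) × (Fin 4 → ℂ) => mirrorDeriv e q.1 q.2 v)
      (univ ×ˢ torusDomain) := by
  have hp : ∀ i, ContDiff ℝ ∞ fun q : (Fin K → ℂ) × (Fin 4 → ℂ) => q.2 i := fun i =>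
    (contDiff_apply ℝ ℂ i).comp contDiff_snd
  have ha : ∀ k, ContDiff ℝ ∞ fun q : (Fin K → ℂ) × (Fin 4 → ℂ) => q.1 k := fun k =>
    (contDiff_apply ℝ ℂ k).comp contDiff_fst
  have hm : ∀ m, ContDiffOn ℝ ∞ (fun q : (Fin K → ℂ) × (Fin 4 → ℂ) => torusMonomial m q.2)
      (univ ×ˢ torusDomain) := fun m =>
    (contDiffOn_torusMonomial m).comp contDiffOn_snd fun q hq => hq.2
  simp only [mirrorDeriv, torusMonomialDeriv, add_apply, smul_apply, sum_apply,
    ContinuousLinearMap.proj_apply, smul_eq_mul]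
  refine (((contDiff_const.mul (hp 0)).mul contDiff_const).contDiffOn.add
    ((contDiff_const.mul (hp 1)).mul contDiff_const).contDiffOn).add
    (ContDiffOn.sum fun k _ => (ha k).contDiffOn.mul ?_)
  exact ((contDiffOn_const.mul (hm _)).mul contDiffOn_const).add
    ((contDiffOn_const.mul (hm _)).mul contDiffOn_const)

/-- The derivative of `F(a; p)` in `a` and `p`. -/
theorem hasFDerivAt_mirrorF_uncurry (a : Fin K → ℂ) {p : Fin 4 → ℂ} (hp : p ∈ torusDomain) :
    HasFDerivAt (fun q : (Fin K → ℂ) × (Fin 4 → ℂ) => mirrorF e q.1 q.2)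
      ((∑ k, torusMonomial (e k) p • (ContinuousLinearMap.proj k).comp
          (ContinuousLinearMap.fst ℂ (Fin K → ℂ) (Fin 4 → ℂ))) +
        (mirrorDeriv e a p).comp (ContinuousLinearMap.snd ℂ (Fin K → ℂ) (Fin 4 → ℂ)))
      (a, p) := by
  have hp' : ∀ i, HasFDerivAt (fun q : (Fin K → ℂ) × (Fin 4 → ℂ) => q.2 i)
      ((ContinuousLinearMap.proj (R := ℂ) (φ := fun _ : Fin 4 => ℂ) i).comp
        (ContinuousLinearMap.snd ℂ (Fin K → ℂ) (Fin 4 → ℂ))) (a, p) := fun i =>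
    ((ContinuousLinearMap.proj (R := ℂ) (φ := fun _ : Fin 4 => ℂ) i).comp
        (ContinuousLinearMap.snd ℂ (Fin K → ℂ) (Fin 4 → ℂ))).hasFDerivAt
  have ha' : ∀ k, HasFDerivAt (fun q : (Fin K → ℂ) × (Fin 4 → ℂ) => q.1 k)
      ((ContinuousLinearMap.proj (R := ℂ) (φ := fun _ : Fin K => ℂ) k).comp
        (ContinuousLinearMap.fst ℂ (Fin K → ℂ) (Fin 4 → ℂ))) (a, p) := fun k =>
    ((ContinuousLinearMap.proj (R := ℂ) (φ := fun _ : Fin K => ℂ) k).comp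
        (ContinuousLinearMap.fst ℂ (Fin K → ℂ) (Fin 4 → ℂ))).hasFDerivAt
  have hm : ∀ m, HasFDerivAt (fun q : (Fin K → ℂ) × (Fin 4 → ℂ) => torusMonomial m q.2)
      ((torusMonomialDeriv m p).comp (ContinuousLinearMap.snd ℂ (Fin K → ℂ) (Fin 4 → ℂ)))
      (a, p) := fun m =>
    HasFDerivAt.comp (f := (Prod.snd : (Fin K → ℂ) × (Fin 4 → ℂ) → _)) (g := torusMonomial m) (a, p)
      (hasFDerivAt_torusMonomial m hp) hasFDerivAt_snd
  refine ((((hp' 0).pow 2).add ((hp' 1).pow 2)).add (HasFDerivAt.fun_sum (u := Finset.univ)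
    fun k _ => (ha' k).mul (hm (e k)))).congr_fderiv ?_
  ext v
  · simp
  · simp [mirrorDeriv]

end Monomials

/-! ### Contractions of the volume form with Euler vector fields. -/

section Forms

open scoped Matrix

/-- `∑ i, det (…, B v i, …) = tr B · det v`. -/
theorem sum_det_update_mulVec {n : ℕ} {R : Type*} [CommRing R] (B M : Matrix (Fin n) (Fin n) R) :
    ∑ i, (M.updateRow i (B.mulVec (M i))).det = B.trace * M.det := by
  -- Cramer's rule: each determinant is a diagonal entry of a product, so the sum is a trace and can
  -- be permuted cyclically.
  have h : ∀ i, (M.updateRow i (B.mulVec (M i))).det =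
      (Mᵀ.adjugate * (B * Mᵀ)) i i := by
    intro i
    rw [← Matrix.cramer_transpose_apply, Matrix.cramer_eq_adjugate_mulVec, Matrix.mul_apply]
    rfl
  calc ∑ i, (M.updateRow i (B.mulVec (M i))).det = (Mᵀ.adjugate * (B * Mᵀ)).trace :=
        Finset.sum_congr rfl fun i _ => h i
    _ = (B * (Mᵀ * Mᵀ.adjugate)).trace := by
        rw [Matrix.trace_mul_comm, Matrix.mul_assoc]
    _ = B.trace * M.det := by
        rw [Matrix.mul_adjugate, Matrix.det_transpose, Matrix.mul_smul, Matrix.mul_one,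
          Matrix.trace_smul, smul_eq_mul, mul_comm]

/-- The determinant as a real alternating form on `ℂⁿ`. -/
noncomputable def detForm (n : ℕ) : (Fin n → ℂ) [⋀^Fin n]→L[ℝ] ℂ :=
  ContinuousAlternatingMap.restrictScalars ℝ
    { toMultilinearMap := (Matrix.detRowAlternating (R := ℂ) (n := Fin n)).toMultilinearMap
      cont := by
        have h : Continuous fun M : Matrix (Fin n) (Fin n) ℂ => M.det := continuous_id.matrix_det
        exact h
      map_eq_zero_of_eq' := (Matrix.detRowAlternating (R := ℂ) (n := Fin n)).map_eq_zero_of_eq' }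

theorem detForm_apply (n : ℕ) (v : Fin n → Fin n → ℂ) : detForm n v = (Matrix.of v).det := rfl

/-- The contraction of the vector field `V` with the standard volume form. -/
noncomputable def contraction {n : ℕ} (V : (Fin (n + 1) → ℂ) → Fin (n + 1) → ℂ)
    (p : Fin (n + 1) → ℂ) : (Fin (n + 1) → ℂ) [⋀^Fin n]→L[ℝ] ℂ :=
  (detForm (n + 1)).curryLeft (V p)

theorem contraction_apply {n : ℕ} (V : (Fin (n + 1) → ℂ) → Fin (n + 1) → ℂ)
    (p : Fin (n + 1) → ℂ) (v : Fin n → Fin (n + 1) → ℂ) :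
    contraction V p v = (Matrix.of (Fin.cons (V p) v : Fin (n + 1) → Fin (n + 1) → ℂ)).det := rfl

/-- This is $d(\iota_V\mathrm{vol})=\operatorname{div}V\cdot\mathrm{vol}$. The alternating sum
defining the exterior derivative replaces the vectors one at a time by their images under `D`, and
the determinant identity collects these terms into the trace. -/
theorem extDeriv_contraction {n : ℕ} {V : (Fin (n + 1) → ℂ) → Fin (n + 1) → ℂ}
    {p : Fin (n + 1) → ℂ} {D : (Fin (n + 1) → ℂ) →L[ℂ] (Fin (n + 1) → ℂ)}
    (hV : HasFDerivAt V D p) (v : Fin (n + 1) → Fin (n + 1) → ℂ) :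
    extDeriv (contraction V) p v = (∑ i, D (Pi.single i 1) i) * (Matrix.of v).det := by
  have h1 : HasFDerivAt (contraction V)
      ((detForm (n + 1)).curryLeft.comp (D.restrictScalars ℝ)) p :=
    ((detForm (n + 1)).curryLeft.hasFDerivAt).comp p (hV.restrictScalars ℝ)
  rw [extDeriv, h1.fderiv, ContinuousAlternatingMap.alternatizeUncurryFin_apply]
  have h2 : ∀ i : Fin (n + 1), (-1 : ℤ) ^ (i : ℕ) •
      ((detForm (n + 1)).curryLeft.comp (D.restrictScalars ℝ)) (v i) (i.removeNth v) =
      ((Matrix.of v).updateRow i ((LinearMap.toMatrix' (D : (Fin (n + 1) → ℂ) →ₗ[ℂ] _)).mulVec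
        (Matrix.of v i))).det := by
    intro i
    have h3 := (detForm (n + 1)).map_insertNth i (D (v i)) (i.removeNth v)
    rw [Fin.insertNth_removeNth, detForm_apply] at h3
    have h4 : (LinearMap.toMatrix' (D : (Fin (n + 1) → ℂ) →ₗ[ℂ] _)).mulVec (Matrix.of v i) =
        D (v i) := by
      rw [LinearMap.toMatrix'_mulVec]
      rfl
    rw [h4]
    exact h3.symm
  rw [Finset.sum_congr rfl fun i _ => h2 i, sum_det_update_mulVec]
  congr 1

theorem contDiffOn_contraction {n : ℕ} {V : (Fin (n + 1) → ℂ) → Fin (n + 1) → ℂ}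
    {X : Set (Fin (n + 1) → ℂ)} (hV : ContDiffOn ℝ ∞ V X) :
    ContDiffOn ℝ ∞ (contraction V) X :=
  (ContinuousLinearMap.contDiff _).comp_contDiffOn hV

/-- The vector field `W^m (c₀ U ∂_U + c₁ V ∂_V + c₂ W₁ ∂_{W₁} + c₃ W₂ ∂_{W₂})`, divided by
`W₁ W₂`. -/
noncomputable def eulerField (c : Fin 4 → ℂ) (m : Fin 2 → ℤ) (p : Fin 4 → ℂ) : Fin 4 → ℂ :=
  torusMonomial (m - 1) p • (c * p)

/-- The contraction of an Euler vector field with `W^m dU dV dW₁/W₁ dW₂/W₂`. -/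
noncomputable def eulerForm (c : Fin 4 → ℂ) (m : Fin 2 → ℤ) (p : Fin 4 → ℂ) :
    (Fin 4 → ℂ) [⋀^Fin 3]→L[ℝ] ℂ :=
  contraction (n := 3) (eulerField c m) p

theorem torusMonomial_sub_one (m : Fin 2 → ℤ) {p : Fin 4 → ℂ} (hp : p ∈ torusDomain) :
    torusMonomial (m - 1) p = torusMonomial m p / (p 2 * p 3) := by
  simp [torusMonomial, zpow_sub_one₀ hp.1, zpow_sub_one₀ hp.2]
  field_simp

theorem eulerForm_apply (c : Fin 4 → ℂ) (m : Fin 2 → ℤ) {p : Fin 4 → ℂ} (hp : p ∈ torusDomain)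
    (v : Fin 3 → Fin 4 → ℂ) :
    eulerForm c m p v = torusMonomial m p * ambientForm p (Fin.cons (c * p) v) := by
  have h : (Matrix.of (Fin.cons (eulerField c m p) v : Fin 4 → Fin 4 → ℂ)).det =
      torusMonomial (m - 1) p *
        (Matrix.of (Fin.cons (c * p) v : Fin 4 → Fin 4 → ℂ)).det := by
    have h0 : ∀ x : Fin 4 → ℂ, (Matrix.of (Fin.cons x v : Fin 4 → Fin 4 → ℂ)) =
        (Matrix.of (Fin.cons (c * p) v : Fin 4 → Fin 4 → ℂ)).updateRow 0 x := by
      intro x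
      ext i j
      refine Fin.cases ?_ (fun k => ?_) i <;> simp
    rw [h0 (eulerField c m p), eulerField, Matrix.det_updateRow_smul, ← h0]
  rw [eulerForm, contraction_apply, h, torusMonomial_sub_one m hp, ambientForm]
  ring

theorem contDiffOn_eulerForm (c : Fin 4 → ℂ) (m : Fin 2 → ℤ) :
    ContDiffOn ℝ ∞ (eulerForm c m) torusDomain := by
  refine contDiffOn_contraction ((contDiffOn_torusMonomial _).smul ?_)
  exact (contDiff_pi.2 fun i => contDiff_const.mul (contDiff_apply ℝ ℂ i)).contDiffOn

/-- The weight of `W^m dU dV dW₁/W₁ dW₂/W₂` under an Euler vector field. -/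
noncomputable def eulerWeight (c : Fin 4 → ℂ) (m : Fin 2 → ℤ) : ℂ :=
  c 0 + c 1 + m 0 * c 2 + m 1 * c 3

/-- The divergence of $W^{m-1}\cdot(c\,p)$ is $\sum c_i$ plus the Euler weight of $W^{m-1}$. The
shift by $-1$, coming from the factor $1/(W_1W_2)$ in the volume form, cancels $c_2+c_3$. -/
theorem extDeriv_eulerForm (c : Fin 4 → ℂ) (m : Fin 2 → ℤ) {p : Fin 4 → ℂ}
    (hp : p ∈ torusDomain) (v : Fin 4 → Fin 4 → ℂ) :
    extDeriv (eulerForm c m) p v = eulerWeight c m * torusMonomial m p * ambientForm p v := by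
  have hlin : HasFDerivAt (fun p : Fin 4 → ℂ => c * p)
      (ContinuousLinearMap.pi fun i => c i • ContinuousLinearMap.proj (R := ℂ) i) p :=
    (ContinuousLinearMap.pi fun i => c i • ContinuousLinearMap.proj (R := ℂ)
      (φ := fun _ : Fin 4 => ℂ) i).hasFDerivAt
  have hV := (hasFDerivAt_torusMonomial (m - 1) hp).smul hlin
  have h1 := extDeriv_contraction (n := 3) hV v
  have h2 : extDeriv (eulerForm c m) p v = extDeriv (contraction (n := 3)
    (torusMonomial (m - 1) • fun p : Fin 4 → ℂ => c * p)) p v := rfl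
  rw [h2, h1, ambientForm]
  have h3 : ∑ i, torusMonomialDeriv (m - 1) p (Pi.single i 1) * (c i * p i) =
      torusMonomialDeriv (m - 1) p (c * p) := by
    rw [pi_eq_sum_univ' (c * p), map_sum]
    refine Finset.sum_congr rfl fun i _ => ?_
    rw [map_smul, smul_eq_mul, mul_comm]
    rfl
  have h4 : ∑ i, (torusMonomial (m - 1) p • (ContinuousLinearMap.pi fun i =>
      c i • ContinuousLinearMap.proj (R := ℂ) (φ := fun _ : Fin 4 => ℂ) i) +
      (torusMonomialDeriv (m - 1) p).smulRight (c * p)) (Pi.single i 1) i =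
      torusMonomial (m - 1) p * ∑ i, c i + torusMonomialDeriv (m - 1) p (c * p) := by
    rw [← h3, Finset.mul_sum, ← Finset.sum_add_distrib]
    refine Finset.sum_congr rfl fun i _ => ?_
    simp
  rw [h4, torusMonomialDeriv_mul _ hp, torusMonomial_sub_one m hp, Fin.sum_univ_four, eulerWeight]
  simp
  ring

end Forms

/-! ### Moments of the residue form over cycles in the level sets. -/

variable {K : ℕ}

/-- A smooth family of maps into the level sets `{F(a; ·) = z}`, parametrized by `(a, z)`. -/
structure IsLevelFamily (e : Fin K → Fin 2 → ℤ) (O : Set ((Fin K → ℂ) × ℂ))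
    (U S : Set (Fin 4 → ℂ)) (Ψ : (Fin K → ℂ) × ℂ → (Fin 4 → ℂ) → Fin 4 → ℂ) : Prop where
  isOpen_param : IsOpen O
  isOpen_source : IsOpen U
  subset : S ⊆ U
  smooth : ContDiffOn ℝ ∞ (Function.uncurry Ψ) (O ×ˢ U)
  mem : ∀ A ∈ O, ∀ p ∈ S, Ψ A p ∈ torusDomain
  level : ∀ A ∈ O, ∀ p ∈ S, mirrorF e A.1 (Ψ A p) = A.2
  regular : ∀ A ∈ O, ∀ p ∈ S, mirrorDeriv e A.1 (Ψ A p) ≠ 0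

/-- The integral of `W^m` times the residue form over the members of a family of chains. -/
noncomputable def residueMoment (e : Fin K → Fin 2 → ℤ) {S : Set (Fin 4 → ℂ)}
    (Ψ : (Fin K → ℂ) × ℂ → (Fin 4 → ℂ) → Fin 4 → ℂ) (c : Chain S 3) (m : Fin 2 → ℤ)
    (A : (Fin K → ℂ) × ℂ) : ℂ :=
  c.sum fun σ n => n • pullbackIntegral
    (fun p v => torusMonomial m p * residueForm e A.1 p v) fun t => Ψ A (cubeExtend σ.toFun t)

theorem residueMoment_combination (e : Fin K → Fin 2 → ℤ) {S : Set (Fin 4 → ℂ)}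
    (Ψ : (Fin K → ℂ) × ℂ → (Fin 4 → ℂ) → Fin 4 → ℂ) {A : (Fin K → ℂ) × ℂ} (c : Chain S 3)
    (m : Fin 2 → ℤ) (w : ℂ) (b : Fin K → ℂ) :
    (c.sum fun σ n => n •
      (w * pullbackIntegral (fun p v => torusMonomial m p * residueForm e A.1 p v)
        (fun t => Ψ A (cubeExtend σ.toFun t)) +
      ∑ k, b k * pullbackIntegral (fun p v => torusMonomial (m + e k) p * residueForm e A.1 p v)
        (fun t => Ψ A (cubeExtend σ.toFun t)))) =
    w * residueMoment e Ψ c m A + ∑ k, b k * residueMoment e Ψ c (m + e k) A := by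
  simp only [residueMoment, Finsupp.sum, smul_add, Finset.sum_add_distrib, Finset.mul_sum,
    Finset.smul_sum, mul_smul_comm]
  rw [Finset.sum_comm]

namespace IsLevelFamily

variable {e : Fin K → Fin 2 → ℤ} {O : Set ((Fin K → ℂ) × ℂ)}
    {U S : Set (Fin 4 → ℂ)} {Ψ : (Fin K → ℂ) × ℂ → (Fin 4 → ℂ) → Fin 4 → ℂ}
    (hΨ : IsLevelFamily e O U S Ψ)

include hΨ

theorem mapsTo : ∀ A ∈ O, MapsTo (Ψ A) S torusDomain := fun A hA p hp => hΨ.mem A hA p hp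

/-- Differentiating the identity $F(a;\Psi_{a,z}(p))=z$ in the parameters determines $dF$ of the
velocity, which is all that the contraction of the volume form with tangent vectors sees. -/
theorem mirrorDeriv_param {A : (Fin K → ℂ) × ℂ} (hA : A ∈ O) {p : Fin 4 → ℂ} (hp : p ∈ S)
    (u : (Fin K → ℂ) × ℂ) :
    mirrorDeriv e A.1 (Ψ A p) (fderiv ℝ (Function.uncurry Ψ) (A, p) (u, 0)) =
      u.2 - ∑ k, u.1 k * torusMonomial (e k) (Ψ A p) := by
  have hd : HasFDerivAt (Function.uncurry Ψ) (fderiv ℝ (Function.uncurry Ψ) (A, p)) (A, p) :=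
    ((hΨ.smooth.contDiffAt ((hΨ.isOpen_param.prod hΨ.isOpen_source).mem_nhds
      ⟨hA, hΨ.subset hp⟩)).differentiableAt (by simp)).hasFDerivAt
  have h1 : HasFDerivAt (fun B => Ψ B p) ((fderiv ℝ (Function.uncurry Ψ) (A, p)).comp
      (ContinuousLinearMap.inl ℝ _ _)) A :=
    HasFDerivAt.comp (f := fun B => (B, p)) (g := Function.uncurry Ψ) A hd
      (hasFDerivAt_prodMk_left A p)
  have h2 : HasFDerivAt (fun B : (Fin K → ℂ) × ℂ => (B.1, Ψ B p))
      ((ContinuousLinearMap.fst ℝ (Fin K → ℂ) ℂ).prod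
        ((fderiv ℝ (Function.uncurry Ψ) (A, p)).comp (ContinuousLinearMap.inl ℝ _ _))) A :=
    hasFDerivAt_fst.prodMk h1
  have h3 := HasFDerivAt.comp A (g := fun q : (Fin K → ℂ) × (Fin 4 → ℂ) => mirrorF e q.1 q.2)
    ((hasFDerivAt_mirrorF_uncurry e A.1 (hΨ.mem A hA p hp)).restrictScalars ℝ) h2
  have h4 : (fun B : (Fin K → ℂ) × ℂ => B.2) =ᶠ[𝓝 A]
      ((fun q : (Fin K → ℂ) × (Fin 4 → ℂ) => mirrorF e q.1 q.2) ∘ fun B => (B.1, Ψ B p)) := by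
    filter_upwards [hΨ.isOpen_param.mem_nhds hA] with B hB
    exact (hΨ.level B hB p hp).symm
  have h5 := (h3.congr_of_eventuallyEq h4).unique (hasFDerivAt_snd (𝕜 := ℝ) (p := A))
  have h6 := DFunLike.congr_fun h5 u
  simp only [ContinuousLinearMap.comp_apply, ContinuousLinearMap.coe_restrictScalars', add_apply,
    ContinuousLinearMap.prod_apply, ContinuousLinearMap.coe_fst', ContinuousLinearMap.coe_snd',
    sum_apply, smul_apply, ContinuousLinearMap.proj_apply, ContinuousLinearMap.inl_apply,
    smul_eq_mul] at h6
  rw [← h6, add_comm, eq_sub_iff_add_eq]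
  congr 1
  exact Finset.sum_congr rfl fun k _ => mul_comm _ _

theorem mirrorDeriv_tangent {n : ℕ} (σ : SmoothCube S n) {A : (Fin K → ℂ) × ℂ} (hA : A ∈ O)
    {t : Fin n → ℝ} (ht : t ∈ Icc (0 : Fin n → ℝ) 1) (v : Fin n → ℝ) :
    mirrorDeriv e A.1 (Ψ A (cubeExtend σ.toFun t))
      (fderivWithin ℝ (fun s => Ψ A (cubeExtend σ.toFun s)) (Icc 0 1) t v) = 0 := by
  have h0 : ContDiffOn ℝ ∞ (fun s => Ψ A (cubeExtend σ.toFun s)) (Icc 0 1) :=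
    (contDiffOn_family hΨ.subset hΨ.smooth σ).comp (contDiff_prodMk_right A).contDiffOn
      fun s hs => mk_mem_prod hA hs
  have h1 := (h0.differentiableOn (by simp) t ht).hasFDerivWithinAt
  have h2 := HasFDerivAt.comp_hasFDerivWithinAt t (g := mirrorF e A.1)
    ((hasFDerivAt_mirrorF e A.1 (hΨ.mem A hA _ (σ.cubeExtend_mem t))).restrictScalars ℝ) h1
  have h3 : mirrorF e A.1 ∘ (fun s => Ψ A (cubeExtend σ.toFun s)) = fun _ => A.2 :=
    funext fun s => hΨ.level A hA _ (σ.cubeExtend_mem s)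
  rw [h3] at h2
  have h4 := (uniqueDiffOn_cube t ht).eq h2 (hasFDerivWithinAt_const A.2 t _)
  exact DFunLike.congr_fun h4 v

theorem ambientForm_cons_tangent (σ : SmoothCube S 3) {A : (Fin K → ℂ) × ℂ} (hA : A ∈ O)
    {t : Fin 3 → ℝ} (ht : t ∈ Icc (0 : Fin 3 → ℝ) 1) (ξ : Fin 4 → ℂ) :
    ambientForm (Ψ A (cubeExtend σ.toFun t)) (Fin.cons ξ fun i =>
      fderivWithin ℝ (fun s => Ψ A (cubeExtend σ.toFun s)) (Icc 0 1) t (Pi.single i 1)) =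
    mirrorDeriv e A.1 (Ψ A (cubeExtend σ.toFun t)) ξ *
      residueForm e A.1 (Ψ A (cubeExtend σ.toFun t)) fun i =>
        fderivWithin ℝ (fun s => Ψ A (cubeExtend σ.toFun s)) (Icc 0 1) t (Pi.single i 1) := by
  have hp := σ.cubeExtend_mem t
  rw [← fderiv_mirrorF e A.1 (hΨ.mem A hA _ hp)]
  refine ambientForm_eq_residueForm e A.1 _ ?_ ξ _ fun i => ?_
  · rw [fderiv_mirrorF e A.1 (hΨ.mem A hA _ hp)]
    exact hΨ.regular A hA _ hp
  · rw [fderiv_mirrorF e A.1 (hΨ.mem A hA _ hp)]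
    exact hΨ.mirrorDeriv_tangent σ hA ht _

/-- The velocity in the direction of $z$ has $dF=1$, so the residue form on the tangent vectors is
the volume form with this velocity in the first slot. That expression is visibly smooth, and the
conjugate gradient in `normalVector` need not be examined. -/
theorem continuousOn_residue (σ : SmoothCube S 3) {A : (Fin K → ℂ) × ℂ} (hA : A ∈ O)
    (m : Fin 2 → ℤ) :
    ContinuousOn (fun t => torusMonomial m (Ψ A (cubeExtend σ.toFun t)) *
      residueForm e A.1 (Ψ A (cubeExtend σ.toFun t)) fun i =>
        fderivWithin ℝ (fun s => Ψ A (cubeExtend σ.toFun s)) (Icc 0 1) t (Pi.single i 1))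
      (Icc 0 1) := by
  have h1 := (contDiffOn_variation hΨ.isOpen_param hΨ.isOpen_source hΨ.subset hΨ.smooth hΨ.mapsTo
    (ContDiffOn.extDeriv isOpen_torusDomain (contDiffOn_eulerForm ![1, 0, 0, 0] m)) σ
    (0, 1)).continuousOn.comp (f := fun t : Fin 3 → ℝ => (A, t)) (s := Icc 0 1) (by fun_prop)
    fun t ht => mk_mem_prod hA ht
  refine h1.congr fun t ht => ?_
  simp only [Function.comp]
  rw [extDeriv_eulerForm _ _ (hΨ.mem A hA _ (σ.cubeExtend_mem t)),
    hΨ.ambientForm_cons_tangent σ hA ht, hΨ.mirrorDeriv_param hA (σ.cubeExtend_mem t)]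
  simp [eulerWeight]

theorem integrableOn_residue (σ : SmoothCube S 3) {A : (Fin K → ℂ) × ℂ} (hA : A ∈ O)
    (m : Fin 2 → ℤ) :
    IntegrableOn (fun t => torusMonomial m (Ψ A (cubeExtend σ.toFun t)) *
      residueForm e A.1 (Ψ A (cubeExtend σ.toFun t)) fun i =>
        fderivWithin ℝ (fun s => Ψ A (cubeExtend σ.toFun s)) (Icc 0 1) t (Pi.single i 1))
      (Icc 0 1) :=
  (hΨ.continuousOn_residue σ hA m).integrableOn_compact isCompact_Icc

/-- Linear combinations of integrals of the residue form times monomials. -/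
theorem integral_combination (σ : SmoothCube S 3) {A : (Fin K → ℂ) × ℂ} (hA : A ∈ O)
    (m : Fin 2 → ℤ) (w : ℂ) (b : Fin K → ℂ) :
    ∫ t in Icc (0 : Fin 3 → ℝ) 1,
      torusMonomial m (Ψ A (cubeExtend σ.toFun t)) *
        ((w + ∑ k, b k * torusMonomial (e k) (Ψ A (cubeExtend σ.toFun t))) *
          residueForm e A.1 (Ψ A (cubeExtend σ.toFun t)) fun i =>
            fderivWithin ℝ (fun s => Ψ A (cubeExtend σ.toFun s)) (Icc 0 1) t (Pi.single i 1)) =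
    w * pullbackIntegral (fun p v => torusMonomial m p * residueForm e A.1 p v)
        (fun t => Ψ A (cubeExtend σ.toFun t)) +
      ∑ k, b k * pullbackIntegral (fun p v => torusMonomial (m + e k) p * residueForm e A.1 p v)
        (fun t => Ψ A (cubeExtend σ.toFun t)) := by
  simp only [pullbackIntegral]
  simp_rw [← integral_const_mul]
  rw [← integral_finsetSum, ← integral_add]
  · refine setIntegral_congr_fun measurableSet_Icc fun t _ => ?_
    simp only [torusMonomial_add _ _ (hΨ.mem A hA _ (σ.cubeExtend_mem t))]
    rw [add_mul, mul_add, Finset.sum_mul, Finset.mul_sum]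
    congr 1
    · ring
    · exact Finset.sum_congr rfl fun k _ => by ring
  · exact (hΨ.integrableOn_residue σ hA m).const_mul w
  · exact integrable_finsetSum _ fun k _ => (hΨ.integrableOn_residue σ hA (m + e k)).const_mul _
  · exact fun k _ => (hΨ.integrableOn_residue σ hA (m + e k)).const_mul _

/-- The central formula. The variation of the integral is that of `extDeriv (eulerForm l m)`, a
multiple of $W^m\Omega$, on the velocity and the tangent vectors. There $\Omega$ becomes
$dF(\text{velocity})$ times the residue form, with $dF(\text{velocity})$ given by
`mirrorDeriv_param`. -/
theorem fderiv_eulerIntegral {c : Chain S 3} (hc : c.IsClosed) (l : Fin 4 → ℂ) (m : Fin 2 → ℤ)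
    {A : (Fin K → ℂ) × ℂ} (hA : A ∈ O) (u : (Fin K → ℂ) × ℂ) :
    fderiv ℝ (familyIntegral (fun p v => eulerForm l m p v) Ψ c) A u =
      eulerWeight l m * (u.2 * residueMoment e Ψ c m A -
        ∑ k, u.1 k * residueMoment e Ψ c (m + e k) A) := by
  rw [fderiv_familyIntegral hΨ.isOpen_param hΨ.isOpen_source hΨ.subset hΨ.smooth
    isOpen_torusDomain hΨ.mapsTo (contDiffOn_eulerForm l m) hc hA u]
  have h1 : ∀ σ : SmoothCube S 3, variationIntegral (fun p v => extDeriv (eulerForm l m) p v)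
      Ψ σ u A = eulerWeight l m * (u.2 * pullbackIntegral
        (fun p v => torusMonomial m p * residueForm e A.1 p v)
        (fun t => Ψ A (cubeExtend σ.toFun t)) + ∑ k, -u.1 k * pullbackIntegral
        (fun p v => torusMonomial (m + e k) p * residueForm e A.1 p v)
        (fun t => Ψ A (cubeExtend σ.toFun t))) := by
    intro σ
    rw [← hΨ.integral_combination σ hA, ← integral_const_mul]
    refine setIntegral_congr_fun measurableSet_Icc fun t ht => ?_
    simp only
    rw [extDeriv_eulerForm _ _ (hΨ.mem A hA _ (σ.cubeExtend_mem t)),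
      hΨ.ambientForm_cons_tangent σ hA ht, hΨ.mirrorDeriv_param hA (σ.cubeExtend_mem t)]
    simp only [neg_mul, Finset.sum_neg_distrib, sub_eq_add_neg]
    ring
  simp only [h1]
  have h2 := residueMoment_combination e Ψ (A := A) c m u.2 (fun k => -u.1 k)
  have h3 : u.2 * residueMoment e Ψ c m A - ∑ k, u.1 k * residueMoment e Ψ c (m + e k) A =
      u.2 * residueMoment e Ψ c m A + ∑ k, -u.1 k * residueMoment e Ψ c (m + e k) A := by
    simp [sub_eq_add_neg]
  rw [h3, ← h2, Finsupp.mul_sum]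
  exact Finsupp.sum_congr fun σ _ => (mul_smul_comm _ _ _).symm

theorem contDiffOn_eulerIntegral (c : Chain S 3) (l : Fin 4 → ℂ) (m : Fin 2 → ℤ) :
    ContDiffOn ℝ ∞ (familyIntegral (fun p v => eulerForm l m p v) Ψ c) O :=
  contDiffOn_familyIntegral hΨ.isOpen_param hΨ.isOpen_source hΨ.subset hΨ.smooth hΨ.mapsTo
    (contDiffOn_eulerForm l m) c

/-- The integral of the contraction of the volume form with an Euler vector field `ξ` is the
integral of the function `dF(ξ)` times the residue form. -/
theorem eulerIntegral_eq (c : Chain S 3) {l : Fin 4 → ℂ} {A : (Fin K → ℂ) × ℂ} (hA : A ∈ O)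
    {w : ℂ} {b : Fin K → ℂ}
    (hl : ∀ p ∈ torusDomain, mirrorF e A.1 p = A.2 → mirrorDeriv e A.1 p (l * p) =
      w + ∑ k, b k * torusMonomial (e k) p) :
    familyIntegral (fun p v => eulerForm l 0 p v) Ψ c A =
      w * residueMoment e Ψ c 0 A + ∑ k, b k * residueMoment e Ψ c (e k) A := by
  have h1 := residueMoment_combination e Ψ (A := A) c 0 w b
  simp only [zero_add] at h1
  rw [← h1, familyIntegral]
  refine Finsupp.sum_congr fun σ _ => ?_
  congr 1
  have h2 := hΨ.integral_combination σ hA 0 w b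
  simp only [zero_add] at h2
  rw [← h2]
  refine setIntegral_congr_fun measurableSet_Icc fun t ht => ?_
  have hp := σ.cubeExtend_mem t
  simp only
  rw [eulerForm_apply _ _ (hΨ.mem A hA _ hp), hΨ.ambientForm_cons_tangent σ hA ht,
    hl _ (hΨ.mem A hA _ hp) (hΨ.level A hA _ hp)]

end IsLevelFamily

/-! ### Moment systems and the GKZ operators. -/

variable {K : ℕ}

/-- The linear form `(a, z) ↦ z G_{m,j+1} - ∑ k, a_k G_{m + e_k,j+1}`. -/
noncomputable def momentDeriv (e : Fin K → Fin 2 → ℤ)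
    (G : (Fin 2 → ℤ) → ℕ → (Fin K → ℂ) × ℂ → ℂ) (m : Fin 2 → ℤ) (j : ℕ)
    (A : (Fin K → ℂ) × ℂ) : ((Fin K → ℂ) × ℂ) →L[ℂ] ℂ :=
  G m (j + 1) A • ContinuousLinearMap.snd ℂ (Fin K → ℂ) ℂ -
    ∑ k, G (m + e k) (j + 1) A •
      (ContinuousLinearMap.proj k).comp (ContinuousLinearMap.fst ℂ (Fin K → ℂ) ℂ)

theorem momentDeriv_apply (e : Fin K → Fin 2 → ℤ)
    (G : (Fin 2 → ℤ) → ℕ → (Fin K → ℂ) × ℂ → ℂ) (m : Fin 2 → ℤ) (j : ℕ)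
    (A u : (Fin K → ℂ) × ℂ) : momentDeriv e G m j A u =
      u.2 * G m (j + 1) A - ∑ k, u.1 k * G (m + e k) (j + 1) A := by
  simp [momentDeriv, mul_comm]

/-- Functions `G_{m,j}` of `(a, z)` with `∂G_{m,j}/∂z = G_{m,j+1}` and
`∂G_{m,j}/∂a_k = -G_{m + e_k,j+1}`. -/
structure IsMomentSystem (e : Fin K → Fin 2 → ℤ) (O : Set ((Fin K → ℂ) × ℂ))
    (G : (Fin 2 → ℤ) → ℕ → (Fin K → ℂ) × ℂ → ℂ) : Prop where
  isOpen : IsOpen O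
  hasFDerivAt : ∀ m j, ∀ A ∈ O, HasFDerivAt (𝕜 := ℂ) (G m j) (momentDeriv e G m j A) A

/-- The derivative in the last variable. -/
noncomputable def levelDeriv (f : (Fin K → ℂ) × ℂ → ℂ) (A : (Fin K → ℂ) × ℂ) : ℂ :=
  fderiv ℝ f A (0, 1)

theorem contDiffOn_levelDeriv {O : Set ((Fin K → ℂ) × ℂ)} (hO : IsOpen O)
    {f : (Fin K → ℂ) × ℂ → ℂ} (hf : ContDiffOn ℝ ∞ f O) : ContDiffOn ℝ ∞ (levelDeriv f) O :=
  (hf.fderiv_of_isOpen hO (by norm_cast)).clm_apply contDiffOn_const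

/-- The formula for the first derivatives passes to all $z$-derivatives by symmetry of second
derivatives. Its right-hand side is complex linear in the direction `u`, so real differentiability
upgrades to complex differentiability. -/
theorem isMomentSystem_iterate {e : Fin K → Fin 2 → ℤ} {O : Set ((Fin K → ℂ) × ℂ)}
    (hO : IsOpen O) {N R : (Fin 2 → ℤ) → (Fin K → ℂ) × ℂ → ℂ}
    (hN : ∀ m, ContDiffOn ℝ ∞ (N m) O)
    (hd : ∀ m, ∀ A ∈ O, ∀ u : (Fin K → ℂ) × ℂ,
      fderiv ℝ (N m) A u = u.2 * R m A - ∑ k, u.1 k * R (m + e k) A) :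
    IsMomentSystem e O fun m j => levelDeriv^[j] (N m) := by
  set G : (Fin 2 → ℤ) → ℕ → (Fin K → ℂ) × ℂ → ℂ := fun m j => levelDeriv^[j] (N m) with hG
  have hsucc : ∀ m j, G m (j + 1) = levelDeriv (G m j) := fun m j =>
    Function.iterate_succ_apply' _ _ _
  have hGs : ∀ j m, ContDiffOn ℝ ∞ (G m j) O := by
    intro j
    induction j with
    | zero => exact hN
    | succ j ih =>
      intro m
      rw [hsucc]
      exact contDiffOn_levelDeriv hO (ih m)
  have hGd : ∀ j m, ∀ A ∈ O, DifferentiableAt ℝ (G m j) A := fun j m A hA =>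
    ((hGs j m).contDiffAt (hO.mem_nhds hA)).differentiableAt (by simp)
  have hform : ∀ j m, ∀ A ∈ O, ∀ u : (Fin K → ℂ) × ℂ,
      fderiv ℝ (G m j) A u = u.2 * G m (j + 1) A - ∑ k, u.1 k * G (m + e k) (j + 1) A := by
    intro j
    induction j with
    | zero =>
      intro m A hA u
      -- The direction `(0, 1)` in the given formula isolates the moment.
      have hR : ∀ m, G m 1 A = R m A := by
        intro m
        change fderiv ℝ (N m) A (0, 1) = _
        rw [hd m A hA]
        simp
      simp only [zero_add, hR]
      exact hd m A hA u
    | succ j ih =>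
      intro m A hA u
      have hcd := (hGs j m).contDiffAt (hO.mem_nhds hA)
      have hD : DifferentiableAt ℝ (fderiv ℝ (G m j)) A :=
        (((hGs j m).fderiv_of_isOpen hO (m := ∞) (by norm_cast)).contDiffAt
          (hO.mem_nhds hA)).differentiableAt (by simp)
      have hsymm := hcd.isSymmSndFDerivAt
        (by simp only [minSmoothness_of_isRCLikeNormedField]; exact WithTop.coe_le_coe.2 le_top)
      have h1 : fderiv ℝ (G m (j + 1)) A u = fderiv ℝ (fderiv ℝ (G m j)) A u (0, 1) := by
        rw [hsucc]
        have : HasFDerivAt (levelDeriv (G m j)) _ A :=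
          hD.hasFDerivAt.clm_apply (hasFDerivAt_const (0, (1 : ℂ)) A)
        rw [this.fderiv]
        simp
      have h2 : fderiv ℝ (fun B => fderiv ℝ (G m j) B u) A (0, 1) =
          fderiv ℝ (fderiv ℝ (G m j)) A (0, 1) u := by
        have := hD.hasFDerivAt.clm_apply (hasFDerivAt_const u A)
        rw [this.fderiv]
        simp
      have h3 : (fun B => fderiv ℝ (G m j) B u) =ᶠ[𝓝 A] fun B =>
          u.2 * G m (j + 1) B - ∑ k, u.1 k * G (m + e k) (j + 1) B := by
        filter_upwards [hO.mem_nhds hA] with B hB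
        exact ih m B hB u
      have h4 : HasFDerivAt (fun B => u.2 * G m (j + 1) B -
          ∑ k, u.1 k * G (m + e k) (j + 1) B)
          (u.2 • fderiv ℝ (G m (j + 1)) A - ∑ k, u.1 k • fderiv ℝ (G (m + e k) (j + 1)) A) A :=
        ((hGd (j + 1) m A hA).hasFDerivAt.const_mul u.2).sub (HasFDerivAt.fun_sum fun k _ =>
          (hGd (j + 1) (m + e k) A hA).hasFDerivAt.const_mul (u.1 k))
      rw [h1, hsymm.eq, ← h2, h3.fderiv_eq, h4.fderiv]
      simp only [sub_apply, smul_apply, sum_apply, smul_eq_mul, hsucc _ (j + 1)]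
      rfl
  refine ⟨hO, fun m j A hA => ?_⟩
  refine hasFDerivAt_of_restrictScalars ℝ (hGd j m A hA).hasFDerivAt ?_
  refine ContinuousLinearMap.ext fun u => ?_
  rw [hform j m A hA u]
  exact momentDeriv_apply e G m j A u

namespace IsMomentSystem

variable {e : Fin K → Fin 2 → ℤ} {O : Set ((Fin K → ℂ) × ℂ)}
  {G : (Fin 2 → ℤ) → ℕ → (Fin K → ℂ) × ℂ → ℂ} (hG : IsMomentSystem e O G)

include hG

/-- Bootstrap: the derivative of a member of the system is a fixed linear combination of other
members. -/
theorem contDiffOn (m : Fin 2 → ℤ) (j : ℕ) : ContDiffOn ℂ ∞ (G m j) O := by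
  rw [contDiffOn_infty]
  intro n
  induction n generalizing m j with
  | zero =>
    exact contDiffOn_zero.2 fun A hA =>
      (hG.hasFDerivAt m j A hA).continuousAt.continuousWithinAt
  | succ n ih =>
    rw [show ((n + 1 : ℕ) : WithTop ℕ∞) = (n : WithTop ℕ∞) + 1 by norm_cast,
      contDiffOn_succ_iff_fderiv_of_isOpen hG.isOpen]
    refine ⟨fun A hA => (hG.hasFDerivAt m j A hA).differentiableAt.differentiableWithinAt,
      fun h => absurd h (by simp), ?_⟩
    have h : ContDiffOn ℂ n (momentDeriv e G m j) O :=
      ((ih m (j + 1)).smul contDiffOn_const).sub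
        (ContDiffOn.sum fun k _ => (ih (m + e k) (j + 1)).smul contDiffOn_const)
    exact h.congr fun A hA => (hG.hasFDerivAt m j A hA).fderiv

theorem contDiffOn_zeroLevel (m : Fin 2 → ℤ) (j : ℕ) :
    ContDiffOn ℂ ∞ (fun a : Fin K → ℂ => G m j (a, 0)) {a | (a, (0 : ℂ)) ∈ O} :=
  (hG.contDiffOn m j).comp (contDiff_prodMk_left 0).contDiffOn fun _ ha => ha

theorem partialDeriv_eq {f : (Fin K → ℂ) → ℂ} {D : Set (Fin K → ℂ)} (hD : IsOpen D)
    (hDO : ∀ a ∈ D, (a, (0 : ℂ)) ∈ O) {b : ℂ} {m : Fin 2 → ℤ} {j : ℕ}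
    (hf : EqOn f (fun a => b * G m j (a, 0)) D) (k : Fin K) :
    EqOn (partialDeriv k f) (fun a => -b * G (m + e k) (j + 1) (a, 0)) D := by
  intro a ha
  have h1 : f =ᶠ[𝓝 a] fun a => b * G m j (a, 0) := by
    filter_upwards [hD.mem_nhds ha] with a' ha'
    exact hf ha'
  have h2 := (HasFDerivAt.comp (f := fun a : Fin K → ℂ => (a, (0 : ℂ))) (g := G m j) a
    (hG.hasFDerivAt m j (a, 0) (hDO a ha)) (hasFDerivAt_prodMk_left a 0)).const_mul b
  have h3 : fderiv ℂ (fun a => b * G m j (a, 0)) a = _ := h2.fderiv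
  rw [partialDeriv, h1.fderiv_eq, h3]
  simp [momentDeriv_apply, Pi.single_apply]

theorem iterate_partialDeriv_eq {f : (Fin K → ℂ) → ℂ} {D : Set (Fin K → ℂ)} (hD : IsOpen D)
    (hDO : ∀ a ∈ D, (a, (0 : ℂ)) ∈ O) {b : ℂ} {m : Fin 2 → ℤ} {j : ℕ}
    (hf : EqOn f (fun a => b * G m j (a, 0)) D) (k : Fin K) (n : ℕ) :
    EqOn ((partialDeriv k)^[n] f)
      (fun a => (-1) ^ n * b * G (m + n • e k) (j + n) (a, 0)) D := by
  induction n with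
  | zero => simpa using hf
  | succ n ih =>
    rw [Function.iterate_succ_apply']
    have h := hG.partialDeriv_eq hD hDO ih k
    intro a ha
    rw [h ha]
    simp only [succ_nsmul, add_assoc, pow_succ]
    ring

theorem foldr_partialDeriv_eq {f : (Fin K → ℂ) → ℂ} {D : Set (Fin K → ℂ)} (hD : IsOpen D)
    (hDO : ∀ a ∈ D, (a, (0 : ℂ)) ∈ O) {b : ℂ} {m : Fin 2 → ℤ} {j : ℕ}
    (hf : EqOn f (fun a => b * G m j (a, 0)) D) (n : Fin K → ℕ) (L : List (Fin K)) :
    EqOn (L.foldr (fun k g => (partialDeriv k)^[n k] g) f)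
      (fun a => (-1) ^ (L.map n).sum * b *
        G (m + (L.map fun k => n k • e k).sum) (j + (L.map n).sum) (a, 0)) D := by
  induction L with
  | nil => simpa using hf
  | cons k L ih =>
    have h := hG.iterate_partialDeriv_eq hD hDO ih k (n k)
    intro a ha
    rw [List.foldr_cons, h ha]
    simp only [List.map_cons, List.sum_cons]
    rw [show m + (L.map fun k => n k • e k).sum + n k • e k =
      m + (n k • e k + (L.map fun k => n k • e k).sum) by abel,
      show j + (L.map n).sum + n k = j + (n k + (L.map n).sum) by ring, pow_add]
    ring

/-- Each derivative in $a_k$ contributes a sign, a shift by `e k` of the exponent, and a shift by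
one of the order in $z$. The outcome therefore depends on `n` only through `∑ k, n k` and `∑ k, n k
• e k`. -/
theorem multiDeriv_eq {f : (Fin K → ℂ) → ℂ} {D : Set (Fin K → ℂ)} (hD : IsOpen D)
    (hDO : ∀ a ∈ D, (a, (0 : ℂ)) ∈ O) {b : ℂ} {m : Fin 2 → ℤ} {j : ℕ}
    (hf : EqOn f (fun a => b * G m j (a, 0)) D) (n : Fin K → ℕ) :
    EqOn (multiDeriv n f)
      (fun a => (-1) ^ (∑ k, n k) * b * G (m + ∑ k, n k • e k) (j + ∑ k, n k) (a, 0)) D := by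
  have h := hG.foldr_partialDeriv_eq hD hDO hf n (List.finRange K)
  simp only [← Fin.sum_univ_def] at h
  exact h

/-- The box operators of the relations `l` with `∑ l_k = 0` and `∑ l_k e_k = 0`. -/
theorem boxOp_eq_zero {f : (Fin K → ℂ) → ℂ} {D : Set (Fin K → ℂ)} (hD : IsOpen D)
    (hDO : ∀ a ∈ D, (a, (0 : ℂ)) ∈ O) {b : ℂ} {m : Fin 2 → ℤ} {j : ℕ}
    (hf : EqOn f (fun a => b * G m j (a, 0)) D) {l : Fin K → ℤ} (hl : ∑ k, l k = 0)
    (hle : ∑ k, l k • e k = 0) {a : Fin K → ℂ} (ha : a ∈ D) : boxOp l f a = 0 := by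
  have h1 : ∑ k, (l k).toNat = ∑ k, (-l k).toNat := by
    have : ((∑ k, (l k).toNat : ℕ) : ℤ) - ((∑ k, (-l k).toNat : ℕ) : ℤ) = 0 := by
      push_cast
      rw [← Finset.sum_sub_distrib, ← hl]
      exact Finset.sum_congr rfl fun k _ => by omega
    omega
  have h2 : ∑ k, (l k).toNat • e k = ∑ k, (-l k).toNat • e k := by
    rw [← sub_eq_zero, ← Finset.sum_sub_distrib, ← hle]
    refine Finset.sum_congr rfl fun k _ => ?_
    rw [← natCast_zsmul, ← natCast_zsmul, ← sub_smul]
    congr 1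
    omega
  rw [boxOp, hG.multiDeriv_eq hD hDO hf _ ha, hG.multiDeriv_eq hD hDO hf _ ha, h1, h2, sub_self]

/-- The Euler operators. -/
theorem scalingOp_eq_zero {f : (Fin K → ℂ) → ℂ} {D : Set (Fin K → ℂ)} (hD : IsOpen D)
    (hDO : ∀ a ∈ D, (a, (0 : ℂ)) ∈ O) {b : ℂ}
    (hf : EqOn f (fun a => b * G 0 1 (a, 0)) D) {M : (Fin K → ℂ) × ℂ → ℂ} {s : ℂ}
    {w : Fin K → ℤ}
    (hM : EqOn M (fun A => s * A.2 * G 0 1 A + ∑ k, w k * A.1 k * G (e k) 1 A) O)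
    (hMd : ∀ A ∈ O, fderiv ℝ M A (0, 1) = s * G 0 1 A) {a : Fin K → ℂ} (ha : a ∈ D) :
    scalingOp w f a = 0 := by
  have hA := hDO a ha
  set A : (Fin K → ℂ) × ℂ := (a, 0) with hAdef
  have hline : HasDerivAt (fun z : ℂ => ((a, z) : (Fin K → ℂ) × ℂ)) (0, 1) 0 := by
    simpa using (hasDerivAt_const (0 : ℂ) a).prodMk (hasDerivAt_id (0 : ℂ))
  have hGline : ∀ m j, HasDerivAt (fun z : ℂ => G m j (a, z)) (G m (j + 1) A) 0 := by
    intro m j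
    have h := HasFDerivAt.comp_hasDerivAt (f := fun z : ℂ => ((a, z) : (Fin K → ℂ) × ℂ))
      (0 : ℂ) (hG.hasFDerivAt m j A hA) hline
    refine h.congr_deriv ?_
    simp [momentDeriv_apply]
  have hr : HasDerivAt (fun z : ℂ => s * z * G 0 1 (a, z) + ∑ k, w k * a k * G (e k) 1 (a, z))
      (s * G 0 1 A + ∑ k, w k * a k * G (e k) 2 A) 0 := by
    have h1 := (((hasDerivAt_id (0 : ℂ)).const_mul s).mul (hGline 0 1)).add
      (HasDerivAt.fun_sum (u := Finset.univ) fun k _ =>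
        (hGline (e k) 1).const_mul ((w k : ℂ) * a k))
    exact h1.congr_deriv (by simp [hAdef])
  have hMc : DifferentiableAt ℝ M A := by
    have h1 : ContDiffOn ℂ ∞ (fun A : (Fin K → ℂ) × ℂ => s * A.2 * G 0 1 A +
        ∑ k, w k * A.1 k * G (e k) 1 A) O := by
      refine ((contDiff_const.mul contDiff_snd).contDiffOn.mul (hG.contDiffOn 0 1)).add
        (ContDiffOn.sum fun k _ => ?_)
      exact (contDiff_const.mul ((contDiff_apply ℂ ℂ k).comp contDiff_fst)).contDiffOn.mul
        (hG.contDiffOn (e k) 1)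
    have h2 := ((h1.congr hM).contDiffAt (hG.isOpen.mem_nhds hA)).differentiableAt (by simp)
    exact h2.restrictScalars ℝ
  -- The information on `M` is a real derivative in the direction `(0, 1)`, so the two expressions
  -- for `M` are compared along the real line of levels.
  have hMline : HasDerivAt (fun x : ℝ => M (a, (x : ℂ))) (s * G 0 1 A) 0 := by
    have h1 : HasDerivAt (fun x : ℝ => ((a, (x : ℂ)) : (Fin K → ℂ) × ℂ)) (0, 1) 0 := by
      simpa using (hasDerivAt_const (0 : ℝ) a).prodMk (Complex.ofRealCLM.hasDerivAt (x := 0))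
    have h2 := hMc.hasFDerivAt.comp_hasDerivAt_of_eq (0 : ℝ) h1 (by simp [hAdef])
    exact h2.congr_deriv (hMd A hA)
  have hr' : HasDerivAt (fun x : ℝ => s * (x : ℂ) * G 0 1 (a, (x : ℂ)) +
      ∑ k, w k * a k * G (e k) 1 (a, (x : ℂ)))
      (s * G 0 1 A + ∑ k, w k * a k * G (e k) 2 A) 0 := by
    have hr0 : HasDerivAt (fun z : ℂ => s * z * G 0 1 (a, z) +
      ∑ k, w k * a k * G (e k) 1 (a, z)) (s * G 0 1 A + ∑ k, w k * a k * G (e k) 2 A)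
      ((0 : ℝ) : ℂ) := by simpa using hr
    exact hr0.comp_ofReal
  have hev : (fun x : ℝ => M (a, (x : ℂ))) =ᶠ[𝓝 0] fun x : ℝ => s * (x : ℂ) * G 0 1 (a, (x : ℂ)) +
      ∑ k, w k * a k * G (e k) 1 (a, (x : ℂ)) := by
    have hc : ContinuousAt (fun x : ℝ => ((a, (x : ℂ)) : (Fin K → ℂ) × ℂ)) 0 := by fun_prop
    filter_upwards [hc (by simpa using hG.isOpen.mem_nhds hA)] with x hx
    exact hM hx
  -- At $z=0$ the derivative of $s\,z\,G_{0,1}$ is $s\,G_{0,1}$, which equals the derivative of `M`.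
  -- The remaining sum $\sum w_ka_kG_{e_k,2}$ must vanish, and up to a constant factor it is the
  -- Euler operator applied to the period.
  have hkey := (hr'.congr_of_eventuallyEq hev).unique hMline
  have hsum : ∑ k, w k * a k * G (e k) 2 A = 0 := by simpa using hkey
  rw [scalingOp]
  have hpd : ∀ k, thetaOp k f a = a k * (-b * G (e k) 2 A) := by
    intro k
    rw [thetaOp, hG.partialDeriv_eq hD hDO hf k ha, zero_add]
  simp only [hpd]
  calc ∑ k, (w k : ℂ) * (a k * (-b * G (e k) 2 A))
      = -b * ∑ k, w k * a k * G (e k) 2 A := by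
        rw [Finset.mul_sum]
        exact Finset.sum_congr rfl fun k _ => by ring
    _ = 0 := by rw [hsum, mul_zero]

end IsMomentSystem

/-! ### Moving points between neighbouring level sets. -/

section LevelProjection

variable {K : ℕ} (e : Fin K → Fin 2 → ℤ)

theorem mem_mirrorYreg_iff {a : Fin K → ℂ} {p : Fin 4 → ℂ} :
    p ∈ mirrorYreg e a ↔ p ∈ torusDomain ∧ mirrorF e a p = 0 ∧ mirrorDeriv e a p ≠ 0 := by
  constructor
  · rintro ⟨⟨h2, h3, h0⟩, hd⟩
    have hp : p ∈ torusDomain := ⟨h2, h3⟩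
    exact ⟨hp, h0, by rwa [fderiv_mirrorF e a hp] at hd⟩
  · rintro ⟨hp, h0, hd⟩
    exact ⟨⟨hp.1, hp.2, h0⟩, by rwa [fderiv_mirrorF e a hp]⟩

/-- The conjugate gradient of `F(a; ·)`. -/
noncomputable def conjGradient (a : Fin K → ℂ) (p : Fin 4 → ℂ) : Fin 4 → ℂ :=
  fun i => (starRingEnd ℂ) (mirrorDeriv e a p (Pi.single i 1))

theorem contDiffOn_conjGradient (a : Fin K → ℂ) :
    ContDiffOn ℝ ∞ (conjGradient e a) torusDomain := by
  refine contDiffOn_pi.2 fun i => ?_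
  have h1 : ContDiff ℝ ∞ fun z : ℂ => (starRingEnd ℂ) z := Complex.conjCLE.contDiff
  have h2 : ContDiffOn ℝ ∞ (fun p => mirrorDeriv e a p (Pi.single i 1)) torusDomain :=
    (contDiffOn_mirrorDeriv_apply e (Pi.single i 1)).comp (f := fun p => (a, p))
      (contDiff_prodMk_right a).contDiffOn fun p hp => mk_mem_prod trivial hp
  exact h1.comp_contDiffOn h2

/-- The value is the square norm of the gradient; `normalVector` is the conjugate gradient rescaled
so that this value becomes 1. -/
theorem mirrorDeriv_conjGradient_ne_zero {a : Fin K → ℂ} {p : Fin 4 → ℂ}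
    (hp : p ∈ mirrorYreg e a) : mirrorDeriv e a p (conjGradient e a p) ≠ 0 := by
  have hpt := ((mem_mirrorYreg_iff e).1 hp).1
  have h1 := fderiv_normalVector e a p hp.2
  have h2 : normalVector e a p = (∑ j, fderiv ℂ (mirrorF e a) p (Pi.single j 1) *
      (starRingEnd ℂ) (fderiv ℂ (mirrorF e a) p (Pi.single j 1)))⁻¹ • conjGradient e a p := by
    ext i
    simp [normalVector, conjGradient, fderiv_mirrorF e a hpt, div_eq_inv_mul]
  intro h0
  rw [h2, map_smul, fderiv_mirrorF e a hpt, h0, smul_zero] at h1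
  exact zero_ne_one h1

/-- Near a compact part of the regular locus of `{F(a₁; ·) = 0}`, points can be moved smoothly to
the level sets `{F(a; ·) = z}`, without moving the points of `{F(a; ·) = 0}` for `z = 0`. -/
theorem exists_levelProjection (a₁ : Fin K → ℂ) {C : Set (Fin 4 → ℂ)} (hC : IsCompact C)
    (hCY : C ⊆ mirrorYreg e a₁) :
    ∃ N : Set (Fin K → ℂ), IsOpen N ∧ a₁ ∈ N ∧ ∃ U : Set (Fin 4 → ℂ), IsOpen U ∧ C ⊆ U ∧
      ∃ ε > 0, ∃ ψ : (Fin K → ℂ) × ℂ → (Fin 4 → ℂ) → Fin 4 → ℂ,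
        ContDiffOn ℝ ∞ (Function.uncurry ψ) ((N ×ˢ Metric.ball 0 ε) ×ˢ U) ∧
        (∀ A ∈ N ×ˢ Metric.ball (0 : ℂ) ε, ∀ p ∈ U, ψ A p ∈ torusDomain ∧
          mirrorF e A.1 (ψ A p) = A.2 ∧ mirrorDeriv e A.1 (ψ A p) ≠ 0) ∧
        ∀ a ∈ N, ∀ p ∈ U, mirrorF e a p = 0 → ψ (a, 0) p = p := by
  set ξ := conjGradient e a₁ with hξ
  have hξs : ContDiffOn ℝ ∞ ξ torusDomain := contDiffOn_conjGradient e a₁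
  -- A point `p` is moved along the conjugate gradient direction at `p`, taken for the fixed
  -- parameter `a₁`. The displacement along this direction is the unknown in the equation
  -- $F(a;p+s\,\xi(p))=z$.
  set θ : ((Fin K → ℂ) × (Fin 4 → ℂ)) × ℂ → (Fin K → ℂ) × (Fin 4 → ℂ) :=
    fun q => (q.1.1, q.1.2 + q.2 • ξ q.1.2) with hθ
  set O₁ : Set (((Fin K → ℂ) × (Fin 4 → ℂ)) × ℂ) := {q | q.1.2 ∈ torusDomain} with hO₁
  have hO₁o : IsOpen O₁ := isOpen_torusDomain.preimage (by fun_prop)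
  have hξq : ContDiffOn ℝ ∞ (fun q : ((Fin K → ℂ) × (Fin 4 → ℂ)) × ℂ => ξ q.1.2) O₁ :=
    hξs.comp (contDiff_snd.comp contDiff_fst).contDiffOn fun q hq => hq
  have hθs : ContDiffOn ℝ ∞ θ O₁ :=
    (contDiff_fst.comp contDiff_fst).contDiffOn.prodMk
      ((contDiff_snd.comp contDiff_fst).contDiffOn.add (contDiff_snd.contDiffOn.smul hξq))
  set O₂ := O₁ ∩ θ ⁻¹' (univ ×ˢ torusDomain) with hO₂
  have hO₂o : IsOpen O₂ :=
    hθs.continuousOn.isOpen_inter_preimage hO₁o (isOpen_univ.prod isOpen_torusDomain)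
  set γ : ((Fin K → ℂ) × (Fin 4 → ℂ)) × ℂ → ℂ :=
    fun q => mirrorDeriv e (θ q).1 (θ q).2 (ξ q.1.2) with hγ
  have hγc : ContinuousOn γ O₂ := by
    have h1 : γ = fun q => ∑ i, ξ q.1.2 i * mirrorDeriv e (θ q).1 (θ q).2 (Pi.single i 1) := by
      ext q
      simp only [hγ]
      conv_lhs => rw [pi_eq_sum_univ' (ξ q.1.2), map_sum]
      exact Finset.sum_congr rfl fun i _ => by rw [map_smul, smul_eq_mul]
    rw [h1]
    refine continuousOn_finsetSum _ fun i _ => ContinuousOn.mul ?_ ?_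
    · exact (continuous_apply i).comp_continuousOn (hξq.continuousOn.mono inter_subset_left)
    · exact (contDiffOn_mirrorDeriv_apply e (Pi.single i 1)).continuousOn.comp
        (hθs.continuousOn.mono inter_subset_left) fun q hq => hq.2
  -- `γ` is the derivative of $F(a;p+s\,\xi(p))$ in `s`. Its nonvanishing gives solvability, and
  -- also that $dF\ne0$ at the displaced point.
  set O := O₂ ∩ γ ⁻¹' {0}ᶜ with hO
  have hOo : IsOpen O := hγc.isOpen_inter_preimage hO₂o isOpen_compl_singleton
  set f : ((Fin K → ℂ) × (Fin 4 → ℂ)) × ℂ → ℂ := fun q => mirrorF e (θ q).1 (θ q).2 with hf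
  have hfs : ContDiffOn ℝ ∞ f O :=
    (contDiffOn_mirrorF e).comp (hθs.mono fun q hq => hq.1.1) fun q hq => hq.1.2
  have hder : ∀ q ∈ O, ∃ c : ℂ, c ≠ 0 ∧ ∀ δ, fderiv ℝ f q (0, δ) = c * δ := by
    intro q hq
    refine ⟨γ q, hq.2, fun δ => ?_⟩
    have h1 : HasFDerivAt f (fderiv ℝ f q) q :=
      ((hfs.contDiffAt (hOo.mem_nhds hq)).differentiableAt (by simp)).hasFDerivAt
    have h2 : HasFDerivAt (fun s : ℂ => f (q.1, s)) _ q.2 :=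
      HasFDerivAt.comp (f := fun s : ℂ => (q.1, s)) (g := f) q.2 h1
        (hasFDerivAt_prodMk_right q.1 q.2)
    have h3 : HasFDerivAt (𝕜 := ℂ) (fun s : ℂ => q.1.2 + s • ξ q.1.2)
        ((ContinuousLinearMap.id ℂ ℂ).smulRight (ξ q.1.2)) q.2 :=
      ((ContinuousLinearMap.id ℂ ℂ).smulRight (ξ q.1.2)).hasFDerivAt.const_add _
    have h4 := (HasFDerivAt.comp (g := mirrorF e q.1.1) q.2
      (hasFDerivAt_mirrorF e q.1.1 hq.1.2.2) h3).restrictScalars ℝ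
    have h5 := DFunLike.congr_fun (h2.unique h4) δ
    simpa [hγ, hθ, mul_comm] using h5
  have hCK : IsCompact (({a₁} : Set (Fin K → ℂ)) ×ˢ C) := isCompact_singleton.prod hC
  obtain ⟨W, hWo, hCW, ε, hε, s, hs, hsO, hs0⟩ := exists_implicit_function_of_compact hOo hfs hder
    hCK (by
      rintro ⟨a, p⟩ ⟨ha, hp⟩
      simp only [mem_singleton_iff] at ha
      subst ha
      have hpY := hCY hp
      have hpt := ((mem_mirrorYreg_iff e).1 hpY).1
      refine ⟨⟨hpt, trivial, ?_⟩, ?_⟩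
      · simpa [hθ] using hpt
      · have := mirrorDeriv_conjGradient_ne_zero e hpY
        simpa [hγ, hθ, hξ] using this) (by
      rintro ⟨a, p⟩ ⟨ha, hp⟩
      simp only [mem_singleton_iff] at ha
      subst ha
      simpa [hf, hθ] using ((mem_mirrorYreg_iff e).1 (hCY hp)).2.1)
  obtain ⟨N, U, hNo, hUo, haN, hCU, hNU⟩ :=
    generalized_tube_lemma isCompact_singleton hC hWo hCW
  have hmem : ∀ A ∈ N ×ˢ Metric.ball (0 : ℂ) ε, ∀ p ∈ U,
      ((A.1, p), s ((A.1, p), A.2)) ∈ O ∧ f ((A.1, p), s ((A.1, p), A.2)) = A.2 :=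
    fun A hA p hp => hsO _ (hNU (mk_mem_prod hA.1 hp)) _ hA.2
  refine ⟨N, hNo, haN rfl, U, hUo, hCU, ε, hε,
    fun A p => p + s ((A.1, p), A.2) • ξ p, ?_, ?_, ?_⟩
  · have h1 : ContDiffOn ℝ ∞ (fun q : ((Fin K → ℂ) × ℂ) × (Fin 4 → ℂ) =>
        s ((q.1.1, q.2), q.1.2)) ((N ×ˢ Metric.ball 0 ε) ×ˢ U) := by
      refine hs.comp (f := fun q : ((Fin K → ℂ) × ℂ) × (Fin 4 → ℂ) => ((q.1.1, q.2), q.1.2)) ?_ ?_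
      · exact (((contDiff_fst.comp contDiff_fst).prodMk contDiff_snd).prodMk
          (contDiff_snd.comp contDiff_fst)).contDiffOn
      · exact fun q hq => mk_mem_prod (hNU (mk_mem_prod hq.1.1 hq.2)) hq.1.2
    refine contDiff_snd.contDiffOn.add (h1.smul (hξs.comp contDiff_snd.contDiffOn ?_))
    exact fun q hq => (hmem q.1 hq.1 q.2 hq.2).1.1.1
  · intro A hA p hp
    obtain ⟨h1, h2⟩ := hmem A hA p hp
    refine ⟨h1.1.2.2, h2, fun h0 => h1.2 ?_⟩
    simp only [mem_singleton_iff, hγ]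
    change mirrorDeriv e A.1 (p + s ((A.1, p), A.2) • ξ p) (ξ p) = 0
    simp only at h0
    rw [h0]
    rfl
  · intro a ha p hp h0
    have h1 := hs0 (a, p) (hNU (mk_mem_prod ha hp)) (by simpa [hf, hθ] using h0)
    simp [h1]

end LevelProjection

/-! ### Restricting chains to smaller sets containing their images. -/

section Restriction

variable {E : Type} [NormedAddCommGroup E] [NormedSpace ℝ E] {n : ℕ}

/-- The union of the images of the cubes of a chain. -/
def chainSupport {S : Set E} (c : Chain S n) : Set E :=
  ⋃ σ ∈ c.support, cubeExtend σ.toFun '' Icc 0 1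

theorem isCompact_chainSupport {S : Set E} (c : Chain S n) : IsCompact (chainSupport c) :=
  c.support.isCompact_biUnion fun σ _ => isCompact_Icc.image_of_continuousOn σ.smooth.continuousOn

theorem chainSupport_subset {S : Set E} (c : Chain S n) : chainSupport c ⊆ S := by
  simp only [chainSupport, iUnion_subset_iff]
  rintro σ - _ ⟨t, -, rfl⟩
  exact σ.cubeExtend_mem t

theorem apply_mem_chainSupport {S : Set E} {c : Chain S n} {σ : SmoothCube S n}
    (hσ : σ ∈ c.support) (t : Fin n → unitInterval) : σ.toFun t ∈ chainSupport c := by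
  refine mem_biUnion hσ ⟨fun i => (t i : ℝ), ⟨fun i => (t i).2.1, fun i => (t i).2.2⟩, ?_⟩
  simp [cubeExtend]

/-- The spanning chains are basis elements, so membership can be read off from the support. This
lets degeneracy be tested after enlarging the ambient set. -/
theorem mem_degenerateChains_iff {S : Set E} {c : Chain S n} :
    c ∈ degenerateChains S n ↔ ∀ σ ∈ c.support, σ.IsDegenerate := by
  have h : degenerateChains S n = Finsupp.supported ℤ ℤ {σ : SmoothCube S n | σ.IsDegenerate} := by
    rw [Finsupp.supported_eq_span_single, degenerateChains]
    congr 1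
    ext c
    constructor
    · rintro ⟨σ, hσ, rfl⟩
      exact ⟨σ, hσ, rfl⟩
    · rintro ⟨σ, hσ, rfl⟩
      exact ⟨σ, hσ, rfl⟩
  rw [h, Finsupp.mem_supported]
  exact Iff.rfl

variable {S T : Set E} (hST : MapsTo id S T)

theorem SmoothCube.map_id_injective :
    Function.Injective (SmoothCube.map (n := n) id contDiffOn_id hST) := by
  intro σ τ h
  ext1
  have h1 : (σ.map id contDiffOn_id hST).toFun = (τ.map id contDiffOn_id hST).toFun := by rw [h]
  exact h1

theorem mem_degenerateChains_of_map_id {c : Chain S n}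
    (hc : Chain.map id contDiffOn_id hST n c ∈ degenerateChains T n) :
    c ∈ degenerateChains S n := by
  classical
  rw [mem_degenerateChains_iff] at hc ⊢
  intro σ hσ
  have h1 := hc (σ.map id contDiffOn_id hST) (by
    rw [Chain.map, Finsupp.lmapDomain_apply,
      Finsupp.mapDomain_support_of_injective (SmoothCube.map_id_injective hST)]
    exact Finset.mem_image_of_mem _ hσ)
  exact h1

theorem exists_map_id_eq (c : Chain T n) (hc : ∀ σ ∈ c.support, ∀ t, σ.toFun t ∈ S) :
    ∃ c' : Chain S n, Chain.map id contDiffOn_id hST n c' = c := by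
  refine ⟨∑ σ ∈ c.support.attach,
    Finsupp.single ⟨σ.1.toFun, hc σ.1 σ.2, σ.1.smooth⟩ (c σ.1), ?_⟩
  rw [map_sum]
  have h : ∀ σ ∈ c.support.attach, Chain.map id contDiffOn_id hST n
      (Finsupp.single ⟨σ.1.toFun, hc σ.1 σ.2, σ.1.smooth⟩ (c σ.1)) =
      Finsupp.single σ.1 (c σ.1) := by
    intro σ _
    rw [Chain.map, Finsupp.lmapDomain_apply, Finsupp.mapDomain_single]
    rfl
  rw [Finset.sum_congr rfl h, Finset.sum_attach c.support fun σ => Finsupp.single σ (c σ)]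
  exact Finsupp.sum_single c

/-- Inclusion is injective on cubes and does not change degeneracy, so a boundary that is degenerate
in the larger set is already degenerate in the smaller one. -/
theorem mem_cycles3_of_map_id {c : Chain S 3}
    (hc : Chain.map id contDiffOn_id hST 3 c ∈ cycles3 T) : c ∈ cycles3 S := by
  refine mem_degenerateChains_of_map_id hST ?_
  rw [← boundary_map]
  exact hc

end Restriction

/-! ### Functoriality of push-forward on chains. -/

section ChainMaps

variable {E E' E'' : Type} [NormedAddCommGroup E] [NormedSpace ℝ E]
  [NormedAddCommGroup E'] [NormedSpace ℝ E'] [NormedAddCommGroup E''] [NormedSpace ℝ E''] {n : ℕ}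

theorem Chain.map_congr {S : Set E} {T : Set E'} {φ φ' : E → E'} (hφ : ContDiffOn ℝ ∞ φ S)
    (hST : MapsTo φ S T) (hφ' : ContDiffOn ℝ ∞ φ' S) (hST' : MapsTo φ' S T) (h : EqOn φ φ' S) :
    Chain.map φ hφ hST n = Chain.map φ' hφ' hST' n := by
  have : SmoothCube.map (n := n) φ hφ hST = SmoothCube.map φ' hφ' hST' := by
    funext σ
    ext1
    exact funext fun t => h (σ.mem t)
  rw [Chain.map, Chain.map, this]

theorem Chain.map_map {S : Set E} {T : Set E'} {R : Set E''} {φ : E → E'} {χ : E' → E''}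
    (hφ : ContDiffOn ℝ ∞ φ S) (hST : MapsTo φ S T) (hχ : ContDiffOn ℝ ∞ χ T)
    (hTR : MapsTo χ T R) (c : Chain S n) :
    Chain.map χ hχ hTR n (Chain.map φ hφ hST n c) =
      Chain.map (χ ∘ φ) (hχ.comp hφ hST) (hTR.comp hST) n c := by
  simp only [Chain.map, Finsupp.lmapDomain_apply]
  rw [← Finsupp.mapDomain_comp]
  rfl

end ChainMaps

/-! ### Periods: well-definedness, flat families and the GKZ system. -/

section Periods

variable {K : ℕ} {e : Fin K → Fin 2 → ℤ}

theorem residueForm_eq_zero (a : Fin K → ℂ) (p : Fin 4 → ℂ) (v : Fin 3 → Fin 4 → ℂ) (i : Fin 3)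
    (hv : v i = 0) : residueForm e a p v = 0 := by
  rw [residueForm, ambientForm, Matrix.det_eq_zero_of_row_eq_zero i.succ, zero_div]
  intro j
  simp [hv]

theorem chainPeriod_eq (a : Fin K → ℂ) (c : Chain (mirrorYreg e a) 3) :
    chainPeriod e a c =
      1 / (4 * (Real.pi : ℂ) ^ 3) * chainIntegral (residueForm e a) c := by
  rw [chainPeriod, chainIntegral, Finsupp.linearCombination_apply]
  congr 1
  refine Finsupp.sum_congr fun σ _ => ?_
  rw [zsmul_eq_mul]
  rfl

theorem residueMoment_zeroLevel {S : Set (Fin 4 → ℂ)}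
    {Ψ : (Fin K → ℂ) × ℂ → (Fin 4 → ℂ) → Fin 4 → ℂ} {a : Fin K → ℂ} {φ : (Fin 4 → ℂ) → Fin 4 → ℂ}
    (hφ : ContDiffOn ℝ ∞ φ S) (hmaps : MapsTo φ S (mirrorYreg e a)) (h : EqOn (Ψ (a, 0)) φ S)
    (c : Chain S 3) :
    residueMoment e Ψ c 0 (a, 0) =
      chainIntegral (residueForm e a) (Chain.map φ hφ hmaps 3 c) := by
  rw [chainIntegral_map, residueMoment]
  refine Finsupp.sum_congr fun σ _ => ?_
  have h1 : (fun t => Ψ (a, 0) (cubeExtend σ.toFun t)) = fun t => φ (cubeExtend σ.toFun t) :=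
    funext fun t => h (σ.cubeExtend_mem t)
  have h2 : (fun p v => torusMonomial 0 p * residueForm e (a, (0 : ℂ)).1 p v) =
      residueForm e a := by
    funext p v
    rw [torusMonomial_zero, one_mul]
  rw [h1, h2]

/-- The volume form vanishes on four vectors tangent to a regular level set: with a tangent vector
in the first slot the factor $dF(\xi)$ is zero. -/
theorem IsLevelFamily.chainIntegral_extDeriv_eq_zero {O : Set ((Fin K → ℂ) × ℂ)}
    {U S : Set (Fin 4 → ℂ)} {Ψ : (Fin K → ℂ) × ℂ → (Fin 4 → ℂ) → Fin 4 → ℂ}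
    (hΨ : IsLevelFamily e O U S Ψ) {A : (Fin K → ℂ) × ℂ} (hA : A ∈ O)
    (hs : ContDiffOn ℝ ∞ (Ψ A) S) (l : Fin 4 → ℂ) (m : Fin 2 → ℤ) (d : Chain S 4) :
    chainIntegral (fun p v => extDeriv (eulerForm l m) p v)
      (Chain.map (Ψ A) hs (hΨ.mapsTo A hA) 4 d) = 0 := by
  rw [chainIntegral_map]
  refine Finset.sum_eq_zero fun σ _ => ?_
  simp only [pullbackIntegral]
  rw [MeasureTheory.setIntegral_eq_zero_of_forall_eq_zero, smul_zero]
  intro t ht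
  have hp := hΨ.mem A hA _ (σ.cubeExtend_mem t)
  rw [extDeriv_eulerForm _ _ hp]
  have hreg : fderiv ℂ (mirrorF e A.1) (Ψ A (cubeExtend σ.toFun t)) ≠ 0 := by
    rw [fderiv_mirrorF e A.1 hp]
    exact hΨ.regular A hA _ (σ.cubeExtend_mem t)
  have htan : ∀ v, fderiv ℂ (mirrorF e A.1) (Ψ A (cubeExtend σ.toFun t))
      (fderivWithin ℝ (fun s => Ψ A (cubeExtend σ.toFun s)) (Icc 0 1) t v) = 0 := by
    intro v
    rw [fderiv_mirrorF e A.1 hp]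
    exact hΨ.mirrorDeriv_tangent σ hA ht v
  have h := ambientForm_eq_residueForm e A.1 _ hreg
    (fderivWithin ℝ (fun s => Ψ A (cubeExtend σ.toFun s)) (Icc 0 1) t (Pi.single 0 1))
    (fun i : Fin 3 => fderivWithin ℝ (fun s => Ψ A (cubeExtend σ.toFun s)) (Icc 0 1) t
      (Pi.single i.succ 1)) (fun i => htan _)
  rw [htan, zero_mul] at h
  have hcons : (fun i : Fin 4 => fderivWithin ℝ (fun s => Ψ A (cubeExtend σ.toFun s)) (Icc 0 1) t
      (Pi.single i 1)) = Fin.cons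
      (fderivWithin ℝ (fun s => Ψ A (cubeExtend σ.toFun s)) (Icc 0 1) t (Pi.single 0 1))
      (fun i : Fin 3 => fderivWithin ℝ (fun s => Ψ A (cubeExtend σ.toFun s)) (Icc 0 1) t
        (Pi.single i.succ 1)) := by
    funext i
    refine Fin.cases ?_ (fun j => ?_) i <;> rfl
  rw [hcons, h, mul_zero]

/-- The residue form is closed: its integrals over boundaries vanish. -/
theorem chainIntegral_residueForm_boundary (a : Fin K → ℂ) (d : Chain (mirrorYreg e a) 4) :
    chainIntegral (residueForm e a) (boundary (mirrorYreg e a) 3 d) = 0 := by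
  obtain ⟨N, hNo, haN, U, hUo, hCU, ε, hε, ψ, hψs, hψ, hψ0⟩ :=
    exists_levelProjection e a (isCompact_chainSupport d) (chainSupport_subset d)
  set S := mirrorYreg e a ∩ U with hS
  have hSY : MapsTo id S (mirrorYreg e a) := fun p hp => hp.1
  have hΨ : IsLevelFamily e (N ×ˢ Metric.ball 0 ε) U S ψ :=
    { isOpen_param := hNo.prod Metric.isOpen_ball
      isOpen_source := hUo
      subset := inter_subset_right
      smooth := hψs
      mem := fun A hA p hp => (hψ A hA p hp.2).1
      level := fun A hA p hp => (hψ A hA p hp.2).2.1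
      regular := fun A hA p hp => (hψ A hA p hp.2).2.2 }
  obtain ⟨d', hd'⟩ := exists_map_id_eq hSY d fun σ hσ t =>
    ⟨σ.mem t, hCU (apply_mem_chainSupport hσ t)⟩
  have hc : Chain.IsClosed (boundary S 3 d') := Or.inr ⟨d', rfl⟩
  have hA : (a, (0 : ℂ)) ∈ N ×ˢ Metric.ball (0 : ℂ) ε := ⟨haN, Metric.mem_ball_self hε⟩
  have hslice : ∀ A ∈ N ×ˢ Metric.ball (0 : ℂ) ε, ContDiffOn ℝ ∞ (ψ A) S := fun A hA =>
    hψs.comp (f := fun p => (A, p)) (contDiff_prodMk_right A).contDiffOn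
      fun p hp => mk_mem_prod hA hp.2
  -- Stokes' theorem inside each level set. Since this holds on an open set of `(a, z)`, the
  -- derivative in `z` vanishes too, and that derivative is the moment in question.
  have hzero : ∀ A ∈ N ×ˢ Metric.ball (0 : ℂ) ε, familyIntegral
      (fun p v => eulerForm ![1, 0, 0, 0] 0 p v) ψ (boundary S 3 d') A = 0 := by
    intro A hA
    have h1 := chainIntegral_boundary isOpen_torusDomain le_rfl
      (contDiffOn_eulerForm ![1, 0, 0, 0] 0)
      (Chain.map (ψ A) (hslice A hA) (hΨ.mapsTo A hA) 4 d')
    rw [hΨ.chainIntegral_extDeriv_eq_zero hA (hslice A hA), boundary_map, chainIntegral_map] at h1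
    exact h1
  have hfd := hΨ.fderiv_eulerIntegral hc ![1, 0, 0, 0] 0 hA (0, 1)
  have h0 : fderiv ℝ (familyIntegral (fun p v => eulerForm ![1, 0, 0, 0] 0 p v) ψ
      (boundary S 3 d')) (a, 0) = 0 := by
    have : familyIntegral (fun p v => eulerForm ![1, 0, 0, 0] 0 p v) ψ
        (boundary S 3 d') =ᶠ[𝓝 (a, 0)]
        fun _ => 0 := by
      filter_upwards [hΨ.isOpen_param.mem_nhds hA] with A hA
      exact hzero A hA
    rw [this.fderiv_eq]
    simp
  rw [h0] at hfd
  have h1 : residueMoment e ψ (boundary S 3 d') 0 (a, 0) = 0 := by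
    simpa [eulerWeight] using hfd.symm
  rw [residueMoment_zeroLevel contDiffOn_id hSY
    (fun p hp => hψ0 a haN p hp.2 ((mem_mirrorYreg_iff e).1 hp.1).2.1), ← boundary_map, hd'] at h1
  exact h1

/-- Two representatives differ by a boundary plus a degenerate chain, and the residue form
integrates to zero over both. -/
theorem period_mk (a : Fin K → ℂ) (c : cycles3 (mirrorYreg e a)) :
    period e a (H3.mk c) = chainPeriod e a c := by
  set c' := (Submodule.mkQ_surjective ((boundaries3 (mirrorYreg e a)).submoduleOf
    (cycles3 (mirrorYreg e a))) (H3.mk c)).choose with hc'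
  have h1 : Submodule.Quotient.mk c' = H3.mk c := (Submodule.mkQ_surjective
    ((boundaries3 (mirrorYreg e a)).submoduleOf (cycles3 (mirrorYreg e a))) (H3.mk c)).choose_spec
  have h2 : (c' : Chain (mirrorYreg e a) 3) - c ∈ boundaries3 (mirrorYreg e a) :=
    (Submodule.Quotient.eq ((boundaries3 (mirrorYreg e a)).submoduleOf
      (cycles3 (mirrorYreg e a)))).1 h1
  have h3 : boundaries3 (mirrorYreg e a) ≤ LinearMap.ker (chainIntegral (residueForm e a)) := by
    refine sup_le ?_ fun x hx => ?_
    · rintro _ ⟨d, rfl⟩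
      exact chainIntegral_residueForm_boundary a d
    · exact chainIntegral_eq_zero_of_mem_degenerateChains (residueForm_eq_zero a) hx
  have h4 : chainIntegral (residueForm e a) (c' : Chain (mirrorYreg e a) 3) -
      chainIntegral (residueForm e a) (c : Chain (mirrorYreg e a) 3) = 0 := by
    rw [← map_sub]
    exact h3 h2
  change chainPeriod e a c' = chainPeriod e a c
  rw [chainPeriod_eq, chainPeriod_eq, sub_eq_zero.1 h4]

/-- Every homology class extends to a flat family over nearby parameters. -/
theorem exists_isFlat (a₀ : Fin K → ℂ) (L₀ : H3 (mirrorYreg e a₀)) :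
    ∃ D : Set (Fin K → ℂ), IsOpen D ∧ a₀ ∈ D ∧
      ∃ L : ∀ a, H3 (mirrorYreg e a), IsFlat e D L ∧ L a₀ = L₀ := by
  classical
  obtain ⟨⟨c, hc⟩, rfl⟩ := Submodule.mkQ_surjective _ L₀
  obtain ⟨N, hNo, haN, U, hUo, hCU, ε, hε, ψ, hψs, hψ, hψ0⟩ :=
    exists_levelProjection e a₀ (isCompact_chainSupport c) (chainSupport_subset c)
  set S := mirrorYreg e a₀ ∩ U with hS
  have hSY : MapsTo id S (mirrorYreg e a₀) := fun p hp => hp.1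
  obtain ⟨c', hc'⟩ := exists_map_id_eq hSY c fun σ hσ t =>
    ⟨σ.mem t, hCU (apply_mem_chainSupport hσ t)⟩
  have hc'c : c' ∈ cycles3 S := mem_cycles3_of_map_id hSY (by rw [hc']; exact hc)
  have h0 : (0 : ℂ) ∈ Metric.ball (0 : ℂ) ε := Metric.mem_ball_self hε
  have hΦs : ContDiffOn ℝ ∞ (Function.uncurry fun a => ψ (a, 0)) (N ×ˢ U) := by
    refine hψs.comp (f := fun q : (Fin K → ℂ) × (Fin 4 → ℂ) => ((q.1, (0 : ℂ)), q.2)) ?_ ?_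
    · exact ((contDiff_fst.prodMk contDiff_const).prodMk contDiff_snd).contDiffOn
    · exact fun q hq => mk_mem_prod (mk_mem_prod hq.1 h0) hq.2
  have hΦa : ∀ a ∈ N, ContDiffOn ℝ ∞ (ψ (a, 0)) S := fun a ha =>
    hΦs.comp (f := fun p => (a, p)) (contDiff_prodMk_right a).contDiffOn
      fun p hp => mk_mem_prod ha hp.2
  have hmaps : ∀ a ∈ N, MapsTo (ψ (a, 0)) S (mirrorYreg e a) := fun a ha p hp =>
    (mem_mirrorYreg_iff e).2 (hψ (a, 0) ⟨ha, h0⟩ p hp.2)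
  -- The zero class outside `N` is a filler; flatness over `N` only concerns parameters in `N`.
  refine ⟨N, hNo, haN, fun a => if ha : a ∈ N then
    H3.map (ψ (a, 0)) (hΦa a ha) (hmaps a ha) (H3.mk ⟨c', hc'c⟩) else 0, ?_, ?_⟩
  · intro a₁ ha₁
    refine ⟨N, hNo, ha₁, le_rfl, a₀, haN, U, hUo, fun a => ψ (a, 0), hΦs,
      fun p hp => hψ0 a₀ haN p hp.2 ((mem_mirrorYreg_iff e).1 hp.1).2.1, H3.mk ⟨c', hc'c⟩, ?_⟩
    intro a ha
    exact ⟨hΦa a ha, hmaps a ha, by simp only [ha, dif_pos]⟩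
  · simp only [haN, dif_pos]
    change Submodule.Quotient.mk _ = Submodule.Quotient.mk _
    congr 1
    refine Subtype.ext ?_
    change Chain.map (ψ (a₀, 0)) _ _ 3 c' = c
    rw [Chain.map_congr (hΦa a₀ haN) (hmaps a₀ haN) contDiffOn_id hSY
      (fun p hp => hψ0 a₀ haN p hp.2 ((mem_mirrorYreg_iff e).1 hp.1).2.1), hc']

/-- Near every point of the base, the periods of a flat family are the zero level values of a
system of moments. -/
theorem IsFlat.exists_levelFamily {D : Set (Fin K → ℂ)} {L : ∀ a, H3 (mirrorYreg e a)}
    (hL : IsFlat e D L) {a₁ : Fin K → ℂ} (ha₁ : a₁ ∈ D) :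
    ∃ N : Set (Fin K → ℂ), IsOpen N ∧ a₁ ∈ N ∧ ∃ ε > 0, ∃ (U S : Set (Fin 4 → ℂ))
      (Ψ : (Fin K → ℂ) × ℂ → (Fin 4 → ℂ) → Fin 4 → ℂ),
      IsLevelFamily e (N ×ˢ Metric.ball 0 ε) U S Ψ ∧ ∃ c : Chain S 3, c.IsClosed ∧
        ∀ a ∈ N, period e a (L a) =
          1 / (4 * (Real.pi : ℂ) ^ 3) * residueMoment e Ψ c 0 (a, 0) := by
  obtain ⟨N, hNo, haN, -, b, -, U, hUo, Φ, hΦs, -, ℓ, hℓ⟩ := hL a₁ ha₁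
  obtain ⟨⟨c, hc⟩, rfl⟩ := Submodule.mkQ_surjective _ ℓ
  have hmaps : ∀ a ∈ N, MapsTo (Φ a) (mirrorYreg e b ∩ U) (mirrorYreg e a) :=
    fun a ha => (hℓ a ha).2.1
  have hΦa : ∀ a ∈ N, ContDiffOn ℝ ∞ (Φ a) (mirrorYreg e b ∩ U) := fun a ha => (hℓ a ha).1
  have hCT := chainSupport_subset c
  have hCc := isCompact_chainSupport c
  obtain ⟨N₁, hN₁o, haN₁, U₁, hU₁o, hCU₁, ε, hε, ψ, hψs, hψ, hψ0⟩ :=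
    exists_levelProjection e a₁ (C := Φ a₁ '' chainSupport c)
      (hCc.image_of_continuousOn ((hΦa a₁ haN).continuousOn.mono hCT))
      ((image_mono hCT).trans (hmaps a₁ haN).image_subset)
  have hWo : IsOpen ((N ×ˢ U) ∩ Function.uncurry Φ ⁻¹' U₁) :=
    hΦs.continuousOn.isOpen_inter_preimage (hNo.prod hUo) hU₁o
  -- After shrinking, `Φ a` sends all of `U₂` into the domain of the level projection, for every `a`
  -- in `N₂`.
  obtain ⟨N₂, U₂, hN₂o, hU₂o, haN₂, hCU₂, hNU₂⟩ := generalized_tube_lemma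
    (isCompact_singleton (x := a₁)) hCc (hWo.inter (hN₁o.prod isOpen_univ)) (by
      rintro ⟨a, p⟩ ⟨ha, hp⟩
      simp only [mem_singleton_iff] at ha
      subst ha
      exact ⟨⟨⟨haN, (hCT hp).2⟩, hCU₁ ⟨p, hp, rfl⟩⟩, haN₁, trivial⟩)
  set S := (mirrorYreg e b ∩ U) ∩ U₂ with hS
  have hST : MapsTo id S (mirrorYreg e b ∩ U) := fun p hp => hp.1
  -- The tube lemma controls `N₂` only through pairs with a point of `U₂`. For an empty support `U₂`
  -- may be empty, and the zero chain is handled separately with an empty source.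
  rcases (chainSupport c).eq_empty_or_nonempty with hempty | hne
  · have hc0 : c = 0 := by
      rw [← Finsupp.support_eq_empty, Finset.eq_empty_iff_forall_notMem]
      intro σ hσ
      have := apply_mem_chainSupport hσ 0
      rw [hempty] at this
      exact this
    refine ⟨N, hNo, haN, 1, one_pos, univ, ∅, fun _ _ => 0, ?_, 0, ?_, ?_⟩
    · exact ⟨hNo.prod Metric.isOpen_ball, isOpen_univ, empty_subset _, contDiffOn_const,
        fun _ _ _ h => h.elim, fun _ _ _ h => h.elim, fun _ _ _ h => h.elim⟩
    · exact Or.inr ⟨0, by simp⟩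
    · intro a ha
      obtain ⟨h1, h2, h3⟩ := hℓ a ha
      have h4 : L a = 0 := by
        rw [h3]
        have : (⟨c, hc⟩ : cycles3 (mirrorYreg e b ∩ U)) = 0 := Subtype.ext hc0
        rw [this, map_zero, map_zero]
      have h5 : L a = H3.mk 0 := h4
      rw [h5, period_mk]
      simp [chainPeriod, residueMoment]
  obtain ⟨p₀, hp₀⟩ := hne
  have hN₂N : ∀ a ∈ N₂, a ∈ N ∧ a ∈ N₁ := fun a ha =>
    ⟨(hNU₂ (mk_mem_prod ha (hCU₂ hp₀))).1.1.1, (hNU₂ (mk_mem_prod ha (hCU₂ hp₀))).2.1⟩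
  obtain ⟨c', hc'⟩ := exists_map_id_eq hST c fun σ hσ t =>
    ⟨σ.mem t, hCU₂ (apply_mem_chainSupport hσ t)⟩
  have hc'c : c' ∈ cycles3 S := mem_cycles3_of_map_id hST (by rw [hc']; exact hc)
  have hΦU : ∀ a ∈ N₂, ∀ p ∈ U₂, Φ a p ∈ U₁ := fun a ha p hp => (hNU₂ (mk_mem_prod ha hp)).1.2
  -- The given maps `Φ a` are followed by the projection to level `z`. At `z = 0` the projection
  -- fixes points of the hypersurface, so there the family is `Φ a` itself.
  refine ⟨N₂, hN₂o, haN₂ rfl, ε, hε, U₂, S, fun A p => ψ A (Φ A.1 p), ?_, c', Or.inl hc'c, ?_⟩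
  · refine ⟨hN₂o.prod Metric.isOpen_ball, hU₂o, inter_subset_right, ?_, ?_, ?_, ?_⟩
    · have h1 : ContDiffOn ℝ ∞ (fun q : ((Fin K → ℂ) × ℂ) × (Fin 4 → ℂ) => Φ q.1.1 q.2)
          ((N₂ ×ˢ Metric.ball 0 ε) ×ˢ U₂) := by
        refine hΦs.comp (f := fun q : ((Fin K → ℂ) × ℂ) × (Fin 4 → ℂ) => (q.1.1, q.2)) ?_ ?_
        · exact ((contDiff_fst.comp contDiff_fst).prodMk contDiff_snd).contDiffOn
        · exact fun q hq => (hNU₂ (mk_mem_prod hq.1.1 hq.2)).1.1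
      refine hψs.comp (f := fun q : ((Fin K → ℂ) × ℂ) × (Fin 4 → ℂ) => (q.1, Φ q.1.1 q.2))
        (contDiff_fst.contDiffOn.prodMk h1) ?_
      exact fun q hq => mk_mem_prod (mk_mem_prod (hN₂N _ hq.1.1).2 hq.1.2)
        (hΦU _ hq.1.1 _ hq.2)
    · exact fun A hA p hp => (hψ A ⟨(hN₂N _ hA.1).2, hA.2⟩ _ (hΦU _ hA.1 _ hp.2)).1
    · exact fun A hA p hp => (hψ A ⟨(hN₂N _ hA.1).2, hA.2⟩ _ (hΦU _ hA.1 _ hp.2)).2.1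
    · exact fun A hA p hp => (hψ A ⟨(hN₂N _ hA.1).2, hA.2⟩ _ (hΦU _ hA.1 _ hp.2)).2.2
  · intro a ha
    obtain ⟨haN, haN₁⟩ := hN₂N a ha
    obtain ⟨h1, h2, h3⟩ := hℓ a haN
    have hcyc : Chain.map (Φ a) h1 h2 3 c ∈ cycles3 (mirrorYreg e a) := by
      have := degenerate_map (Φ a) h1 h2 2 _ hc
      rw [← boundary_map] at this
      exact this
    have h4 : L a = H3.mk ⟨Chain.map (Φ a) h1 h2 3 c, hcyc⟩ := h3
    rw [h4, period_mk, chainPeriod_eq]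
    congr 1
    rw [residueMoment_zeroLevel (h1.comp contDiffOn_id hST) (h2.comp hST)]
    · rw [← Chain.map_map contDiffOn_id hST h1 h2, hc']
    · intro p hp
      exact hψ0 a haN₁ _ (hΦU a ha p hp.2) ((mem_mirrorYreg_iff e).1 (h2 hp.1)).2.1

theorem mirrorDeriv_mul (a : Fin K → ℂ) {p : Fin 4 → ℂ} (hp : p ∈ torusDomain) (l : Fin 4 → ℂ) :
    mirrorDeriv e a p (l * p) = 2 * (l 0 * p 0 ^ 2 + l 1 * p 1 ^ 2) +
      ∑ k, (e k 0 * l 2 + e k 1 * l 3) * a k * torusMonomial (e k) p := by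
  simp only [mirrorDeriv, add_apply, sum_apply, smul_apply, torusMonomialDeriv_mul _ hp,
    ContinuousLinearMap.proj_apply, Pi.mul_apply, smul_eq_mul]
  congr 1
  · ring
  · exact Finset.sum_congr rfl fun k _ => by ring

/-- The periods of a flat family are holomorphic and satisfy the GKZ equations. -/
theorem IsFlat.period_gkz {D : Set (Fin K → ℂ)} {L : ∀ a, H3 (mirrorYreg e a)}
    (hL : IsFlat e D L) {a₁ : Fin K → ℂ} (ha₁ : a₁ ∈ D) :
    ContDiffAt ℂ ∞ (fun a => period e a (L a)) a₁ ∧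
    (∀ l : Fin K → ℤ, ∑ k, l k = 0 → ∑ k, l k • e k = 0 →
      boxOp l (fun a => period e a (L a)) a₁ = 0) ∧
    scalingOp (fun _ => 1) (fun a => period e a (L a)) a₁ = 0 ∧
    scalingOp (fun k => e k 0) (fun a => period e a (L a)) a₁ = 0 ∧
    scalingOp (fun k => e k 1) (fun a => period e a (L a)) a₁ = 0 := by
  obtain ⟨N, hNo, haN, ε, hε, U, S, Ψ, hΨ, c, hc, hper⟩ := hL.exists_levelFamily ha₁
  set O := N ×ˢ Metric.ball (0 : ℂ) ε with hO
  -- The field $U\partial_U$ has weight 1 for every exponent `m`, whereas the weights of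
  -- $W_i\partial_{W_i}$ vary with `m` and vanish at `m = 0`.
  set l₁ : Fin 4 → ℂ := ![1, 0, 0, 0] with hl₁
  have hw : ∀ m, eulerWeight l₁ m = 1 := fun m => by simp [eulerWeight, hl₁]
  set F : (Fin 2 → ℤ) → (Fin K → ℂ) × ℂ → ℂ := fun m =>
    familyIntegral (fun p v => eulerForm l₁ m p v) Ψ c with hF
  have hG := isMomentSystem_iterate (e := e) hΨ.isOpen_param (N := F) (R := residueMoment e Ψ c)
    (fun m => hΨ.contDiffOn_eulerIntegral c l₁ m)
    (fun m A hA u => by rw [hF, hΨ.fderiv_eulerIntegral hc l₁ m hA u, hw, one_mul])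
  set G : (Fin 2 → ℤ) → ℕ → (Fin K → ℂ) × ℂ → ℂ := fun m j => levelDeriv^[j] (F m) with hGdef
  have hG1 : ∀ m, ∀ A ∈ O, G m 1 A = residueMoment e Ψ c m A := by
    intro m A hA
    change fderiv ℝ (F m) A (0, 1) = _
    rw [hF, hΨ.fderiv_eulerIntegral hc l₁ m hA, hw]
    simp
  have hDO : ∀ a ∈ N, (a, (0 : ℂ)) ∈ O := fun a ha => ⟨ha, Metric.mem_ball_self hε⟩
  have hf : EqOn (fun a => period e a (L a))
      (fun a => 1 / (4 * (Real.pi : ℂ) ^ 3) * G 0 1 (a, 0)) N := by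
    intro a ha
    simp only
    rw [hper a ha, hG1 0 _ (hDO a ha)]
  -- An Euler operator arises whenever the weight of the field is the same `s` that multiplies the
  -- level in $dF(\xi)=s\,z+\sum w_ka_kW^{e_k}$.
  have hscal : ∀ (l : Fin 4 → ℂ) (s : ℂ) (w : Fin K → ℤ), eulerWeight l 0 = s →
      (∀ A : (Fin K → ℂ) × ℂ, ∀ p ∈ torusDomain, mirrorF e A.1 p = A.2 →
        mirrorDeriv e A.1 p (l * p) = s * A.2 + ∑ k, w k * A.1 k * torusMonomial (e k) p) →
      scalingOp w (fun a => period e a (L a)) a₁ = 0 := by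
    intro l s w hs hl
    refine hG.scalingOp_eq_zero hNo hDO hf
      (M := familyIntegral (fun p v => eulerForm l 0 p v) Ψ c) (s := s) ?_ ?_ haN
    · intro A hA
      simp only [hG1 _ A hA]
      exact hΨ.eulerIntegral_eq c hA fun p hp hz => hl A p hp hz
    · intro A hA
      rw [hΨ.fderiv_eulerIntegral hc l 0 hA, hs, hG1 0 A hA]
      simp
  refine ⟨?_, ?_, ?_, ?_, ?_⟩
  · have h1 : ContDiffOn ℂ ∞ (fun a => 1 / (4 * (Real.pi : ℂ) ^ 3) * G 0 1 (a, 0)) N :=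
      contDiffOn_const.mul ((hG.contDiffOn_zeroLevel 0 1).mono hDO)
    exact (h1.congr hf).contDiffAt (hNo.mem_nhds haN)
  · exact fun l hl hle => hG.boxOp_eq_zero hNo hDO hf hl hle haN
  -- Here $dF(\xi)=-(U^2+V^2)$, which on the level set is $-z+\sum a_kW^{e_k}$; the weight is
  -- $-\frac12-\frac12=-1$.
  · refine hscal ![-1 / 2, -1 / 2, 0, 0] (-1) _ (by simp [eulerWeight]) ?_
    intro A p hp hz
    rw [mirrorDeriv_mul _ hp, ← hz, mirrorF_eq]
    simp
    ring
  -- The torus field $W_1\partial_{W_1}$ preserves $\Omega$, so the weight is 0, and $dF(\xi)$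
  -- weights each term of `F` by the exponent of $W_1$.
  · refine hscal ![0, 0, 1, 0] 0 _ (by simp [eulerWeight]) ?_
    intro A p hp hz
    rw [mirrorDeriv_mul _ hp]
    simp
  · refine hscal ![0, 0, 0, 1] 0 _ (by simp [eulerWeight]) ?_
    intro A p hp hz
    rw [mirrorDeriv_mul _ hp]
    simp

end Periods

end LocalMirror

theorem proposition6p2 (G : Subgroup SL(3, ℂ)) [Finite G] [IsMulCommutative G]
    -- coordinates of `ℂ³` in which `G` is diagonal
    (P : GL (Fin 3) ℂ)
    (hP : ∀ g ∈ G, ((P : Matrix (Fin 3) (Fin 3) ℂ) * (g : Matrix (Fin 3) (Fin 3) ℂ) *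
      ((P⁻¹ : GL (Fin 3) ℂ) : Matrix (Fin 3) (Fin 3) ℂ)).IsDiag)
    -- the generators of the one-dimensional cones of the fan of `G`-Hilb
    (r : ℕ) (ν : Fin (r + 3) → LocalMirror.latticeN G P) (hν : Function.Injective ν)
    (hrays : Set.range ν = LocalMirror.rayGenerators G P)
    -- the isomorphism `N_G ≃ ℤ³` with `φ (ν k) = (1, e k)`
    (φ : LocalMirror.latticeN G P ≃+ (Fin 3 → ℤ)) (e : Fin (r + 3) → Fin 2 → ℤ)
    (hφ : ∀ k, φ (ν k) = ![1, e k 0, e k 1]) :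
    -- the period of a homology class is the integral over any cycle in the class
    (∀ (a : Fin (r + 3) → ℂ) (c : LocalMirror.cycles3 (LocalMirror.mirrorYreg e a)),
      LocalMirror.period e a (LocalMirror.H3.mk c) = LocalMirror.chainPeriod e a c) ∧
    -- every class extends to a flat family of classes over nearby parameters
    (∀ (a₀ : Fin (r + 3) → ℂ) (L₀ : LocalMirror.H3 (LocalMirror.mirrorYreg e a₀)),
      ∃ D : Set (Fin (r + 3) → ℂ), IsOpen D ∧ a₀ ∈ D ∧
        ∃ L : ∀ a, LocalMirror.H3 (LocalMirror.mirrorYreg e a),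
          LocalMirror.IsFlat e D L ∧ L a₀ = L₀) ∧
    -- the periods of every flat family are holomorphic and satisfy the GKZ system
    (∀ D : Set (Fin (r + 3) → ℂ), IsOpen D →
      ∀ L : ∀ a, LocalMirror.H3 (LocalMirror.mirrorYreg e a), LocalMirror.IsFlat e D L →
        ContDiffOn ℂ ∞ (fun a => LocalMirror.period e a (L a)) D ∧
        ∀ a ∈ D,
          (∀ l ∈ LocalMirror.relationLattice ν,
            LocalMirror.boxOp l (fun a => LocalMirror.period e a (L a)) a = 0) ∧
          LocalMirror.scalingOp (fun _ => 1) (fun a => LocalMirror.period e a (L a)) a = 0 ∧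
          LocalMirror.scalingOp (fun k => e k 0) (fun a => LocalMirror.period e a (L a)) a = 0 ∧
          LocalMirror.scalingOp (fun k => e k 1) (fun a => LocalMirror.period e a (L a)) a = 0) := by
  refine ⟨fun a c => LocalMirror.period_mk a c, LocalMirror.exists_isFlat, ?_⟩
  refine fun D _ L hL => ⟨fun a ha => (hL.period_gkz ha).1.contDiffWithinAt, fun a ha => ?_⟩
  obtain ⟨-, hbox, h1, h2, h3⟩ := hL.period_gkz ha
  refine ⟨fun l hl => ?_, h1, h2, h3⟩
  -- Through `φ` a relation among the rays becomes one among the vectors $(1,e_k)$. The first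
  -- coordinate gives `∑ k, l k = 0`, which equates the orders of the two derivatives; the others
  -- give `∑ k, l k • e k = 0`.
  have hrel : ∑ k, l k • (![1, e k 0, e k 1] : Fin 3 → ℤ) = 0 := by
    have h : φ (∑ k, l k • ν k) = 0 := by
      rw [show ∑ k, l k • ν k = 0 from hl, map_zero]
    simpa only [map_sum, map_zsmul, hφ] using h
  have h0 := congrFun hrel 0
  have h1 := congrFun hrel 1
  have h2 := congrFun hrel 2
  simp only [Finset.sum_apply, Pi.smul_apply, Pi.zero_apply, smul_eq_mul] at h0 h1 h2
  refine hbox l (by simpa using h0) ?_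
  ext i
  fin_cases i
  · simpa [Finset.sum_apply] using h1
  · simpa [Finset.sum_apply] using h2
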